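/- Let $\alpha=\sqrt5$, $\omega=(\alpha+1)/2$, $\beta=(\alpha-1)/2=\omega^{-1}$, $\mathbb{Q}(\sqrt5)=\{x+y\alpha : x,y\in\mathbb{Q}\}$ and $\mathbf{u}_m=(\cos\frac{2\pi m}5,\sin\frac{2\pi m}5)$, $m=0,\dots,4$. A *tile* $[(m_1,\dots,m_n),(\epsilon_1,\dots,\epsilon_n),(b_1,\dots,b_n)]$ is the convex polygon defined by the conditions $\mathbf{u}_{m_i}\cdot\mathbf{x}<b_i$ if $\epsilon_i=1$ and $\mathbf{u}_{m_i}\cdot\mathbf{x}\ge b_i$ if $\epsilon_i=-1$. Points and vectors are written in the coordinates $(\mathbf{u}_0\cdot\mathbf{x},\mathbf{u}_1\cdot\mathbf{x})$; $\mathtt{R}_m$ is the rotation by $2\pi m/5$ about the origin, $\mathtt{T}_{\mathbf d}$ the translation by $\mathbf d$. A *dressed domain* $\mathcal X$ is a domain partitioned into finitely many tiles (atoms), with an orientation-preserving isometry $\mathtt{T}_{\mathbf d}\mathtt{R}_m$ attached to each atom which maps it into the domain. $\mathcal Y$ is a *dressed sub-domain* of $\mathcal X$ (written $\mathcal X\triangleright\mathcal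 Y$) if its map is the first-return map induced on it by the map of $\mathcal X$. Dressed domains are *similar* ($\sim$) if they are conjugate under the group generated by the symmetries of the regular pentagon, the translations, and the homotheties of positive ratio. $\mathcal Y$ *recursively tiles* $\mathcal X$ if the return orbits of the atoms of $\mathcal Y$ and the orbits of finitely many periodic tiles (tiles mapped onto themselves after finitely many steps, each intermediate image lying in one atom; degenerate tiles are allowed) are disjoint and cover $\mathcal X$. The *bifurcation-free set* of a parametric family of tiles is the largest open set of parameters at which all edges of all the tiles have non-zero length. **The rhombus map.** For real parameters $(s,t)$ let $\mathcal R$ be the dressed domain on $R=[(0,1,0,1),(-1,-1,1,1),(-t,-s,1-t,1-s)]$ with atoms $R_1=[(0,2,1),(-1,-1,1),(-t,-s,1-s)]$, $R_2=[(0,1,2,0,1,2),(-1,-1,-1,1,1,1),(-t,-t,-1-s,1-t,1-s,-s)]$, $R_3=[(0,2,1),(1,1,-1),(1-t,-1-s,-t)]$, $R_4=[(0,1,2,1),(-1,-1,-1,1),(-t,-s,-1-s,-t)]$, $R_5=[(1,0,1,2),(-1,1,1,1),(-s,1-t,-t,-1-s)]$ and isometries $\mathtt{T}_{\mathbf d}\mathtt{R}_4$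 with $\mathbf d=(0,0),(0,1),(0,2),(1,1),(1,2)$ respectively. **The domain $\mathcal A$.** Let $\mathcal A$ be the dressed domain on $A=[(2,1,0),(1,-1,1),(-1-s,\beta^4-s,1-s)]$ with atoms $A_1=[(1,0,4),(-1,1,-1),(\beta^4-t,1-s,\alpha\beta^4-t)]$, $A_2=[(1,4,0,4),(-1,1,1,-1),(\beta^4-t,\alpha\beta^4-t,1-s,\alpha\beta^4-s)]$, $A_3=[(0,1,4,1),(1,1,-1,-1),(1-s,\beta^4-t,\alpha\beta^4-t,\beta^4-s)]$, $A_4=[(4,1,4,1),(1,1,-1,-1),(\alpha\beta^4-t,\beta^4-t,\alpha\beta^4-s,\beta^4-s)]$, $A_5=[(2,1,4,0,3),(1,-1,1,1,-1),(-1-s,\beta^4-t,\alpha\beta^4-s,1-s,-4\beta^3-t)]$, $A_6=[(2,3,0,3),(1,1,1,-1),(-1-s,-4\beta^3-t,1-s,-4\beta^3-s)]$, $A_7=[(2,1,4,1),(1,-1,1,1),(-1-s,\beta^4-s,\alpha\beta^4-s,\beta^4-t)]$, $A_8=[(2,3,0),(1,1,1),(-1-s,-4\beta^3-s,1-s)]$,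 with the isometry $\mathtt{T}_{(8\beta^3,-2\beta^5)}\mathtt{R}_2$ on $A_1,\dots,A_4$, $\mathtt{T}_{(2,1+\beta^5)}\mathtt{R}_3$ on $A_5,A_6,A_7$, and $\mathtt{T}_{(2-\beta^6,-\beta^5)}\mathtt{R}_2$ on $A_8$. Let $\mathcal C$ be the domain obtained from $\mathcal A$ by merging the atoms that share an isometry: $C=A$, $C_1=A_8$, $C_2=A_5\cup A_6\cup A_7$, $C_3=A_1\cup A_2\cup A_3\cup A_4$, with the corresponding isometries. **Base triangles.** $\mathcal B=\mathcal B(\tau)$ is the dressed domain on $B=[(1,0,2),(-1,1,1),(\tau-\omega^2,0,0)]$ with atoms $B_1=[(0,2,3),(1,1,1),(0,0,\omega-\omega\tau)]$, $B_2=[(1,4,0,3,2),(-1,1,1,-1,1),(\tau-\omega^2,\omega^2-\omega\tau,0,\omega-\omega\tau,0)]$, $B_3=[(1,0,4),(-1,1,-1),(\tau-\omega^2,0,\omega^2-\omega\tau)]$ and isometries $\mathtt{T}_{(\omega\tau-\omega,-\omega^2+\omega^2\tau)}\mathtt{R}_2$, $\mathtt{T}_{(0,\omega^2\tau-\omega^3)}\mathtt{R}_3$,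 $\mathtt{T}_{(\omega\tau-2\omega,\omega^2\tau-2\omega^2)}\mathtt{R}_2$; $\tilde{\mathcal B}(\tau)$ is obtained from it by changing the signs of all $b_i$, $\epsilon_i$ and translation vectors. The renormalization function is $r(\tau)=\omega^2\tau$ on $(0,\beta^2)$, $r(\tau)=\omega^3(\beta-\tau)$ on $(\beta^2,\beta)$, $r(\tau)=\omega^2(1-\tau)$ on $(\beta,1)$, and $r(0)=r(\beta^2)=r(\beta)=0$. **Theorem.** 1. The bifurcation-free set $\Pi(\mathcal A)$ of the atoms of $\mathcal A$ is the open triangle of parameters $(s,t)$ with vertices $(-1+\frac2\alpha,-1+\frac2\alpha)$, $(\frac{11-5\alpha}2,\frac{-25+11\alpha}4)$, $(\frac{11-5\alpha}2,\frac{11-5\alpha}2)$, and it is contained in the bifurcation-free set of the atoms of $\mathcal R$. 2. (Triple induction.) There is a triangular tile $R_{31}(s,t)$, with edge coordinates affine in $(s,t)$ over $\mathbb Q(\sqrt5)$, such that for all $(s,t)\in\Pi(\mathcal A)$ one has $A\subsetneq R_{31}\subsetneq R_3$, and there are dressed domains $\mathcal R_3$ on $R_3$ and $\mathcal R_{31}$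 on $R_{31}$ with $\mathcal R\triangleright\mathcal R_3\triangleright\mathcal R_{31}\triangleright\mathcal A$. In particular $\mathcal R\triangleright\mathcal A$. 3. (Tiling.) There are 13 tiles, with edge coordinates affine in $(s,t)$ over $\mathbb Q(\sqrt5)$, such that for all $(s,t)\in\Pi(\mathcal A)$ they have non-empty interior and are periodic under $\mathcal R$, with 13 cyclic itineraries that are pairwise distinct and independent of $(s,t)$; the atoms $A_1,\dots,A_8$ return to $A$ along eight distinct paths of atoms of $\mathcal R$ that are independent of $(s,t)$, those of $A_1,\dots,A_4$ having 78 steps; and the return orbits of $A_1,\dots,A_8$ together with the orbits of the 13 periodic tiles tile the rhombus $R$, edges included. So do the return orbits of $C_1,C_2,C_3$ together with the orbits of the same 13 tiles. 4. (Merging.) For all $(s,t)\in\Pi(\mathcal A)=:\Pi(\mathcal C)$, $\mathcal C$ is a dressed sub-domain of $\mathcal R$; its shape parameter $\tau_{\mathcal C}=\omega^2\eta/(1+\eta)$, where $\eta$ is the ratio of the altitude of the isosceles triangle $C_3$ to that of $C$, is $\tau_{\mathcal C}=\omega^7(\sqrt5\,s+\beta^3)\in(0,1)$; and $\mathcal C\sim\mathcal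 B(\tau_{\mathcal C})$. 5. (Renormalization.) For $0<\tau<1$, each of $\mathcal B(\tau)$, $\tilde{\mathcal B}(\tau)$, and also $\mathcal B(0)$, is recursively tiled by a dressed sub-domain which is a copy, scaled by a factor less than 1, of the following base triangle: of the same kind with parameter $r(\tau)$ if $0<\tau<\beta^2$; of the other kind with parameter $r(\tau)$ if $\beta^2<\tau<\beta$ or $\beta<\tau<1$; $\mathcal B(0)$ if $\tau\in\{0,\beta^2,\beta\}$. 6. (Self-similarity.) Consequently, over $\Pi(\mathcal C)$ the map $\mathcal R$ renormalizes through $\mathcal C\sim\mathcal B(\tau_{\mathcal C})$, which recursively tiles it, and $\mathcal R$ is self-similar (that is, the parameter $\tau_{\mathcal C}$ of the base triangle is eventually periodic under the renormalization function $r$) if and only if $s\in\mathbb Q(\sqrt5)$, with no condition on $t$. -/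

import Mathlib

open Set

namespace RhombusPWI

noncomputable section

/-! ### The field and the plane -/

/-- `α = √5`. -/
def α : ℝ := Real.sqrt 5

/-- `ω = (√5 + 1) / 2`. -/
def ω : ℝ := (α + 1) / 2

/-- `β = ω⁻¹ = (√5 - 1) / 2`. -/
def β : ℝ := (α - 1) / 2

/-- The field `ℚ(√5) = {x + y √5 : x, y ∈ ℚ}`, as a set of real numbers. -/
def QSqrt5 : Set ℝ := {z | ∃ x y : ℚ, z = x + y * α}

/-- The plane in pentagonal coordinates: the pair `x` stands for the point of the Euclidean plane
whose scalar products with the unit vectors `u₀ = (1, 0)` and `u₁ = (cos (2π/5), sin (2π/5))` are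
`x.1` and `x.2`. In these coordinates the rhombus becomes a unit square. -/
abbrev Plane : Type := ℝ × ℝ

/-- The scalar product with `u_m = (cos (2πm/5), sin (2πm/5))`, in pentagonal coordinates
(by the relation `u_{m+1} + u_{m-1} = β u_m`). -/
def dotU (m : Fin 5) (x : Plane) : ℝ :=
  match m with
  | 0 => x.1
  | 1 => x.2
  | 2 => -x.1 + β * x.2
  | 3 => -β * x.1 - β * x.2
  | 4 => β * x.1 - x.2

/-- The counterclockwise Euclidean rotation by `2π/5` about the origin, in pentagonal coordinates:
`u₀ · Rx = u₄ · x` and `u₁ · Rx = u₀ · x`. -/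
def rotate (x : Plane) : Plane := (β * x.1 - x.2, x.1)

/-- The Euclidean reflection about the line spanned by `u₀`, in pentagonal coordinates. -/
def reflect (x : Plane) : Plane := (x.1, β * x.1 - x.2)

/-! ### Tiles -/

/-- Half-plane data of a tile: a list of triples `(m, ε, b)`. The triple stands for the condition
`u_m · x < b` if `ε = 1` (excluded edge) and for `u_m · x ≥ b` if `ε = -1` (included edge). -/
abbrev Tile : Type := List (Fin 5 × ℤ × ℝ)

/-- The tile `[(m₁, …, mₙ), (ε₁, …, εₙ), (b₁, …, bₙ)]`. -/
def tile (ms : List (Fin 5)) (es : List ℤ) (bs : List ℝ) : Tile := ms.zip (es.zip bs)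

/-- The set of points of a tile. -/
def Tile.carrier (T : Tile) : Set Plane :=
  {x | ∀ c ∈ T, if c.2.1 = 1 then dotU c.1 x < c.2.2 else c.2.2 ≤ dotU c.1 x}

/-- The closed edge of `T` on the line `u_m · x = b` of the condition `c = (m, ε, b)`. -/
def Tile.edge (T : Tile) (c : Fin 5 × ℤ × ℝ) : Set Plane :=
  {x | dotU c.1 x = c.2.2 ∧
    ∀ d ∈ T, if d.2.1 = 1 then dotU d.1 x ≤ d.2.2 else d.2.2 ≤ dotU d.1 x}

/-- Change of sign of all edge coordinates and of all inclusion indices. -/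
def Tile.neg (T : Tile) : Tile := T.map fun c => (c.1, -c.2.1, -c.2.2)

/-- `S` is a bounded convex polygon given by finitely many half-plane conditions with normals
`u₀, …, u₄`, each of its edges being included or excluded. (Degenerate polygons are allowed.) -/
def IsTile (S : Set Plane) : Prop := (∃ T : Tile, S = T.carrier) ∧ Bornology.IsBounded S

/-- A two-parameter tile: the condition `(m, ε, (a₀, a₁, a₂))` has edge coordinate
`a₀ + a₁ s + a₂ t`. -/
abbrev ParamTile : Type := List (Fin 5 × ℤ × (ℝ × ℝ × ℝ))

/-- The tile at the parameter values `s, t`. -/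
def ParamTile.at (T : ParamTile) (s t : ℝ) : Tile :=
  T.map fun c => (c.1, c.2.1, c.2.2.1 + c.2.2.2.1 * s + c.2.2.2.2 * t)

/-- The edge coordinates are affine functions of the parameters with coefficients in `ℚ(√5)`. -/
def ParamTile.OverQSqrt5 (T : ParamTile) : Prop :=
  ∀ c ∈ T, c.2.2.1 ∈ QSqrt5 ∧ c.2.2.2.1 ∈ QSqrt5 ∧ c.2.2.2.2 ∈ QSqrt5

/-- The bifurcation-free set of a family of tiles with parameters `(s, t)`: the largest open set of
parameters at which all the edges of all the tiles have non-zero length. -/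
def bifurcationFree {n : ℕ} (X : ℝ → ℝ → Fin n → Tile) : Set (ℝ × ℝ) :=
  interior {p | ∀ k, ∀ c ∈ X p.1 p.2 k, ((X p.1 p.2 k).edge c).Nontrivial}

/-! ### Isometries, similarities, dressed domains -/

/-- An orientation-preserving isometry `T_d R_m`: rotation by `2πm/5` followed by translation. -/
structure Isom where
  trans : Plane
  rot : ℕ

/-- The action of an isometry on the plane. -/
def Isom.apply (g : Isom) (x : Plane) : Plane := rotate^[g.rot] x + g.trans

/-- An element of the group generated by the symmetries of the regular pentagon, the translations
and the homotheties with positive ratio. -/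
structure Similarity where
  refl : Bool
  rot : ℕ
  scale : ℝ
  scale_pos : 0 < scale
  trans : Plane

/-- The action of a similarity on the plane. -/
def Similarity.apply (G : Similarity) (x : Plane) : Plane :=
  G.scale • rotate^[G.rot] (if G.refl then reflect x else x) + G.trans

/-- The data of a dressed domain with `n` atoms: a domain, its atoms, and an isometry for each. -/
structure DressedDomain (n : ℕ) where
  dom : Set Plane
  atom : Fin n → Set Plane
  iso : Fin n → Isom

namespace DressedDomain

variable {m n : ℕ}

/-- The atoms are tiles, they form a partition of the domain, and their isometries map them into
the domain. -/
def IsDressed (X : DressedDomain n) : Prop :=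
  (∀ k, IsTile (X.atom k)) ∧ Pairwise (fun i j => Disjoint (X.atom i) (X.atom j)) ∧
    ⋃ k, X.atom k = X.dom ∧ ∀ k, ∀ x ∈ X.atom k, (X.iso k).apply x ∈ X.dom

open Classical in
/-- The piecewise isometry of a dressed domain (extended by the identity outside its domain). -/
def map (X : DressedDomain n) (x : Plane) : Plane :=
  if h : ∃ k, x ∈ X.atom k then (X.iso h.choose).apply x else x

/-- `Y` is a dressed sub-domain of `X`: its domain lies in that of `X`, and its isometries give
the first-return map on it of the piecewise isometry of `X`. -/
def IsSubdomain (Y : DressedDomain m) (X : DressedDomain n) : Prop :=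
  Y.IsDressed ∧ Y.dom ⊆ X.dom ∧
    ∀ k, ∀ x ∈ Y.atom k, ∃ j, 0 < j ∧ X.map^[j] x = (Y.iso k).apply x ∧
      X.map^[j] x ∈ Y.dom ∧ ∀ i, 0 < i → i < j → X.map^[i] x ∉ Y.dom

/-- `Y` is the image of `X` under the similarity `G`. -/
def IsImage (G : Similarity) (X Y : DressedDomain n) : Prop :=
  Y.dom = G.apply '' X.dom ∧ ∀ k, Y.atom k = G.apply '' X.atom k ∧
    ∀ x, (Y.iso k).apply (G.apply x) = G.apply ((X.iso k).apply x)

/-- Similarity of dressed domains. -/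
def Similar (X Y : DressedDomain n) : Prop := ∃ G : Similarity, IsImage G X Y

/-- The images at time `i` of those points of `S` that have not returned to `D` at the times
`1, …, i`. For `S ⊆ D`, these sets make up the return orbit of `S`. -/
def returnLevel (X : DressedDomain n) (D S : Set Plane) (i : ℕ) : Set Plane :=
  X.map^[i] '' {x ∈ S | ∀ j, 0 < j → j ≤ i → X.map^[j] x ∉ D}

/-- All the images of `S` along the finite path `w` of atoms of `X` lie in the atoms of the path. -/
def Follows (X : DressedDomain n) (S : Set Plane) (w : List (Fin n)) : Prop :=
  ∀ i (h : i < w.length), X.map^[i] '' S ⊆ X.atom w[i]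

/-- The set `S` returns as a whole to `D`, for the first time, along the path `w`. -/
def HasReturnPath (X : DressedDomain n) (D S : Set Plane) (w : List (Fin n)) : Prop :=
  w ≠ [] ∧ X.Follows S w ∧ X.map^[w.length] '' S ⊆ D ∧
    ∀ i, 0 < i → i < w.length → Disjoint (X.map^[i] '' S) D

/-- `P` is a non-empty tile which is mapped onto itself along the path `w`. -/
def IsPeriodicTile (X : DressedDomain n) (P : Set Plane) (w : List (Fin n)) : Prop :=
  IsTile P ∧ P.Nonempty ∧ w ≠ [] ∧ X.Follows P w ∧ X.map^[w.length] '' P = P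

/-- The return orbits of the atoms of `Y`, together with the orbits of the sets `P j` (of length
`p j`), tile the domain of `X`: all the sets in these orbits are disjoint, and cover it. -/
def TiledBy (X : DressedDomain n) (Y : DressedDomain m) {N : ℕ} (P : Fin N → Set Plane)
    (p : Fin N → ℕ) : Prop :=
  let S : (Fin m × ℕ) ⊕ (Σ j : Fin N, Fin (p j)) → Set Plane :=
    Sum.elim (fun a => X.returnLevel Y.dom (Y.atom a.1) a.2) (fun a => X.map^[a.2] '' P a.1)
  Pairwise (fun a b => Disjoint (S a) (S b)) ∧ ⋃ a, S a = X.dom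

/-- The recursive tiling property: the return orbits of the atoms of `Y`, together with the orbits
of finitely many periodic tiles, tile the domain of `X`. -/
def RecursivelyTiles (Y : DressedDomain m) (X : DressedDomain n) : Prop :=
  ∃ (N : ℕ) (P : Fin N → Set Plane) (w : Fin N → List (Fin n)),
    (∀ j, X.IsPeriodicTile (P j) (w j)) ∧ X.TiledBy Y P fun j => (w j).length

/-- The family `F` of dressed domains is renormalizable over the set `D` of parameters, with
renormalization function `r`: each `F p` has a dressed sub-domain which recursively tiles it and is
a copy of `F (r p)` on a smaller scale. -/
def RenormalizableVia {ι : Type*} (F : ι → DressedDomain n) (D : Set ι) (r : ι → ι) : Prop :=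
  ∀ p ∈ D, r p ∈ D ∧ ∃ (Y : DressedDomain n) (G : Similarity), G.scale < 1 ∧
    IsImage G (F (r p)) Y ∧ Y.IsSubdomain (F p) ∧ Y.RecursivelyTiles (F p)

/-- `X` is self-similar through its dressed sub-domain `Y`: the latter recursively tiles `X` and is
similar to the member `F q` of a renormalizable family, whose parameter `q` is eventually periodic
under the renormalization function. -/
def SelfSimilarVia {ι : Type*} (X : DressedDomain m) (Y : DressedDomain n)
    (F : ι → DressedDomain n) (D : Set ι) (r : ι → ι) (q : ι) : Prop :=
  Y.IsSubdomain X ∧ Y.RecursivelyTiles X ∧ Similar (F q) Y ∧ RenormalizableVia F D r ∧ q ∈ D ∧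
    ∃ k, r^[k] q ∈ Function.periodicPts r

end DressedDomain

/-! ### The two-parameter rhombus map -/

/-- The five atoms of the rhombus. -/
def rhombusAtom (s t : ℝ) : Fin 5 → Tile := ![
  tile [0, 2, 1] [-1, -1, 1] [-t, -s, 1 - s],
  tile [0, 1, 2, 0, 1, 2] [-1, -1, -1, 1, 1, 1] [-t, -t, -1 - s, 1 - t, 1 - s, -s],
  tile [0, 2, 1] [1, 1, -1] [1 - t, -1 - s, -t],
  tile [0, 1, 2, 1] [-1, -1, -1, 1] [-t, -s, -1 - s, -t],
  tile [1, 0, 1, 2] [-1, 1, 1, 1] [-s, 1 - t, -t, -1 - s]]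

/-- The dressed domain `ℛ` with parameters `s, t`. -/
def rhombus (s t : ℝ) : DressedDomain 5 where
  dom := (tile [0, 1, 0, 1] [-1, -1, 1, 1] [-t, -s, 1 - t, 1 - s]).carrier
  atom k := (rhombusAtom s t k).carrier
  iso := ![⟨(0, 0), 4⟩, ⟨(0, 1), 4⟩, ⟨(0, 2), 4⟩, ⟨(1, 1), 4⟩, ⟨(1, 2), 4⟩]

/-! ### The induced domains `𝒜` and `𝒞` -/

/-- The eight atoms `A₁, …, A₈`. -/
def atomA (s t : ℝ) : Fin 8 → Tile := ![
  tile [1, 0, 4] [-1, 1, -1] [β ^ 4 - t, 1 - s, α * β ^ 4 - t],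
  tile [1, 4, 0, 4] [-1, 1, 1, -1] [β ^ 4 - t, α * β ^ 4 - t, 1 - s, α * β ^ 4 - s],
  tile [0, 1, 4, 1] [1, 1, -1, -1] [1 - s, β ^ 4 - t, α * β ^ 4 - t, β ^ 4 - s],
  tile [4, 1, 4, 1] [1, 1, -1, -1] [α * β ^ 4 - t, β ^ 4 - t, α * β ^ 4 - s, β ^ 4 - s],
  tile [2, 1, 4, 0, 3] [1, -1, 1, 1, -1]
    [-1 - s, β ^ 4 - t, α * β ^ 4 - s, 1 - s, -4 * β ^ 3 - t],
  tile [2, 3, 0, 3] [1, 1, 1, -1] [-1 - s, -4 * β ^ 3 - t, 1 - s, -4 * β ^ 3 - s],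
  tile [2, 1, 4, 1] [1, -1, 1, 1] [-1 - s, β ^ 4 - s, α * β ^ 4 - s, β ^ 4 - t],
  tile [2, 3, 0] [1, 1, 1] [-1 - s, -4 * β ^ 3 - s, 1 - s]]

/-- The common isometry of `A₁, A₂, A₃, A₄`. -/
def isoA1 : Isom := ⟨(8 * β ^ 3, -2 * β ^ 5), 2⟩

/-- The common isometry of `A₅, A₆, A₇`. -/
def isoA5 : Isom := ⟨(2, 1 + β ^ 5), 3⟩

/-- The isometry of `A₈`. -/
def isoA8 : Isom := ⟨(2 - β ^ 6, -β ^ 5), 2⟩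

/-- The dressed domain `𝒜`. -/
def domA (s t : ℝ) : DressedDomain 8 where
  dom := (tile [2, 1, 0] [1, -1, 1] [-1 - s, β ^ 4 - s, 1 - s]).carrier
  atom k := (atomA s t k).carrier
  iso := ![isoA1, isoA1, isoA1, isoA1, isoA5, isoA5, isoA5, isoA8]

/-- The dressed domain `𝒞`, obtained from `𝒜` by merging the atoms that have the same isometry:
`C₁ = A₈`, `C₂ = A₅ ∪ A₆ ∪ A₇`, `C₃ = A₁ ∪ A₂ ∪ A₃ ∪ A₄`. -/
def domC (s t : ℝ) : DressedDomain 3 where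
  dom := (domA s t).dom
  atom := ![(domA s t).atom 7,
    (domA s t).atom 4 ∪ (domA s t).atom 5 ∪ (domA s t).atom 6,
    (domA s t).atom 0 ∪ (domA s t).atom 1 ∪ (domA s t).atom 2 ∪ (domA s t).atom 3]
  iso := ![isoA8, isoA5, isoA1]

/-- The open triangle of parameters `(s, t)` over which `𝒜` and `𝒞` are considered. -/
def paramTriangle : Set (ℝ × ℝ) :=
  interior (convexHull ℝ {(-1 + 2 / α, -1 + 2 / α),
    ((11 - 5 * α) / 2, (-25 + 11 * α) / 4), ((11 - 5 * α) / 2, (11 - 5 * α) / 2)})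

/-- The Euclidean width of `S` in the direction `u_m`. -/
def width (m : Fin 5) (S : Set Plane) : ℝ := sSup (dotU m '' S) - sInf (dotU m '' S)

/-- The shape parameter `τ = ω² η / (1 + η)` of `𝒞`, where `η` is the ratio of the altitude of the
isosceles triangle `C₃` (over its side normal to `u₀`) to the altitude of the isosceles triangle
`C` (over its side normal to `u₁`). -/
def shapeC (s t : ℝ) : ℝ :=
  let η := width 0 ((domC s t).atom 2) / width 1 (domC s t).dom
  ω ^ 2 * η / (1 + η)

/-! ### The base triangles -/

/-- The triangle `B`. -/
def baseTriangle (τ : ℝ) : Tile := tile [1, 0, 2] [-1, 1, 1] [τ - ω ^ 2, 0, 0]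

/-- The three atoms of `B`. -/
def baseAtom (τ : ℝ) : Fin 3 → Tile := ![
  tile [0, 2, 3] [1, 1, 1] [0, 0, ω - ω * τ],
  tile [1, 4, 0, 3, 2] [-1, 1, 1, -1, 1] [τ - ω ^ 2, ω ^ 2 - ω * τ, 0, ω - ω * τ, 0],
  tile [1, 0, 4] [-1, 1, -1] [τ - ω ^ 2, 0, ω ^ 2 - ω * τ]]

/-- The translation vectors of the three isometries of `B`. -/
def baseTrans (τ : ℝ) : Fin 3 → Plane := ![
  (ω * τ - ω, -ω ^ 2 + ω ^ 2 * τ),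
  (0, ω ^ 2 * τ - ω ^ 3),
  (ω * τ - 2 * ω, ω ^ 2 * τ - 2 * ω ^ 2)]

/-- The base triangle `ℬ` (for `true`) with parameter `τ`, and its companion `ℬ̃` (for `false`), in
which all the edge coordinates, inclusion indices and translation vectors change their signs. -/
def base : Bool × ℝ → DressedDomain 3
  | (true, τ) =>
    { dom := (baseTriangle τ).carrier
      atom := fun k => (baseAtom τ k).carrier
      iso := fun k => ⟨baseTrans τ k, ![2, 3, 2] k⟩ }
  | (false, τ) =>
    { dom := (baseTriangle τ).neg.carrier
      atom := fun k => (baseAtom τ k).neg.carrier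
      iso := fun k => ⟨-baseTrans τ k, ![2, 3, 2] k⟩ }

/-- The parameters of the base triangles: `τ ∈ (0, 1)` for both kinds, and the limiting two-atom
case `τ = 0` of `ℬ`, in which the third atom is empty. -/
def baseParam : Set (Bool × ℝ) := {p | 0 < p.2 ∧ p.2 < 1} ∪ {(true, 0)}

/-- The renormalization function `r` of the base triangles: `r(τ) = ω² τ` on `(0, β²)`,
`r(τ) = ω³ (β - τ)` on `(β², β)`, `r(τ) = ω² (1 - τ)` on `(β, 1)`, and `r(τ) = 0` at the remaining
points. The second and the third branch exchange `ℬ` and `ℬ̃`. -/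
def baseRenorm (p : Bool × ℝ) : Bool × ℝ :=
  if 0 < p.2 ∧ p.2 < β ^ 2 then (p.1, ω ^ 2 * p.2)
  else if β ^ 2 < p.2 ∧ p.2 < β then (!p.1, ω ^ 3 * (β - p.2))
  else if β < p.2 ∧ p.2 < 1 then (!p.1, ω ^ 2 * (1 - p.2))
  else (true, 0)

end

end RhombusPWI

/-!
Everything in the theorem is piecewise linear over the ring `ℤ[ω]`, so that its geometric part can
be decided by exact arithmetic, uniformly in the parameters.

A tile is encoded (`CTile`) by half-plane conditions `n_d · x < f` or `n_d · x ≤ f`, where `n_d`,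
`d < 10`, are the vectors `± u_m`, and where `f` is a linear form with coefficients in `ℤ[ω]`. The
domain of the parameters is a triangle, an interval or a point; a point of it is written with
positive coordinates with respect to the vertices (`Verts`). A form is positive on the whole
domain if its coefficients are non-negative and not all zero, and signs in `ℤ[ω]` are decided by
integer arithmetic. One condition follows from two others by the identity `sin (i + j) n_{c + i} =
sin j n_c + sin i n_{c + i + j}` (`nd_interpolate`), and inclusion, disjointness and emptiness of
convex tiles are reduced to such implications. This yields boolean tests, evaluated by the kernel,
for the properties of a dressed domain (`CSys.Models.isDressed`), for first-return maps
(`CSys.Models.isSubdomain`), and for families of periodic tiles (`CSys.Models.periodicFamily`).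

The tiling properties are not checked by comparing areas or by intersecting all the tiles of the
orbits. By `tiledBy_of_hits` it suffices that the map of `X` is injective, that the induced map is
onto, that the itineraries of the periodic tiles are different, and that every orbit visits the
induced domain or a periodic tile. The last point is proved by a certificate (`Cert`): a binary
tree of cuts of the domain into tiles, each of which is moved by the map until it lies in a tile
known to consist of such points. For the rhombus this is done in three stages, along the chain `R
⊃ R₃ ⊃ R₃₁ ⊃ A` (`rhombus_subset_basin`); here the orbits of the periodic tiles serve as known
tiles as well.

For the bifurcation-free set, the edges are non-degenerate over the triangle by the same tests
(`edge_atomA`), while three particular edges force the three inequalities that define the triangle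
(`mem_paramTriangle_of_edges`).

The base triangles are treated by the same tests (`BaseCase.sound`), over each of the three
intervals between the discontinuities of the renormalization function `r` and at the single points
`0`, `β²` and `β`; the domain `𝒞` is identified with a base triangle in `similar_domC`.

The criterion for self-similarity is arithmetical (`eventually_periodic_iff`). The branches of `r`
are affine over `ℚ(√5)` with slopes `ω²`, `-ω³` and `-ω²`. So a periodic parameter is the fixed
point of an expanding affine function over `ℚ(√5)`, and lies in this field. Conversely, on the
elements of `ℚ(√5)` the function `r` preserves denominators, and the conjugates of its slopes are
contracting; hence an orbit consists of numbers with bounded denominators and bounded conjugates,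
of which there are finitely many.
-/

open Set

namespace RhombusPWI

section

/-! ### The ring `ℤ[ω]` -/

/-- The element `a + b ω` of the ring of integers of `ℚ(√5)`. -/
structure Zw where
  a : ℤ
  b : ℤ

namespace Zw

/-- The real number `a + b ω`. -/
noncomputable def val (x : Zw) : ℝ := x.a + x.b * ω

def add (x y : Zw) : Zw := ⟨x.a + y.a, x.b + y.b⟩
def sub (x y : Zw) : Zw := ⟨x.a - y.a, x.b - y.b⟩
def neg (x : Zw) : Zw := ⟨-x.a, -x.b⟩
def mul (x y : Zw) : Zw := ⟨x.a * y.a + x.b * y.b, x.a * y.b + x.b * y.a + x.b * y.b⟩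

/-- Multiplication by `ω`. -/
def mulω (x : Zw) : Zw := ⟨x.b, x.a + x.b⟩

/-- Multiplication by `β = ω - 1`. -/
def mulβ (x : Zw) : Zw := ⟨x.b - x.a, x.a⟩

/-- The test `0 ≤ p + q √5`. -/
def nonnegAux : ℤ → ℤ → Bool
  | Int.ofNat _, Int.ofNat _ => true
  | Int.ofNat p, Int.negSucc q => Nat.ble (5 * ((q + 1) * (q + 1))) (p * p)
  | Int.negSucc p, Int.ofNat q => Nat.ble ((p + 1) * (p + 1)) (5 * (q * q))
  | Int.negSucc _, Int.negSucc _ => false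

/-- The test `0 < p + q √5`. -/
def posAux : ℤ → ℤ → Bool
  | Int.ofNat p, Int.ofNat q => Nat.blt 0 (p + q)
  | Int.ofNat p, Int.negSucc q => Nat.blt (5 * ((q + 1) * (q + 1))) (p * p)
  | Int.negSucc p, Int.ofNat q => Nat.blt ((p + 1) * (p + 1)) (5 * (q * q))
  | Int.negSucc _, Int.negSucc _ => false

/-- The test `0 ≤ a + b ω`, in terms of `2 (a + b ω) = (2 a + b) + b √5`. -/
def nonneg (x : Zw) : Bool := nonnegAux (2 * x.a + x.b) x.b

/-- The test `0 < a + b ω`. -/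
def pos (x : Zw) : Bool := posAux (2 * x.a + x.b) x.b

/-- The test `a + b ω = 0`. -/
def isZero (x : Zw) : Bool := Nat.beq x.a.natAbs 0 && Nat.beq x.b.natAbs 0

end Zw

theorem α_sq : α ^ 2 = 5 := by
  simp [α]

theorem α_pos : 0 < α := by
  simp [α]

theorem α_eq : α = 2 * ω - 1 := by
  simp only [ω]; ring

theorem β_eq : β = ω - 1 := by
  simp only [ω, β]; ring

theorem ω_sq : ω ^ 2 = ω + 1 := by
  have := α_sq
  simp only [ω]; linarith

theorem ω_pos : 0 < ω := by
  have := α_pos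
  simp only [ω]; linarith

namespace Zw

theorem nonnegAux_sound {p q : ℤ} (h : nonnegAux p q = true) : 0 ≤ (p : ℝ) + q * α := by
  have h5 := α_sq
  have h0 := α_pos
  match p, q with
  | Int.ofNat p, Int.ofNat q =>
    have : (0 : ℝ) ≤ p := p.cast_nonneg
    have : (0 : ℝ) ≤ q * α := mul_nonneg q.cast_nonneg h0.le
    simp only [Int.ofNat_eq_natCast, Int.cast_natCast]; linarith
  | Int.ofNat p, Int.negSucc q =>
    have h' : 5 * ((q + 1) * (q + 1)) ≤ p * p := Nat.le_of_ble_eq_true h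
    have h'' : 5 * (((q : ℝ) + 1) * (q + 1)) ≤ p * p := by exact_mod_cast h'
    have : ((q : ℝ) + 1) * α ≤ p := by
      apply abs_le_of_sq_le_sq' _ p.cast_nonneg |>.2
      nlinarith
    simp only [Int.ofNat_eq_natCast, Int.cast_natCast, Int.cast_negSucc]
    push_cast
    linarith
  | Int.negSucc p, Int.ofNat q =>
    have h' : (p + 1) * (p + 1) ≤ 5 * (q * q) := Nat.le_of_ble_eq_true h
    have h'' : ((p : ℝ) + 1) * (p + 1) ≤ 5 * (q * q) := by exact_mod_cast h'
    have : (p : ℝ) + 1 ≤ q * α := by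
      apply abs_le_of_sq_le_sq' _ (mul_nonneg q.cast_nonneg h0.le) |>.2
      nlinarith
    simp only [Int.ofNat_eq_natCast, Int.cast_natCast, Int.cast_negSucc]
    push_cast
    linarith
  | Int.negSucc p, Int.negSucc q => simp [nonnegAux] at h

theorem posAux_sound {p q : ℤ} (h : posAux p q = true) : 0 < (p : ℝ) + q * α := by
  have h5 := α_sq
  have h0 := α_pos
  match p, q with
  | Int.ofNat p, Int.ofNat q =>
    have h' : 0 < p + q := Nat.le_of_ble_eq_true h
    have h1 : (1 : ℝ) ≤ p + q := by exact_mod_cast h'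
    have hq : (0 : ℝ) ≤ q := q.cast_nonneg
    have : 1 < α := by nlinarith
    simp only [Int.ofNat_eq_natCast, Int.cast_natCast]; nlinarith
  | Int.ofNat p, Int.negSucc q =>
    have h' : 5 * ((q + 1) * (q + 1)) < p * p := Nat.le_of_ble_eq_true h
    have h'' : 5 * (((q : ℝ) + 1) * (q + 1)) < p * p := by exact_mod_cast h'
    have : ((q : ℝ) + 1) * α < p := by
      apply abs_lt_of_sq_lt_sq' _ p.cast_nonneg |>.2
      nlinarith
    simp only [Int.ofNat_eq_natCast, Int.cast_natCast, Int.cast_negSucc]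
    push_cast
    linarith
  | Int.negSucc p, Int.ofNat q =>
    have h' : (p + 1) * (p + 1) < 5 * (q * q) := Nat.le_of_ble_eq_true h
    have h'' : ((p : ℝ) + 1) * (p + 1) < 5 * (q * q) := by exact_mod_cast h'
    have : (p : ℝ) + 1 < q * α := by
      apply abs_lt_of_sq_lt_sq' _ (mul_nonneg q.cast_nonneg h0.le) |>.2
      nlinarith
    simp only [Int.ofNat_eq_natCast, Int.cast_natCast, Int.cast_negSucc]
    push_cast
    linarith
  | Int.negSucc p, Int.negSucc q => simp [posAux] at h

theorem two_mul_val (x : Zw) : 2 * x.val = ((2 * x.a + x.b : ℤ) : ℝ) + x.b * α := by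
  simp only [val, ω]; push_cast; ring

theorem val_nonneg {x : Zw} (h : x.nonneg = true) : 0 ≤ x.val := by
  have := nonnegAux_sound h
  linarith [two_mul_val x]

theorem val_pos {x : Zw} (h : x.pos = true) : 0 < x.val := by
  have := posAux_sound h
  linarith [two_mul_val x]

theorem val_eq_zero {x : Zw} (h : x.isZero = true) : x.val = 0 := by
  simp only [isZero, Bool.and_eq_true, Nat.beq_eq, Int.natAbs_eq_zero] at h
  simp [val, h.1, h.2]

theorem val_add (x y : Zw) : (x.add y).val = x.val + y.val := by
  simp only [val, add]; push_cast; ring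

theorem val_sub (x y : Zw) : (x.sub y).val = x.val - y.val := by
  simp only [val, sub]; push_cast; ring

theorem val_neg (x : Zw) : x.neg.val = -x.val := by
  simp only [val, neg]; push_cast; ring

theorem val_mul (x y : Zw) : (x.mul y).val = x.val * y.val := by
  have := ω_sq
  simp only [val, mul]; push_cast
  linear_combination (-(x.b : ℝ) * y.b) * this

theorem val_mulω (x : Zw) : x.mulω.val = ω * x.val := by
  have := ω_sq
  simp only [val, mulω]; push_cast
  linear_combination (-(x.b : ℝ)) * this

theorem val_mulβ (x : Zw) : x.mulβ.val = β * x.val := by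
  have := ω_sq
  simp only [val, mulβ, β_eq]; push_cast
  linear_combination (-(x.b : ℝ)) * this

end Zw

/-! ### Linear forms on the cone of parameters -/

/-- A linear form in three real variables with coefficients in `ℤ[ω]`. -/
structure Form where
  x : Zw
  y : Zw
  z : Zw

namespace Form

/-- The value of a form. -/
noncomputable def eval (p : ℝ × ℝ × ℝ) (f : Form) : ℝ :=
  f.x.val * p.1 + f.y.val * p.2.1 + f.z.val * p.2.2

def zero : Form := ⟨⟨0, 0⟩, ⟨0, 0⟩, ⟨0, 0⟩⟩
def add (f g : Form) : Form := ⟨f.x.add g.x, f.y.add g.y, f.z.add g.z⟩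
def sub (f g : Form) : Form := ⟨f.x.sub g.x, f.y.sub g.y, f.z.sub g.z⟩
def neg (f : Form) : Form := ⟨f.x.neg, f.y.neg, f.z.neg⟩
def smul (c : Zw) (f : Form) : Form := ⟨c.mul f.x, c.mul f.y, c.mul f.z⟩
def mulω (f : Form) : Form := ⟨f.x.mulω, f.y.mulω, f.z.mulω⟩
def mulβ (f : Form) : Form := ⟨f.x.mulβ, f.y.mulβ, f.z.mulβ⟩

/-- All the coefficients are non-negative. -/
def nonneg (f : Form) : Bool := f.x.nonneg && f.y.nonneg && f.z.nonneg

/-- All the coefficients are non-negative, and one of them is positive. -/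
def pos (f : Form) : Bool := f.nonneg && (f.x.pos || f.y.pos || f.z.pos)

/-- The coefficients of the two forms are the same. -/
def eqB (f g : Form) : Bool := (f.x.sub g.x).isZero && (f.y.sub g.y).isZero && (f.z.sub g.z).isZero

variable {p : ℝ × ℝ × ℝ} {f g : Form}

theorem eval_zero : zero.eval p = 0 := by simp [eval, zero, Zw.val]

theorem eval_add : (f.add g).eval p = f.eval p + g.eval p := by
  simp only [eval, add, Zw.val_add]; ring

theorem eval_sub : (f.sub g).eval p = f.eval p - g.eval p := by
  simp only [eval, sub, Zw.val_sub]; ring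

theorem eval_neg : f.neg.eval p = -f.eval p := by
  simp only [eval, neg, Zw.val_neg]; ring

theorem eval_smul {c : Zw} : (f.smul c).eval p = c.val * f.eval p := by
  simp only [eval, smul, Zw.val_mul]; ring

theorem eval_mulω : f.mulω.eval p = ω * f.eval p := by
  simp only [eval, mulω, Zw.val_mulω]; ring

theorem eval_mulβ : f.mulβ.eval p = β * f.eval p := by
  simp only [eval, mulβ, Zw.val_mulβ]; ring

/-- The open cone of parameters. -/
def _root_.RhombusPWI.Positive (p : ℝ × ℝ × ℝ) : Prop := 0 < p.1 ∧ 0 < p.2.1 ∧ 0 < p.2.2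

theorem eval_nonneg (hp : Positive p) (h : f.nonneg = true) : 0 ≤ f.eval p := by
  simp only [nonneg, Bool.and_eq_true] at h
  have := mul_nonneg (Zw.val_nonneg h.1.1) hp.1.le
  have := mul_nonneg (Zw.val_nonneg h.1.2) hp.2.1.le
  have := mul_nonneg (Zw.val_nonneg h.2) hp.2.2.le
  simp only [eval]; linarith

theorem eval_pos (hp : Positive p) (h : f.pos = true) : 0 < f.eval p := by
  simp only [pos, nonneg, Bool.and_eq_true, Bool.or_eq_true] at h
  have h1 := mul_nonneg (Zw.val_nonneg h.1.1.1) hp.1.le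
  have h2 := mul_nonneg (Zw.val_nonneg h.1.1.2) hp.2.1.le
  have h3 := mul_nonneg (Zw.val_nonneg h.1.2) hp.2.2.le
  simp only [eval]
  rcases h.2 with (h | h) | h
  · linarith [mul_pos (Zw.val_pos h) hp.1]
  · linarith [mul_pos (Zw.val_pos h) hp.2.1]
  · linarith [mul_pos (Zw.val_pos h) hp.2.2]

theorem eval_eq (h : f.eqB g = true) : f.eval p = g.eval p := by
  simp only [eqB, Bool.and_eq_true] at h
  have h1 := Zw.val_eq_zero h.1.1
  have h2 := Zw.val_eq_zero h.1.2
  have h3 := Zw.val_eq_zero h.2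
  rw [Zw.val_sub] at h1 h2 h3
  simp only [eval]
  linear_combination p.1 * h1 + p.2.1 * h2 + p.2.2 * h3

end Form

/-! ### The ten directions -/

/-- The scalar product with the unit vector `n_d` at the angle `2πd/10`, in pentagonal coordinates:
`n_{2m} = u_m`, and `n_{d+5} = -n_d`. -/
noncomputable def nd (d : ℕ) (x : Plane) : ℝ :=
  match d % 10 with
  | 0 => x.1
  | 1 => β * x.1 + β * x.2
  | 2 => x.2
  | 3 => x.2 - β * x.1
  | 4 => -x.1 + β * x.2
  | 5 => -x.1
  | 6 => -β * x.1 - β * x.2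
  | 7 => -x.2
  | 8 => β * x.1 - x.2
  | _ => x.1 - β * x.2

theorem nd_congr {d e : ℕ} (h : d % 10 = e % 10) (x : Plane) : nd d x = nd e x := by
  simp only [nd, h]

theorem mod_ten_cases (d : ℕ) : d % 10 = 0 ∨ d % 10 = 1 ∨ d % 10 = 2 ∨ d % 10 = 3 ∨ d % 10 = 4 ∨
    d % 10 = 5 ∨ d % 10 = 6 ∨ d % 10 = 7 ∨ d % 10 = 8 ∨ d % 10 = 9 := by
  lia

theorem nd_add_two (d : ℕ) (x : Plane) : nd (d + 2) x = ω * nd (d + 1) x - nd d x := by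
  have h := ω_sq
  rcases mod_ten_cases d with h' | h' | h' | h' | h' | h' | h' | h' | h' | h' <;>
  simp only [nd, Nat.add_mod d 1, Nat.add_mod d 2, h', β_eq] <;> norm_num <;> grind

theorem nd_add_five (d : ℕ) (x : Plane) : nd (d + 5) x = -nd d x := by
  rcases mod_ten_cases d with h' | h' | h' | h' | h' | h' | h' | h' | h' | h' <;>
  simp only [nd, Nat.add_mod d 5, h'] <;> norm_num <;> ring

/-- `sin (2πi/10) / sin (2π/10)` for `1 ≤ i ≤ 4`. -/
noncomputable def sine (i : ℕ) : ℝ := if i = 2 ∨ i = 3 then ω else 1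

theorem sine_pos (i : ℕ) : 0 < sine i := by
  unfold sine
  split_ifs
  · exact ω_pos
  · exact one_pos

/-- The middle one of three directions within an angle less than `π` is a positive combination of
the two others. -/
theorem nd_interpolate (c : ℕ) {i j : ℕ} (hi : 1 ≤ i) (hj : 1 ≤ j) (hij : i + j ≤ 4) (x : Plane) :
    sine (i + j) * nd (c + i) x = sine j * nd c x + sine i * nd (c + i + j) x := by
  have h := ω_sq
  have h2 := nd_add_two c x
  have h3 := nd_add_two (c + 1) x
  have h4 := nd_add_two (c + 2) x
  have hi' : i = 1 ∨ i = 2 ∨ i = 3 := by lia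
  have hj' : j = 1 ∨ j = 2 ∨ j = 3 := by lia
  rcases hi' with rfl | rfl | rfl <;> rcases hj' with rfl | rfl | rfl <;>
    first | (exfalso; lia) | (simp [sine, add_assoc] at *; grind)

/-! ### Tiles with parametric edges -/

/-- A half-plane condition `n_d · x < f` (if `d` is even) or `n_d · x ≤ f` (if `d` is odd). The
conditions `u_m · x < b` and `u_m · x ≥ b` are of the form `n_{2m} · x < b` and
`n_{2m+5} · x ≤ -b`, so that the parity of the direction tells excluded edges from included ones. -/
abbrev Cond : Type := ℕ × Form

/-- A list of half-plane conditions. -/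
abbrev CTile : Type := List Cond

/-- The point `x` satisfies the condition `c` at the parameter `p`. -/
def Cond.Holds (p : ℝ × ℝ × ℝ) (c : Cond) (x : Plane) : Prop :=
  if c.1 % 2 = 0 then nd c.1 x < c.2.eval p else nd c.1 x ≤ c.2.eval p

/-- The set of points of a tile at the parameter `p`. -/
def CTile.set (p : ℝ × ℝ × ℝ) (T : CTile) : Set Plane := {x | ∀ c ∈ T, Cond.Holds p c x}

/-- The complementary half-plane. -/
def Cond.compl (c : Cond) : Cond := ((c.1 + 5) % 10, c.2.neg)

theorem Cond.holds_compl {p : ℝ × ℝ × ℝ} {c : Cond} {x : Plane} :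
    c.compl.Holds p x ↔ ¬ c.Holds p x := by
  have h : nd ((c.1 + 5) % 10) x = -nd c.1 x := by
    rw [← nd_add_five]; exact nd_congr (by simp) x
  simp only [Holds, compl, h, Form.eval_neg]
  rcases Nat.mod_two_eq_zero_or_one c.1 with h2 | h2
  · rw [if_neg (by lia), if_pos h2, neg_le_neg_iff, not_lt]
  · rw [if_pos (by lia), if_neg (by lia), neg_lt_neg_iff, not_le]

theorem Cond.Holds.le {p : ℝ × ℝ × ℝ} {c : Cond} {x : Plane} (h : c.Holds p x) :
    nd c.1 x ≤ c.2.eval p := by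
  unfold Holds at h
  split_ifs at h
  · exact h.le
  · exact h

/-- Multiplication by `sine i`. -/
def Form.mulSine (i : ℕ) (f : Form) : Form := bif Nat.beq i 2 || Nat.beq i 3 then f.mulω else f

theorem Form.eval_mulSine {p : ℝ × ℝ × ℝ} {i : ℕ} {f : Form} :
    (f.mulSine i).eval p = sine i * f.eval p := by
  unfold mulSine sine
  by_cases h : i = 2 ∨ i = 3
  · have : (Nat.beq i 2 || Nat.beq i 3) = true := by simpa using h
    rw [this, cond_true, if_pos h, Form.eval_mulω]
  · have : (Nat.beq i 2 || Nat.beq i 3) = false := by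
      rw [Bool.eq_false_iff]; simpa using h
    rw [this, cond_false, if_neg h, one_mul]

def isEven (d : ℕ) : Bool := Nat.beq (d % 2) 0

/-- The condition `t` is a consequence of the conditions `c` and `e`, whose directions enclose that
of `t` (or of `c` alone, if it has the direction of `t`). -/
def Cond.follows (t c e : Cond) : Bool :=
  (fun i j : ℕ =>
    bif Nat.beq i 0 then (t.2.sub c.2).nonneg
    else bif Nat.ble 1 j && Nat.ble (i + j) 4 then
      (fun g : Form => bif isEven t.1 && !isEven c.1 && !isEven e.1 then g.pos else g.nonneg)
        ((t.2.mulSine (i + j)).sub ((c.2.mulSine j).add (e.2.mulSine i)))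
    else false) ((t.1 + 9 * c.1) % 10) ((e.1 + 9 * t.1) % 10)

variable {p : ℝ × ℝ × ℝ}

theorem Cond.follows_sound (hp : Positive p) {t c e : Cond} (h : t.follows c e = true) {x : Plane}
    (hc : c.Holds p x) (he : e.Holds p x) : t.Holds p x := by
  simp only [follows] at h
  by_cases hi : (t.1 + 9 * c.1) % 10 = 0
  · rw [hi] at h
    have h1 : 0 ≤ (t.2.sub c.2).eval p := Form.eval_nonneg hp (by simpa using h)
    rw [Form.eval_sub] at h1
    have h2 : nd t.1 x = nd c.1 x := nd_congr (by lia) x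
    have h3 : t.1 % 2 = c.1 % 2 := by lia
    unfold Holds at hc ⊢
    rw [h2, h3]
    split_ifs at hc ⊢ <;> linarith
  · set i := (t.1 + 9 * c.1) % 10 with hi'
    set j := (e.1 + 9 * t.1) % 10 with hj'
    have hb : Nat.beq i 0 = false := by rw [Bool.eq_false_iff]; simpa using hi
    rw [hb, cond_false] at h
    by_cases hij : 1 ≤ j ∧ i + j ≤ 4
    · have hb' : (Nat.ble 1 j && Nat.ble (i + j) 4) = true := by simpa using hij
      rw [hb', cond_true] at h
      have key := nd_interpolate c.1 (i := i) (j := j) (by lia) hij.1 hij.2 x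
      rw [nd_congr (d := c.1 + i) (e := t.1) (by lia), nd_congr (d := c.1 + i + j) (e := e.1)
        (by lia)] at key
      have hs1 := sine_pos (i + j)
      have hs2 := mul_le_mul_of_nonneg_left hc.le (sine_pos j).le
      have hs3 := mul_le_mul_of_nonneg_left he.le (sine_pos i).le
      have hev : ∀ g : Form, g = (t.2.mulSine (i + j)).sub ((c.2.mulSine j).add (e.2.mulSine i)) →
          g.eval p = sine (i + j) * t.2.eval p - (sine j * c.2.eval p + sine i * e.2.eval p) := by
        rintro g rfl
        rw [Form.eval_sub, Form.eval_add, Form.eval_mulSine, Form.eval_mulSine, Form.eval_mulSine]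
      generalize hg : (t.2.mulSine (i + j)).sub ((c.2.mulSine j).add (e.2.mulSine i)) = g at h
      have hg' := hev g hg.symm
      by_cases hst : (isEven t.1 && !isEven c.1 && !isEven e.1) = true
      · rw [hst, cond_true] at h
        have := Form.eval_pos hp h
        have : nd t.1 x < t.2.eval p := lt_of_mul_lt_mul_left (by linarith) hs1.le
        unfold Holds
        split_ifs <;> linarith
      · rw [Bool.eq_false_iff.2 hst, cond_false] at h
        have := Form.eval_nonneg hp h
        have hle : nd t.1 x ≤ t.2.eval p := le_of_mul_le_mul_left (by linarith) hs1
        unfold Holds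
        split_ifs with ht
        · have hce : c.1 % 2 = 0 ∨ e.1 % 2 = 0 := by
            by_contra hcon
            rw [not_or] at hcon
            apply hst
            simp only [isEven, ht, Bool.and_eq_true, Bool.not_eq_true', Bool.eq_false_iff, ne_eq,
              Nat.beq_eq]
            exact ⟨⟨trivial, hcon.1⟩, hcon.2⟩
          rcases hce with h0 | h0
          · have hc' : nd c.1 x < c.2.eval p := by unfold Holds at hc; rwa [if_pos h0] at hc
            have := mul_lt_mul_of_pos_left hc' (sine_pos j)
            exact lt_of_mul_lt_mul_left (by linarith) hs1.le
          · have hc' : nd e.1 x < e.2.eval p := by unfold Holds at he; rwa [if_pos h0] at he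
            have := mul_lt_mul_of_pos_left hc' (sine_pos i)
            exact lt_of_mul_lt_mul_left (by linarith) hs1.le
        · exact hle
    · have hb' : (Nat.ble 1 j && Nat.ble (i + j) 4) = false := by
        rw [Bool.eq_false_iff]
        simpa using hij
      rw [hb'] at h
      simp at h

namespace CTile

/-- The condition `t` follows from two neighbouring conditions in the cyclic list
`first, …, prev, rest`. -/
def impliesAdj (t first : Cond) : Cond → CTile → Bool
  | prev, [] => t.follows prev first
  | prev, c :: rest => t.follows prev c || impliesAdj t first c rest

/-- The condition `t` follows from two of the conditions of the tile. Neighbouring conditions in the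
list are tried first: they suffice if the list is in cyclic order and irredundant. -/
def implies (T : CTile) (t : Cond) : Bool :=
  match T with
  | [] => false
  | c :: rest => impliesAdj t c c rest || (c :: rest).any fun c₁ => (c :: rest).any (t.follows c₁)

/-- The test `T ⊆ U`. -/
def subsetB (T U : CTile) : Bool := U.all (implies T)

/-- The tile is empty, since it lies in the complement of one of its half-planes. -/
def emptyB (T : CTile) : Bool := T.any fun c => implies T c.compl

/-- The tiles are separated by the line of one of their edges. -/
def disjointB (T U : CTile) : Bool :=
  (T.any fun c => implies U c.compl) || U.any fun c => implies T c.compl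

theorem impliesAdj_sound (hp : Positive p) {t first : Cond} {x : Plane} (hf : first.Holds p x) :
    ∀ (rest : CTile) (prev : Cond), prev.Holds p x → x ∈ set p rest →
      impliesAdj t first prev rest = true → t.Holds p x
  | [], prev, h, _, hi => Cond.follows_sound hp hi h hf
  | c :: rest, prev, h, hr, hi => by
    have hc : c.Holds p x := hr c (by simp)
    rw [impliesAdj, Bool.or_eq_true] at hi
    rcases hi with hi | hi
    · exact Cond.follows_sound hp hi h hc
    · exact impliesAdj_sound hp hf rest c hc (fun e he => hr e (by simp [he])) hi

theorem implies_sound (hp : Positive p) {T : CTile} {t : Cond} (h : T.implies t = true) {x : Plane}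
    (hx : x ∈ T.set p) : t.Holds p x := by
  match T with
  | [] => simp [implies] at h
  | c :: rest =>
    simp only [implies, Bool.or_eq_true, List.any_eq_true] at h
    have hc : c.Holds p x := hx c (by simp)
    rcases h with h | ⟨c₁, h₁, c₂, h₂, h⟩
    · exact impliesAdj_sound hp hc rest c hc (fun e he => hx e (by simp [he])) h
    · exact Cond.follows_sound hp h (hx c₁ h₁) (hx c₂ h₂)

theorem subset_of_subsetB (hp : Positive p) {T U : CTile} (h : T.subsetB U = true) :
    T.set p ⊆ U.set p := fun _ hx c hc =>
  implies_sound hp (List.all_eq_true.1 h c hc) hx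

theorem set_of_emptyB (hp : Positive p) {T : CTile} (h : T.emptyB = true) : T.set p = ∅ := by
  obtain ⟨c, hc, h⟩ := List.any_eq_true.1 h
  refine eq_empty_of_forall_notMem fun x hx => ?_
  exact Cond.holds_compl.1 (implies_sound hp h hx) (hx c hc)

theorem disjoint_of_disjointB (hp : Positive p) {T U : CTile} (h : T.disjointB U = true) :
    Disjoint (T.set p) (U.set p) := by
  rw [Set.disjoint_left]
  intro x hT hU
  simp only [disjointB, Bool.or_eq_true, List.any_eq_true] at h
  rcases h with ⟨c, hc, h⟩ | ⟨c, hc, h⟩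
  · exact Cond.holds_compl.1 (implies_sound hp h hU) (hT c hc)
  · exact Cond.holds_compl.1 (implies_sound hp h hT) (hU c hc)

end CTile

end

section

/-! ### Isometries and similarities acting on parametric tiles -/

theorem nd_add (d : ℕ) (x y : Plane) : nd d (x + y) = nd d x + nd d y := by
  rcases mod_ten_cases d with h | h | h | h | h | h | h | h | h | h <;>
  simp only [nd, h, Prod.fst_add, Prod.snd_add] <;> ring

theorem nd_smul (d : ℕ) (a : ℝ) (x : Plane) : nd d (a • x) = a * nd d x := by
  rcases mod_ten_cases d with h | h | h | h | h | h | h | h | h | h <;>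
  simp only [nd, h, Prod.smul_fst, Prod.smul_snd, smul_eq_mul] <;> ring

theorem nd_rotate (d : ℕ) (x : Plane) : nd (d + 2) (rotate x) = nd d x := by
  have h := ω_sq
  rcases mod_ten_cases d with h' | h' | h' | h' | h' | h' | h' | h' | h' | h' <;>
  simp only [nd, rotate, Nat.add_mod d 2, h', β_eq] <;> norm_num <;> grind

theorem nd_rotate_iterate (d k : ℕ) (x : Plane) : nd (d + 2 * k) (rotate^[k] x) = nd d x := by
  induction k with
  | zero => rfl
  | succ k ih => rw [Function.iterate_succ_apply', mul_add, mul_one, ← add_assoc, nd_rotate, ih]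

theorem nd_reflect (d : ℕ) (x : Plane) : nd (9 * d) (reflect x) = nd d x := by
  have h := ω_sq
  rcases mod_ten_cases d with h' | h' | h' | h' | h' | h' | h' | h' | h' | h' <;>
  simp only [nd, reflect, Nat.mul_mod 9 d, h', β_eq] <;> norm_num <;> grind

theorem plane_ext {x y : Plane} (h0 : nd 0 x = nd 0 y) (h2 : nd 2 x = nd 2 y) : x = y :=
  Prod.ext h0 h2

theorem rotate_five (x : Plane) : rotate^[5] x = x := by
  apply plane_ext
  · rw [← nd_rotate_iterate 0 5 x]; exact nd_congr rfl _
  · rw [← nd_rotate_iterate 2 5 x]; exact nd_congr rfl _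

theorem rotate_bijective : Function.Bijective rotate :=
  Function.bijective_iff_has_inverse.2 ⟨rotate^[4], fun x => rotate_five x, fun x => rotate_five x⟩

theorem reflect_reflect (x : Plane) : reflect (reflect x) = x := by
  simp [reflect]

/-- A vector whose coordinates are linear forms in the parameters. -/
structure Vec where
  x : Form
  y : Form

namespace Vec

variable {p : ℝ × ℝ × ℝ}

noncomputable def eval (p : ℝ × ℝ × ℝ) (v : Vec) : Plane := (v.x.eval p, v.y.eval p)

def add (v w : Vec) : Vec := ⟨v.x.add w.x, v.y.add w.y⟩
def sub (v w : Vec) : Vec := ⟨v.x.sub w.x, v.y.sub w.y⟩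
def smul (c : Zw) (v : Vec) : Vec := ⟨v.x.smul c, v.y.smul c⟩
def rot (v : Vec) : Vec := ⟨v.x.mulβ.sub v.y, v.x⟩
def refl (v : Vec) : Vec := ⟨v.x, v.x.mulβ.sub v.y⟩

/-- The scalar product `n_d · v`. -/
def coord (d : ℕ) (v : Vec) : Form :=
  match d % 10 with
  | 0 => v.x
  | 1 => v.x.mulβ.add v.y.mulβ
  | 2 => v.y
  | 3 => v.y.sub v.x.mulβ
  | 4 => v.y.mulβ.sub v.x
  | 5 => v.x.neg
  | 6 => (v.x.mulβ.add v.y.mulβ).neg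
  | 7 => v.y.neg
  | 8 => v.x.mulβ.sub v.y
  | _ => v.x.sub v.y.mulβ

theorem eval_add {v w : Vec} : (v.add w).eval p = v.eval p + w.eval p := by
  simp [eval, add, Form.eval_add]

theorem eval_sub {v w : Vec} : (v.sub w).eval p = v.eval p - w.eval p := by
  simp [eval, sub, Form.eval_sub]

theorem eval_smul {c : Zw} {v : Vec} : (v.smul c).eval p = c.val • v.eval p := by
  simp [eval, smul, Form.eval_smul]

theorem eval_rot {v : Vec} : v.rot.eval p = rotate (v.eval p) := by
  simp [eval, rot, rotate, Form.eval_sub, Form.eval_mulβ]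

theorem eval_refl {v : Vec} : v.refl.eval p = reflect (v.eval p) := by
  simp [eval, refl, reflect, Form.eval_sub, Form.eval_mulβ]

theorem eval_rot_iterate {k : ℕ} {v : Vec} : (rot^[k] v).eval p = rotate^[k] (v.eval p) := by
  induction k with
  | zero => rfl
  | succ k ih => rw [Function.iterate_succ_apply', Function.iterate_succ_apply', eval_rot, ih]

theorem eval_coord {d : ℕ} {v : Vec} : (v.coord d).eval p = nd d (v.eval p) := by
  rcases mod_ten_cases d with h | h | h | h | h | h | h | h | h | h <;>
  simp only [nd, coord, h, eval, Form.eval_sub, Form.eval_mulβ, Form.eval_add, Form.eval_neg] <;>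
  ring

/-- The two vectors have the same coordinates. -/
def eqB (v w : Vec) : Bool := v.x.eqB w.x && v.y.eqB w.y

theorem eval_eq {v w : Vec} (h : v.eqB w = true) : v.eval p = w.eval p := by
  simp only [eqB, Bool.and_eq_true] at h
  simp [eval, Form.eval_eq h.1, Form.eval_eq h.2]

end Vec

/-- An isometry whose translation vector depends linearly on the parameters. -/
structure CIso where
  rot : ℕ
  trans : Vec

namespace CIso

variable {p : ℝ × ℝ × ℝ}

noncomputable def toIsom (p : ℝ × ℝ × ℝ) (g : CIso) : Isom := ⟨g.trans.eval p, g.rot⟩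

/-- The composition `g ∘ h`. -/
def comp (g h : CIso) : CIso := ⟨(g.rot + h.rot) % 5, (Vec.rot^[g.rot] h.trans).add g.trans⟩

def one : CIso := ⟨0, ⟨Form.zero, Form.zero⟩⟩

def eqB (g h : CIso) : Bool := Nat.beq (g.rot % 5) (h.rot % 5) && g.trans.eqB h.trans

end CIso

theorem rotate_iterate_mod (k : ℕ) (x : Plane) : rotate^[k % 5] x = rotate^[k] x := by
  have h : rotate^[5] = id := funext rotate_five
  conv_rhs => rw [← Nat.mod_add_div k 5, Function.iterate_add, Function.iterate_mul, h,
    Function.iterate_id, Function.comp_id]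

theorem rotate_add (x y : Plane) : rotate (x + y) = rotate x + rotate y := by
  apply Prod.ext <;> simp [rotate]
  ring

theorem rotate_iterate_add (k : ℕ) (x y : Plane) :
    rotate^[k] (x + y) = rotate^[k] x + rotate^[k] y := by
  induction k with
  | zero => rfl
  | succ k ih => simp only [Function.iterate_succ_apply', ih, rotate_add]

theorem rotate_smul (a : ℝ) (x : Plane) : rotate (a • x) = a • rotate x := by
  apply Prod.ext <;> simp [rotate]
  ring

theorem rotate_iterate_smul (k : ℕ) (a : ℝ) (x : Plane) :
    rotate^[k] (a • x) = a • rotate^[k] x := by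
  induction k with
  | zero => rfl
  | succ k ih => simp only [Function.iterate_succ_apply', ih, rotate_smul]

namespace CIso

variable {p : ℝ × ℝ × ℝ}

theorem comp_apply (g h : CIso) (x : Plane) :
    ((g.comp h).toIsom p).apply x = (g.toIsom p).apply ((h.toIsom p).apply x) := by
  simp only [Isom.apply, toIsom, comp, rotate_iterate_mod, Vec.eval_add, Vec.eval_rot_iterate,
    rotate_iterate_add, Function.iterate_add_apply, add_assoc]

theorem one_apply (x : Plane) : (one.toIsom p).apply x = x := by
  simp [Isom.apply, toIsom, one, Vec.eval, Form.eval_zero]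

theorem apply_eq {g h : CIso} (hgh : g.eqB h = true) (x : Plane) :
    (g.toIsom p).apply x = (h.toIsom p).apply x := by
  simp only [eqB, Bool.and_eq_true, Nat.beq_eq] at hgh
  simp only [Isom.apply, toIsom, Vec.eval_eq hgh.2]
  rw [← rotate_iterate_mod, hgh.1, rotate_iterate_mod]

end CIso

theorem Isom.apply_bijective (g : Isom) : Function.Bijective g.apply :=
  (Equiv.addRight g.trans).bijective.comp (rotate_bijective.iterate g.rot)

theorem nd_isom_apply (d : ℕ) (g : Isom) (x : Plane) :
    nd (d + 2 * g.rot) (g.apply x) = nd d x + nd (d + 2 * g.rot) g.trans := by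
  rw [Isom.apply, nd_add, nd_rotate_iterate]

variable {p : ℝ × ℝ × ℝ}

/-- The image of a half-plane under an isometry. -/
def Cond.move (g : CIso) (c : Cond) : Cond :=
  (fun d => (d, c.2.add (g.trans.coord d))) ((c.1 + 2 * g.rot) % 10)

theorem Cond.holds_move {g : CIso} {c : Cond} {x : Plane} :
    (c.move g).Holds p ((g.toIsom p).apply x) ↔ c.Holds p x := by
  have h := nd_isom_apply c.1 (g.toIsom p) x
  have h' : ∀ y, nd ((c.1 + 2 * g.rot) % 10) y = nd (c.1 + 2 * g.rot) y :=
    fun y => nd_congr (by lia) y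
  simp only [Holds, move, Form.eval_add, Vec.eval_coord, h']
  rw [show (c.1 + 2 * g.rot) % 10 % 2 = c.1 % 2 by lia, show g.rot = (g.toIsom p).rot from rfl, h,
    show g.trans.eval p = (g.toIsom p).trans from rfl, add_lt_add_iff_right, add_le_add_iff_right]

/-- The image of a tile under an isometry. -/
def CTile.image (g : CIso) (T : CTile) : CTile := T.map (Cond.move g)

theorem CTile.mem_image {g : CIso} {T : CTile} {x : Plane} :
    (g.toIsom p).apply x ∈ (T.image g).set p ↔ x ∈ T.set p := by
  simp only [CTile.set, image, mem_ofPred_eq, List.forall_mem_map, Cond.holds_move]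

theorem CTile.set_image (g : CIso) (T : CTile) :
    (T.image g).set p = (g.toIsom p).apply '' T.set p := by
  ext y
  obtain ⟨x, rfl⟩ := (g.toIsom p).apply_bijective.surjective y
  rw [mem_image, (g.toIsom p).apply_bijective.injective.mem_set_image]

/-- A similarity whose translation vector depends linearly on the parameters. -/
structure CSim where
  refl : Bool
  rot : ℕ
  scale : Zw
  trans : Vec

/-- The similarity at the parameter `p`. -/
noncomputable def CSim.toSim (p : ℝ × ℝ × ℝ) (G : CSim) (h : 0 < G.scale.val) : Similarity :=
  ⟨G.refl, G.rot, G.scale.val, h, G.trans.eval p⟩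

theorem Similarity.apply_bijective (G : Similarity) : Function.Bijective G.apply := by
  have h : Function.Bijective fun x : Plane => if G.refl then reflect x else x := by
    split_ifs
    · exact Function.Involutive.bijective reflect_reflect
    · exact Function.bijective_id
  have hs : Function.Bijective fun x : Plane => G.scale • x :=
    (Homeomorph.smulOfNeZero G.scale G.scale_pos.ne').bijective
  exact (Equiv.addRight G.trans).bijective.comp
    (hs.comp ((rotate_bijective.iterate G.rot).comp h))

/-- The image of a half-plane under a similarity. -/
def Cond.scaleMove (G : CSim) (c : Cond) : Cond :=
  (fun d => (d, (c.2.smul G.scale).add (G.trans.coord d)))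
    (((bif G.refl then 9 * c.1 else c.1) + 2 * G.rot) % 10)

theorem Cond.holds_scaleMove {G : CSim} (h : 0 < G.scale.val) {c : Cond} {x : Plane} :
    (c.scaleMove G).Holds p ((G.toSim p h).apply x) ↔ c.Holds p x := by
  set d := (bif G.refl then 9 * c.1 else c.1) + 2 * G.rot with hd
  have h1 : ∀ y, nd (d % 10) y = nd d y := fun y => nd_congr (by lia) y
  have h2 : nd d ((G.toSim p h).apply x) = G.scale.val * nd c.1 x + nd d (G.trans.eval p) := by
    rw [Similarity.apply, nd_add, nd_smul, hd]
    simp only [CSim.toSim]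
    rw [nd_rotate_iterate]
    by_cases hr : G.refl = true
    · simp [hr, nd_reflect]
    · simp [hr]
  have h3 : d % 10 % 2 = c.1 % 2 := by
    cases hr : G.refl <;> simp only [hr, cond_true, cond_false] at hd <;> lia
  have h4 : c.scaleMove G = (d % 10, (c.2.smul G.scale).add (G.trans.coord (d % 10))) := rfl
  simp only [h4, Holds, Form.eval_add, Vec.eval_coord, h1, h2, h3, Form.eval_smul,
    add_lt_add_iff_right, add_le_add_iff_right, mul_lt_mul_iff_right₀ h, mul_le_mul_iff_right₀ h]

/-- The image of a tile under a similarity. -/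
def CTile.scaleImage (G : CSim) (T : CTile) : CTile := T.map (Cond.scaleMove G)

theorem CTile.set_scaleImage {G : CSim} (h : 0 < G.scale.val) (T : CTile) :
    (T.scaleImage G).set p = (G.toSim p h).apply '' T.set p := by
  ext y
  obtain ⟨x, rfl⟩ := (G.toSim p h).apply_bijective.surjective y
  rw [(G.toSim p h).apply_bijective.injective.mem_set_image]
  simp only [CTile.set, scaleImage, mem_ofPred_eq, List.forall_mem_map, Cond.holds_scaleMove h]

/-- The conjugate `G g G⁻¹`. -/
def CIso.conj (G : CSim) (g : CIso) : CIso :=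
  (fun r : ℕ => ⟨r, (((Vec.rot^[G.rot] (bif G.refl then g.trans.refl else g.trans)).smul
    G.scale).add G.trans).sub (Vec.rot^[r] G.trans)⟩)
    (bif G.refl then 4 * g.rot % 5 else g.rot)

theorem reflect_add (x y : Plane) : reflect (x + y) = reflect x + reflect y := by
  apply Prod.ext <;> simp [reflect]
  ring

theorem reflect_rotate (x : Plane) : reflect (rotate x) = rotate^[4] (reflect x) := by
  have h := ω_sq
  apply Prod.ext <;> simp [reflect, rotate, β_eq] <;> grind

theorem reflect_rotate_iterate (k : ℕ) (x : Plane) :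
    reflect (rotate^[k] x) = rotate^[4 * k] (reflect x) := by
  induction k with
  | zero => rfl
  | succ k ih =>
    rw [Function.iterate_succ_apply', reflect_rotate, ih, ← Function.iterate_add_apply]
    rw [show 4 + 4 * k = 4 * (k + 1) by ring]

theorem CIso.conj_apply {G : CSim} (h : 0 < G.scale.val) (g : CIso) (x : Plane) :
    ((g.conj G).toIsom p).apply ((G.toSim p h).apply x) =
      (G.toSim p h).apply ((g.toIsom p).apply x) := by
  have hcomm : ∀ (j k : ℕ) (y : Plane), rotate^[j] (rotate^[k] y) = rotate^[k] (rotate^[j] y) := by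
    intro j k y
    rw [← Function.iterate_add_apply, ← Function.iterate_add_apply, add_comm]
  cases hr : G.refl
  · simp only [Isom.apply, Similarity.apply, toIsom, CSim.toSim, conj, hr, cond_false,
      Vec.eval_add, Vec.eval_sub, Vec.eval_smul, Vec.eval_rot_iterate, rotate_iterate_add,
      rotate_iterate_smul, smul_add, Bool.false_eq_true, if_false]
    rw [hcomm g.rot G.rot]
    abel
  · simp only [Isom.apply, Similarity.apply, toIsom, CSim.toSim, conj, hr, cond_true,
      Vec.eval_add, Vec.eval_sub, Vec.eval_smul, Vec.eval_rot_iterate, rotate_iterate_add,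
      rotate_iterate_smul, smul_add, if_true, Vec.eval_refl, reflect_add, reflect_rotate_iterate,
      rotate_iterate_mod]
    rw [hcomm (4 * g.rot) G.rot]
    abel

/-! ### Bounded tiles -/

theorem dotU_eq_nd (m : Fin 5) (x : Plane) : dotU m x = nd (2 * m) x := by
  fin_cases m <;> simp [dotU, nd]

/-- The condition in the notation `(m, ε, b)`. -/
noncomputable def Cond.toTriple (p : ℝ × ℝ × ℝ) (c : Cond) : Fin 5 × ℤ × ℝ :=
  if c.1 % 2 = 0 then (Fin.ofNat 5 (c.1 / 2), 1, c.2.eval p)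
  else (Fin.ofNat 5 ((c.1 + 5) / 2), -1, -c.2.eval p)

theorem Cond.holds_iff_triple {c : Cond} {x : Plane} : c.Holds p x ↔
    if (c.toTriple p).2.1 = 1 then dotU (c.toTriple p).1 x < (c.toTriple p).2.2
    else (c.toTriple p).2.2 ≤ dotU (c.toTriple p).1 x := by
  unfold Holds toTriple
  by_cases h : c.1 % 2 = 0
  · simp only [h, if_true, dotU_eq_nd]
    rw [nd_congr (d := 2 * (Fin.ofNat 5 (c.1 / 2) : ℕ)) (e := c.1)
      (by simp only [Fin.ofNat]; lia)]
  · simp only [h, if_false, dotU_eq_nd, show (-1 : ℤ) ≠ 1 by decide]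
    rw [nd_congr (d := 2 * (Fin.ofNat 5 ((c.1 + 5) / 2) : ℕ)) (e := c.1 + 5)
      (by simp only [Fin.ofNat]; lia), nd_add_five, neg_le_neg_iff]

/-- The tile in the notation of lists of triples `(m, ε, b)`. -/
noncomputable def CTile.toTile (p : ℝ × ℝ × ℝ) (T : CTile) : Tile := T.map (Cond.toTriple p)

theorem CTile.carrier_toTile (T : CTile) : (T.toTile p).carrier = T.set p := by
  ext x
  simp only [CTile.set, toTile, Tile.carrier, List.forall_mem_map, mem_ofPred_eq,
    Cond.holds_iff_triple]

/-- Two of the conditions bound `n_d · x`. -/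
def CTile.boundsB (T : CTile) (d : ℕ) : Bool :=
  T.any fun c => T.any fun e => (fun i j : ℕ => Nat.beq i 0 || (Nat.ble 1 j && Nat.ble (i + j) 4))
    ((d + 9 * c.1) % 10) ((e.1 + 9 * d) % 10)

/-- The conditions bound all the coordinates. -/
def CTile.boundedB (T : CTile) : Bool :=
  T.boundsB 0 && T.boundsB 2 && T.boundsB 5 && T.boundsB 7

theorem CTile.le_of_boundsB {T : CTile} {d : ℕ} (h : T.boundsB d = true) :
    ∃ b, ∀ x ∈ T.set p, nd d x ≤ b := by
  simp only [boundsB, List.any_eq_true, Bool.or_eq_true, Bool.and_eq_true, Nat.beq_eq,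
    Nat.ble_eq] at h
  obtain ⟨c, hc, e, he, h | ⟨hj, hij⟩⟩ := h
  · refine ⟨c.2.eval p, fun x hx => ?_⟩
    rw [nd_congr (e := c.1) (by lia)]
    exact (hx c hc).le
  · by_cases hi : (d + 9 * c.1) % 10 = 0
    · refine ⟨c.2.eval p, fun x hx => ?_⟩
      rw [nd_congr (e := c.1) (by lia)]
      exact (hx c hc).le
    set i := (d + 9 * c.1) % 10 with hi'
    set j := (e.1 + 9 * d) % 10 with hj'
    refine ⟨(sine j * c.2.eval p + sine i * e.2.eval p) / sine (i + j), fun x hx => ?_⟩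
    have key := nd_interpolate c.1 (i := i) (j := j) (by lia) hj hij x
    rw [nd_congr (d := c.1 + i) (e := d) (by lia), nd_congr (d := c.1 + i + j) (e := e.1)
      (by lia)] at key
    have hs2 := mul_le_mul_of_nonneg_left (hx c hc).le (sine_pos j).le
    have hs3 := mul_le_mul_of_nonneg_left (hx e he).le (sine_pos i).le
    rw [le_div_iff₀ (sine_pos _)]
    linarith

theorem CTile.isTile {T : CTile} (h : T.boundedB = true) : IsTile (T.set p) := by
  refine ⟨⟨T.toTile p, T.carrier_toTile.symm⟩, ?_⟩
  simp only [boundedB, Bool.and_eq_true] at h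
  obtain ⟨b0, h0⟩ := le_of_boundsB (p := p) h.1.1.1
  obtain ⟨b2, h2⟩ := le_of_boundsB (p := p) h.1.1.2
  obtain ⟨b5, h5⟩ := le_of_boundsB (p := p) h.1.2
  obtain ⟨b7, h7⟩ := le_of_boundsB (p := p) h.2
  refine (Metric.isBounded_Icc ((-b5, -b7) : Plane) (b0, b2)).subset fun x hx => ?_
  have a0 : x.1 ≤ b0 := h0 x hx
  have a2 : x.2 ≤ b2 := h2 x hx
  have a5 : -x.1 ≤ b5 := h5 x hx
  have a7 : -x.2 ≤ b7 := h7 x hx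
  exact ⟨⟨by simp only; linarith, by simp only; linarith⟩, ⟨a0, a2⟩⟩

end

section

/-! ### Orbits in dressed domains -/

namespace DressedDomain

variable {m n : ℕ} {X : DressedDomain n} {Y : DressedDomain m}

theorem map_of_mem (hX : X.IsDressed) {k : Fin n} {x : Plane} (hx : x ∈ X.atom k) :
    X.map x = (X.iso k).apply x := by
  have h : ∃ k, x ∈ X.atom k := ⟨k, hx⟩
  have hk : h.choose = k := by
    by_contra hne
    exact Set.disjoint_left.1 (hX.2.1 hne) h.choose_spec hx
  rw [map, dif_pos h, hk]

theorem exists_mem_atom (hX : X.IsDressed) {x : Plane} (hx : x ∈ X.dom) : ∃ k, x ∈ X.atom k := by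
  rw [← hX.2.2.1] at hx
  exact mem_iUnion.1 hx

theorem atom_subset (hX : X.IsDressed) (k : Fin n) : X.atom k ⊆ X.dom := by
  rw [← hX.2.2.1]
  exact subset_iUnion _ k

theorem map_mem (hX : X.IsDressed) {x : Plane} (hx : x ∈ X.dom) : X.map x ∈ X.dom := by
  obtain ⟨k, hk⟩ := exists_mem_atom hX hx
  rw [map_of_mem hX hk]
  exact hX.2.2.2 k x hk

theorem iterate_mem (hX : X.IsDressed) {x : Plane} (hx : x ∈ X.dom) (i : ℕ) :
    X.map^[i] x ∈ X.dom := by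
  induction i with
  | zero => exact hx
  | succ i ih => rw [Function.iterate_succ_apply']; exact map_mem hX ih

theorem eq_of_mem_atom (hX : X.IsDressed) {k l : Fin n} {x : Plane} (hk : x ∈ X.atom k)
    (hl : x ∈ X.atom l) : k = l := by
  by_contra hne
  exact Set.disjoint_left.1 (hX.2.1 hne) hk hl

/-- The piecewise isometry is injective. -/
def Reversible (X : DressedDomain n) : Prop := InjOn X.map X.dom

theorem iterate_injOn (hX : X.IsDressed) (hr : X.Reversible) (i : ℕ) :
    InjOn X.map^[i] X.dom := by
  induction i with
  | zero => exact injOn_id _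
  | succ i ih =>
    rw [Function.iterate_succ]
    exact ih.comp hr fun x hx => map_mem hX hx

/-- The isometries of the atoms map `X` onto itself. -/
def OntoDom (X : DressedDomain n) : Prop := ∀ y ∈ X.dom, ∃ k, ∃ x ∈ X.atom k, (X.iso k).apply x = y

/-- The point `x` visits the first atoms of the list `l`. -/
def Visits (X : DressedDomain n) (x : Plane) (l : List (Fin n)) : Prop :=
  ∀ i (h : i < l.length), X.map^[i] x ∈ X.atom l[i]

theorem Visits.append {x : Plane} {l l' : List (Fin n)} (h : X.Visits x l)
    (h' : X.Visits (X.map^[l.length] x) l') : X.Visits x (l ++ l') := by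
  intro i hi
  rw [List.getElem_append]
  split_ifs with hil
  · exact h i hil
  · have hi' : i - l.length < l'.length := by rw [List.length_append] at hi; lia
    have := h' (i - l.length) hi'
    rwa [← Function.iterate_add_apply, Nat.sub_add_cancel (not_lt.1 hil)] at this

theorem Visits.drop {x : Plane} {l : List (Fin n)} (h : X.Visits x l) (a : ℕ) :
    X.Visits (X.map^[a] x) (l.drop a) := by
  intro i hi
  rw [List.length_drop] at hi
  rw [List.getElem_drop, ← Function.iterate_add_apply, add_comm i a]
  exact h (a + i) (by lia)

/-- The lists differ at some place. -/
def mismatch : List (Fin n) → List (Fin n) → Bool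
  | a :: l, b :: l' => !Nat.beq a b || mismatch l l'
  | _, _ => false

theorem Visits.tail {x : Plane} {a : Fin n} {l : List (Fin n)} (h : X.Visits x (a :: l)) :
    X.Visits (X.map x) l := fun i hi => h (i + 1) (by simpa using hi)

theorem not_visits_of_mismatch (hX : X.IsDressed) : ∀ {l l' : List (Fin n)} {x : Plane},
    mismatch l l' = true → X.Visits x l → X.Visits x l' → False
  | [], _, _, h, _, _ => by simp [mismatch] at h
  | _ :: _, [], _, h, _, _ => by simp [mismatch] at h
  | a :: l, b :: l', x, h, h1, h2 => by
    have hab : a = b := eq_of_mem_atom hX (h1 0 (by simp)) (h2 0 (by simp))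
    have h' : mismatch l l' = true := by simpa [mismatch, hab] using h
    exact not_visits_of_mismatch hX h' h1.tail h2.tail

theorem Follows.visits {S : Set Plane} {w : List (Fin n)} (h : X.Follows S w) {x : Plane}
    (hx : x ∈ S) : X.Visits x w := fun i hi => h i hi (mem_image_of_mem _ hx)

/-- Several repetitions of a word. -/
def repetitions (w : List (Fin n)) : ℕ → List (Fin n)
  | 0 => []
  | N + 1 => w ++ repetitions w N

theorem IsPeriodicTile.visits {P : Set Plane} {w : List (Fin n)} (h : X.IsPeriodicTile P w)
    (N : ℕ) {x : Plane} (hx : x ∈ P) : X.Visits x (repetitions w N) := by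
  induction N generalizing x with
  | zero => intro i hi; simp [repetitions] at hi
  | succ N ih =>
    refine (h.2.2.2.1.visits hx).append (ih ?_)
    rw [← h.2.2.2.2]
    exact mem_image_of_mem _ hx

/-- No common point of tiles with the periodic itineraries `u` and `v` is possible, after any shift
of `v` by less than its length (or by a positive such number, if `proper` holds). -/
def unrelatedB (N : ℕ) (proper : Bool) (u v : List (Fin n)) : Bool :=
  (List.range v.length).all fun a =>
    (proper && Nat.beq a 0) || mismatch (repetitions u N) (v.drop a ++ repetitions v N)

theorem disjoint_of_unrelatedB (hX : X.IsDressed) {P Q : Set Plane} {u v : List (Fin n)}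
    (hP : X.IsPeriodicTile P u) (hQ : X.IsPeriodicTile Q v) {N : ℕ} {proper : Bool}
    (h : unrelatedB N proper u v = true) {a : ℕ} (ha : a < v.length)
    (hproper : proper = true → a ≠ 0) : Disjoint P (X.map^[a] '' Q) := by
  rw [Set.disjoint_left]
  rintro _ hxP ⟨x, hxQ, rfl⟩
  have h1 := List.all_eq_true.1 h a (List.mem_range.2 ha)
  simp only [Bool.or_eq_true, Bool.and_eq_true, Nat.beq_eq] at h1
  rcases h1 with h1 | h1
  · exact hproper h1.1 h1.2
  · refine not_visits_of_mismatch hX h1 (hP.visits N hxP) ?_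
    have h2 := (hQ.visits (N + 1) hxQ).drop a
    rwa [repetitions, List.drop_append_of_le_length ha.le] at h2

theorem IsPeriodicTile.iterate_image {P : Set Plane} {w : List (Fin n)}
    (h : X.IsPeriodicTile P w) (N : ℕ) : X.map^[N * w.length] '' P = P := by
  induction N with
  | zero => simp
  | succ N ih => rw [Nat.succ_mul, Function.iterate_add, image_comp, h.2.2.2.2, ih]

theorem IsPeriodicTile.iterate_image_mod {P : Set Plane} {w : List (Fin n)}
    (h : X.IsPeriodicTile P w) (a : ℕ) : X.map^[a % w.length] '' P = X.map^[a] '' P := by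
  conv_rhs => rw [← Nat.mod_add_div a w.length, mul_comm, Function.iterate_add, image_comp,
    h.iterate_image]

theorem IsPeriodicTile.length_pos {P : Set Plane} {w : List (Fin n)}
    (h : X.IsPeriodicTile P w) : 0 < w.length := List.length_pos_iff.2 h.2.2.1

theorem IsPeriodicTile.subset_dom (hX : X.IsDressed) {P : Set Plane} {w : List (Fin n)}
    (h : X.IsPeriodicTile P w) : P ⊆ X.dom := fun x hx =>
  atom_subset hX _ (h.2.2.2.1 0 h.length_pos ⟨x, hx, rfl⟩)

/-- The periodic tiles `P j`, with itineraries `v j`, avoid `D` and have unrelated itineraries. -/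
structure PeriodicFamily (X : DressedDomain n) (D : Set Plane) {N : ℕ} (P : Fin N → Set Plane)
    (v : Fin N → List (Fin n)) : Prop where
  periodic : ∀ j, X.IsPeriodicTile (P j) (v j)
  avoids : ∀ j, ∀ a < (v j).length, Disjoint (X.map^[a] '' P j) D
  unrelated : ∀ i j, i < j → ∃ M, unrelatedB M false (v i) (v j) = true
  primitive : ∀ j, ∃ M, unrelatedB M true (v j) (v j) = true

namespace PeriodicFamily

variable {D : Set Plane} {N : ℕ} {P : Fin N → Set Plane} {v : Fin N → List (Fin n)}

theorem avoids' (h : X.PeriodicFamily D P v) (j : Fin N) (a : ℕ) :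
    Disjoint (X.map^[a] '' P j) D := by
  rw [← (h.periodic j).iterate_image_mod]
  exact h.avoids j _ (Nat.mod_lt _ (h.periodic j).length_pos)

/-- A common point of the two tiles can be moved forward until the first of them is at the start of
its orbit. -/
theorem disjoint_aux (hX : X.IsDressed) (h : X.PeriodicFamily D P v)
    {i j : Fin N} {a b : ℕ} (ha : a < (v i).length) (hb : b < (v j).length)
    (hij : i ≤ j) (hne : i = j → a ≠ b) : Disjoint (X.map^[a] '' P i) (X.map^[b] '' P j) := by
  have hi := h.periodic i
  have hj := h.periodic j
  have key : Disjoint (P i) (X.map^[(b + ((v i).length - a)) % (v j).length] '' P j) := by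
    rcases hij.lt_or_eq with hlt | rfl
    · obtain ⟨M, hM⟩ := h.unrelated i j hlt
      exact disjoint_of_unrelatedB hX hi hj hM (Nat.mod_lt _ hj.length_pos) (by simp)
    · obtain ⟨M, hM⟩ := h.primitive i
      refine disjoint_of_unrelatedB hX hi hj hM (Nat.mod_lt _ hj.length_pos) fun _ h0 => ?_
      have hab := hne rfl
      obtain ⟨c, hc⟩ := Nat.dvd_of_mod_eq_zero h0
      have : c = 1 := by
        have h1 : 0 < c := by
          rcases Nat.eq_zero_or_pos c with rfl | h1
          · lia
          · exact h1
        have h2 : c < 2 := by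
          by_contra hc2
          have := Nat.mul_le_mul_left (v i).length (not_lt.1 hc2)
          lia
        lia
      subst this
      lia
  rw [Set.disjoint_left] at key ⊢
  rintro x ⟨y, hy, rfl⟩ ⟨z, hz, hzy⟩
  have e : X.map^[(v i).length - a] (X.map^[a] y) = X.map^[(v i).length] y := by
    rw [← Function.iterate_add_apply, Nat.sub_add_cancel ha.le]
  refine key (a := X.map^[(v i).length] y) ?_ ?_
  · have := mem_image_of_mem X.map^[(v i).length] hy
    rwa [hi.2.2.2.2] at this
  · rw [hj.iterate_image_mod, ← e, ← hzy, ← Function.iterate_add_apply, add_comm]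
    exact mem_image_of_mem _ hz

end PeriodicFamily

/-- The tiling theorem: the induced map on `Y.dom` is onto, and every orbit visits `Y.dom` or one of
the periodic tiles. As the map of `X` is injective, the union `U` of the orbits satisfies
`f⁻¹ U ⊆ U`, hence contains all points whose orbits meet it; and two sets in these orbits which
meet are the same. -/
theorem tiledBy_of_hits (hX : X.IsDressed) (hr : X.Reversible) (hY : Y.IsSubdomain X)
    (hYo : Y.OntoDom) {N : ℕ} {P : Fin N → Set Plane} {v : Fin N → List (Fin n)}
    (hP : X.PeriodicFamily Y.dom P v)
    (hit : ∀ x ∈ X.dom, ∃ i, X.map^[i] x ∈ Y.dom ∨ ∃ j, X.map^[i] x ∈ P j) :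
    X.TiledBy Y P fun j => (v j).length := by
  have hsub : ∀ k i, X.returnLevel Y.dom (Y.atom k) i ⊆ X.dom := by
    rintro k i _ ⟨x, ⟨hx, -⟩, rfl⟩
    exact iterate_mem hX (hY.2.1 (atom_subset hY.1 k hx)) i
  have hPdom : ∀ j i, X.map^[i] '' P j ⊆ X.dom := by
    rintro j i _ ⟨x, hx, rfl⟩
    exact iterate_mem hX ((hP.periodic j).subset_dom hX hx) i
  -- Two points on return levels with the same image.
  have hlev : ∀ k l i j, i ≤ j → ∀ x, x ∈ X.returnLevel Y.dom (Y.atom k) i →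
      x ∈ X.returnLevel Y.dom (Y.atom l) j → (k, i) = (l, j) := by
    rintro k l i j hij x ⟨y, ⟨hy, -⟩, rfl⟩ ⟨z, ⟨hz, hz'⟩, hzy⟩
    have hyX := hY.2.1 (atom_subset hY.1 k hy)
    have hzX := hY.2.1 (atom_subset hY.1 l hz)
    rw [← Nat.add_sub_of_le hij, Function.iterate_add_apply] at hzy
    have hyz := iterate_injOn hX hr i (iterate_mem hX hzX _) hyX hzy
    rcases hij.lt_or_eq with hlt | rfl
    · exact absurd (hyz ▸ atom_subset hY.1 k hy) (hz' (j - i) (by lia) (by lia))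
    · rw [Nat.sub_self, Function.iterate_zero_apply] at hyz
      rw [eq_of_mem_atom hY.1 hy (hyz ▸ hz)]
  have hmix : ∀ k i j a, Disjoint (X.returnLevel Y.dom (Y.atom k) i) (X.map^[a] '' P j) := by
    intro k i j a
    rw [Set.disjoint_left]
    rintro _ ⟨y, ⟨hy, -⟩, rfl⟩ hya
    have hyY := atom_subset hY.1 k hy
    have hper := hP.periodic j
    have hle : i ≤ a + i * (v j).length := by
      have := Nat.mul_le_mul_left i hper.length_pos
      lia
    have e : X.map^[a] '' P j = X.map^[i] '' (X.map^[a + i * (v j).length - i] '' P j) := by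
      rw [← image_comp, ← Function.iterate_add, Nat.add_sub_of_le hle, Function.iterate_add,
        image_comp, hper.iterate_image]
    rw [e] at hya
    obtain ⟨z, hz, hzy⟩ := hya
    have := iterate_injOn hX hr i (hPdom _ _ hz) (hY.2.1 hyY) hzy
    exact Set.disjoint_left.1 (hP.avoids' j _) hz (this ▸ hyY)
  refine ⟨?_, ?_⟩
  · rintro (⟨k, i⟩ | ⟨i, a⟩) (⟨l, j⟩ | ⟨j, b⟩) hne
    · rw [Set.disjoint_left]
      intro x hx hx'
      apply hne
      rcases le_total i j with h | h
      · rw [hlev k l i j h x hx hx']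
      · rw [hlev l k j i h x hx' hx]
    · exact hmix k i j b
    · exact (hmix l j i a).symm
    · have hne' : i = j → (a : ℕ) ≠ b := by
        rintro rfl hab
        exact hne (by rw [Fin.ext hab])
      rcases le_total i j with h | h
      · exact hP.disjoint_aux hX a.2 b.2 h hne'
      · exact (hP.disjoint_aux hX b.2 a.2 h fun e e' => hne' e.symm e'.symm).symm
  · refine Subset.antisymm (iUnion_subset ?_) fun x hx => ?_
    · rintro (⟨k, i⟩ | ⟨j, a⟩)
      · exact hsub k i
      · exact hPdom j a
    -- The union of the orbits contains the preimages of its points.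
    · have hback : ∀ x ∈ X.dom,
          ((∃ k i, X.map x ∈ X.returnLevel Y.dom (Y.atom k) i) ∨
            ∃ j a, X.map x ∈ X.map^[a] '' P j) →
          ((∃ k i, x ∈ X.returnLevel Y.dom (Y.atom k) i) ∨ ∃ j a, x ∈ X.map^[a] '' P j) := by
        rintro x hx (⟨k, i, hi⟩ | ⟨j, a, hj⟩)
        · rcases i with _ | i
          · obtain ⟨z, ⟨hz, -⟩, hzx⟩ := hi
            have hxY : X.map x ∈ Y.dom := hzx ▸ atom_subset hY.1 k hz
            obtain ⟨l, y, hy, hyx⟩ := hYo _ hxY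
            obtain ⟨c, hc, hcy, -, hc'⟩ := hY.2.2 l y hy
            refine Or.inl ⟨l, c - 1, y, ⟨hy, fun i h1 h2 => hc' i h1 (by lia)⟩, ?_⟩
            refine hr (iterate_mem hX (hY.2.1 (atom_subset hY.1 l hy)) _) hx ?_
            rw [← Function.iterate_succ_apply' X.map, Nat.succ_eq_add_one, Nat.sub_add_cancel hc,
              hcy, hyx]
          · obtain ⟨z, ⟨hz, hz'⟩, hzx⟩ := hi
            refine Or.inl ⟨k, i, z, ⟨hz, fun a h1 h2 => hz' a h1 (by lia)⟩, ?_⟩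
            refine hr (iterate_mem hX (hY.2.1 (atom_subset hY.1 k hz)) _) hx ?_
            rw [← Function.iterate_succ_apply' X.map, hzx]
        · have hper := hP.periodic j
          obtain ⟨b, hb⟩ : ∃ b, a + (v j).length = b + 1 :=
            ⟨a + (v j).length - 1, by have := hper.length_pos; lia⟩
          have e : X.map^[a] '' P j = X.map '' (X.map^[b] '' P j) := by
            rw [← image_comp, ← Function.iterate_succ', Nat.succ_eq_add_one, ← hb,
              Function.iterate_add, image_comp, hper.2.2.2.2]
          rw [e] at hj
          obtain ⟨z, hz, hzx⟩ := hj
          exact Or.inr ⟨j, b, hr (hPdom _ _ hz) hx hzx ▸ hz⟩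
      have hall : ∀ i, ∀ x ∈ X.dom,
          (X.map^[i] x ∈ Y.dom ∨ ∃ j, X.map^[i] x ∈ P j) →
          ((∃ k i, x ∈ X.returnLevel Y.dom (Y.atom k) i) ∨ ∃ j a, x ∈ X.map^[a] '' P j) := by
        intro i
        induction i with
        | zero =>
          rintro x - (h | ⟨j, h⟩)
          · obtain ⟨k, hk⟩ := exists_mem_atom hY.1 h
            exact Or.inl ⟨k, 0, x, ⟨hk, fun a h1 h2 => by lia⟩, rfl⟩
          · exact Or.inr ⟨j, 0, x, h, rfl⟩
        | succ i ih =>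
          intro x hx h
          exact hback x hx (ih _ (map_mem hX hx) h)
      obtain ⟨i, hi⟩ := hit x hx
      rcases hall i x hx hi with ⟨k, i, h⟩ | ⟨j, a, h⟩
      · exact mem_iUnion.2 ⟨Sum.inl (k, i), h⟩
      · rw [← (hP.periodic j).iterate_image_mod] at h
        exact mem_iUnion.2 ⟨Sum.inr ⟨j, _, Nat.mod_lt _ (hP.periodic j).length_pos⟩, h⟩

end DressedDomain

end

section

/-! ### Dressed domains with parametric tiles, and decidable tests of their properties -/

/-- The data of a dressed domain whose tiles and isometries depend linearly on the parameters. -/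
structure CSys where
  dom : CTile
  parts : List (CTile × CIso)

namespace CSys

/-- The tile with number `k`, or the tile without conditions if there is none. -/
def atom (S : CSys) (k : ℕ) : CTile := (S.parts.getD k ([], CIso.one)).1
/-- The isometry with number `k`, or the identity if there is none. -/
def iso (S : CSys) (k : ℕ) : CIso := (S.parts.getD k ([], CIso.one)).2

/-- The dressed domain `X` is given by the data `S` at the parameter `p`. -/
structure Models (p : ℝ × ℝ × ℝ) (S : CSys) {n : ℕ} (X : DressedDomain n) : Prop where
  length : S.parts.length = n
  dom : X.dom = S.dom.set p
  atom : ∀ k : Fin n, X.atom k = (S.atom k).set p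
  iso : ∀ (k : Fin n) (x : Plane), (X.iso k).apply x = ((S.iso k).toIsom p).apply x

/-- The dressed domain given by the data at the parameter `p`. -/
noncomputable def toDressed (S : CSys) (p : ℝ × ℝ × ℝ) : DressedDomain S.parts.length where
  dom := S.dom.set p
  atom k := (S.atom k).set p
  iso k := (S.iso k).toIsom p

theorem models_toDressed (S : CSys) (p : ℝ × ℝ × ℝ) : S.Models p (S.toDressed p) :=
  ⟨rfl, rfl, fun _ => rfl, fun _ _ => rfl⟩

/-- The image of the data under a similarity. -/
def scaleImage (G : CSim) (S : CSys) : CSys :=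
  ⟨S.dom.scaleImage G, S.parts.map fun c => (c.1.scaleImage G, c.2.conj G)⟩

end CSys

/-! ### Certificates -/

/-- A proof that all the points of a tile belong to a certain set: the tile may be contained in one
of a list of tiles known to lie in the set, it may be moved by a map which can only bring points
into the set if they were there before, and it may be cut by a line. Tiles in double lists are
referred to by two indices. The last argument of `cut` before each subtree selects, by hexadecimal
digits, those conditions of the new part which are kept, in cyclic order; the digit `1` stands for
the new condition. -/
inductive Cert where
  | hit (g i : ℕ) : Cert
  | move (k : ℕ) (c : Cert) : Cert
  | cut (g i j : ℕ) (s₁ : ℕ) (c₁ : Cert) (s₂ : ℕ) (c₂ : Cert) : Cert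

/-- The digits of a number in base `b`, diminished by one, in the usual order (at most `k` of
them). -/
def digitsAux (b : ℕ) : ℕ → ℕ → List ℕ → List ℕ
  | 0, _, acc => acc
  | k + 1, a, acc => bif Nat.beq a 0 then acc else digitsAux b k (a / b) ((a % b - 1) :: acc)

/-- The word in the letters `0, …, m`, written with the decimal digits `1, …, m + 1`. -/
def word (m a : ℕ) : List (Fin (m + 1)) := (digitsAux 10 100 a []).map (Fin.ofNat (m + 1))

/-- The conditions of the tile at the given places. -/
def CTile.select (T : CTile) (s : ℕ) : CTile := (digitsAux 16 16 s []).filterMap fun i => T[i]?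

namespace Cert

/-- The test of a certificate. -/
def check (moves : List (CTile × CIso)) (good lines : List (List CTile)) : Cert → CTile → Bool
  | hit g i, T =>
    match (good.getD g [])[i]? with
    | some U => T.subsetB U
    | none => false
  | move k c, T =>
    match moves[k]? with
    | some m => T.subsetB m.1 && check moves good lines c (T.image m.2)
    | none => false
  | cut g i j s₁ c₁ s₂ c₂, T =>
    match ((lines.getD g []).getD i [])[j]? with
    | some c => check moves good lines c₁ (CTile.select (c :: T) s₁) &&
        check moves good lines c₂ (CTile.select (c.compl :: T) s₂)
    | none => false

variable {p : ℝ × ℝ × ℝ}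

theorem _root_.RhombusPWI.CTile.subset_select {T : CTile} {s : ℕ} :
    T.set p ⊆ (T.select s).set p := by
  intro x hx c hc
  obtain ⟨i, -, hi⟩ := List.mem_filterMap.1 hc
  exact hx c (List.mem_of_getElem? hi)

theorem sound (hp : Positive p) {moves : List (CTile × CIso)} {good lines : List (List CTile)}
    {S : Set Plane} (hgood : ∀ l ∈ good, ∀ U ∈ l, U.set p ⊆ S)
    (hmoves : ∀ m ∈ moves, ∀ x ∈ m.1.set p, (m.2.toIsom p).apply x ∈ S → x ∈ S) :
    ∀ (c : Cert) (T : CTile), c.check moves good lines T = true → T.set p ⊆ S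
  | hit g i, T, h => by
    simp only [check] at h
    split at h
    · rename_i U hU
      have hg : good.getD g [] ∈ good := by
        by_contra hg
        rw [List.getD_eq_getElem?_getD] at hg hU
        rcases hgg : good[g]? with _ | l
        · simp [hgg] at hU
        · exact hg (by simpa [hgg] using List.mem_of_getElem? hgg)
      exact (CTile.subset_of_subsetB hp h).trans (hgood _ hg U (List.mem_of_getElem? hU))
    · simp at h
  | move k c, T, h => by
    simp only [check] at h
    split at h
    · rename_i m hm
      rw [Bool.and_eq_true] at h
      intro x hx
      have h1 := CTile.subset_of_subsetB hp h.1 hx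
      exact hmoves m (List.mem_of_getElem? hm) x h1
        (sound hp hgood hmoves c _ h.2 (CTile.mem_image.2 hx))
    · simp at h
  | cut g i j s₁ c₁ s₂ c₂, T, h => by
    simp only [check] at h
    split at h
    · rename_i c hc
      rw [Bool.and_eq_true] at h
      intro x hx
      by_cases hcx : c.Holds p x
      · refine sound hp hgood hmoves c₁ _ h.1 (CTile.subset_select ?_)
        intro e he
        rcases List.mem_cons.1 he with rfl | he
        · exact hcx
        · exact hx e he
      · refine sound hp hgood hmoves c₂ _ h.2 (CTile.subset_select ?_)
        intro e he
        rcases List.mem_cons.1 he with rfl | he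
        · exact Cond.holds_compl.2 hcx
        · exact hx e he
    · simp at h

/-- The tile is covered by tiles of a list. -/
def covers (c : Cert) (l : List CTile) (T : CTile) : Bool := c.check [] [l] [l] T

theorem covers_sound (hp : Positive p) {c : Cert} {l : List CTile} {T : CTile}
    (h : c.covers l T = true) : ∀ x ∈ T.set p, ∃ U ∈ l, x ∈ U.set p := by
  intro x hx
  have := sound (S := {x | ∃ U ∈ l, x ∈ U.set p}) hp (moves := []) (good := [l]) (lines := [l])
    (fun l' hl' U hU x hx => ⟨U, by simp at hl'; exact hl' ▸ hU, hx⟩) (by simp) c T h hx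
  exact this

end Cert

variable {p : ℝ × ℝ × ℝ} {m n : ℕ}

/-- The tiles of the list are pairwise disjoint. -/
def pairwiseDisjointB : List CTile → Bool
  | [] => true
  | T :: l => l.all T.disjointB && pairwiseDisjointB l

theorem disjoint_of_pairwiseDisjointB (hp : Positive p) : ∀ {l : List CTile},
    pairwiseDisjointB l = true → l.Pairwise fun T U => Disjoint (T.set p) (U.set p)
  | [], _ => List.Pairwise.nil
  | T :: l, h => by
    rw [pairwiseDisjointB, Bool.and_eq_true, List.all_eq_true] at h
    exact List.Pairwise.cons (fun U hU => CTile.disjoint_of_disjointB hp (h.1 U hU))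
      (disjoint_of_pairwiseDisjointB hp h.2)

namespace CSys

variable {S : CSys} {X : DressedDomain n}

def atoms (S : CSys) : List CTile := S.parts.map Prod.fst

def images (S : CSys) : List CTile := S.parts.map fun c => c.1.image c.2

theorem Models.getElem (h : S.Models p X) (k : Fin n) :
    S.parts[(k : ℕ)]'(h.length ▸ k.2) = (S.atom k, S.iso k) := by
  have hk : (k : ℕ) < S.parts.length := h.length ▸ k.2
  rw [CSys.atom, CSys.iso, List.getD_eq_getElem _ _ hk]

theorem Models.mem_parts (h : S.Models p X) (k : Fin n) : (S.atom k, S.iso k) ∈ S.parts :=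
  h.getElem k ▸ List.getElem_mem _

theorem Models.exists_index (h : S.Models p X) {c : CTile × CIso} (hc : c ∈ S.parts) :
    ∃ k : Fin n, c = (S.atom k, S.iso k) := by
  obtain ⟨i, hi, rfl⟩ := List.mem_iff_getElem.1 hc
  exact ⟨⟨i, h.length ▸ hi⟩, h.getElem ⟨i, h.length ▸ hi⟩⟩

/-- The atoms and their images are disjoint tiles contained in the domain. The certificate `c`
proves that the atoms cover the domain. -/
def dressedB (S : CSys) (c : Cert) : Bool :=
  (S.parts.all fun c => c.1.boundedB && c.1.subsetB S.dom && (c.1.image c.2).subsetB S.dom) &&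
    pairwiseDisjointB S.atoms && c.covers S.atoms S.dom

theorem Models.isDressed (h : S.Models p X) (hp : Positive p) {c : Cert}
    (hc : S.dressedB c = true) : X.IsDressed := by
  simp only [dressedB, Bool.and_eq_true, List.all_eq_true] at hc
  obtain ⟨⟨h1, h2⟩, h3⟩ := hc
  refine ⟨fun k => ?_, fun i j hij => ?_, ?_, fun k x hx => ?_⟩
  · rw [h.atom]
    exact CTile.isTile (h1 _ (h.mem_parts k)).1.1
  · change Disjoint (X.atom i) (X.atom j)
    rw [h.atom, h.atom]
    have hd := List.pairwise_iff_getElem.1 (disjoint_of_pairwiseDisjointB hp h2)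
    have key : ∀ i j : Fin n, i < j → Disjoint ((S.atom i).set p) ((S.atom j).set p) := by
      intro i j hij
      have := hd i j (by simp [atoms, h.length]) (by simp [atoms, h.length]) hij
      simpa [atoms, h.getElem] using this
    rcases lt_or_gt_of_ne hij with hlt | hlt
    · exact key i j hlt
    · exact (key j i hlt).symm
  · refine Subset.antisymm (iUnion_subset fun k => ?_) fun x hx => ?_
    · rw [h.atom, h.dom]
      exact CTile.subset_of_subsetB hp (h1 _ (h.mem_parts k)).1.2
    · rw [h.dom] at hx
      obtain ⟨U, hU, hxU⟩ := Cert.covers_sound hp h3 x hx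
      obtain ⟨c, hc, rfl⟩ := List.mem_map.1 hU
      obtain ⟨k, rfl⟩ := h.exists_index hc
      exact mem_iUnion.2 ⟨k, by rw [h.atom]; exact hxU⟩
  · rw [h.iso, h.dom]
    rw [h.atom] at hx
    exact CTile.subset_of_subsetB hp (h1 _ (h.mem_parts k)).2 (CTile.mem_image.2 hx)

/-- The images of the atoms are disjoint. -/
def reversibleB (S : CSys) : Bool := pairwiseDisjointB S.images

theorem Models.reversible (h : S.Models p X) (hp : Positive p) (hX : X.IsDressed)
    (hr : S.reversibleB = true) : X.Reversible := by
  intro x hx y hy hxy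
  obtain ⟨i, hi⟩ := DressedDomain.exists_mem_atom hX hx
  obtain ⟨j, hj⟩ := DressedDomain.exists_mem_atom hX hy
  rw [DressedDomain.map_of_mem hX hi, DressedDomain.map_of_mem hX hj, h.iso, h.iso] at hxy
  have hd := List.pairwise_iff_getElem.1 (disjoint_of_pairwiseDisjointB hp hr)
  have key : ∀ i j : Fin n, i < j → Disjoint (((S.atom i).image (S.iso i)).set p)
      (((S.atom j).image (S.iso j)).set p) := by
    intro i j hij
    have := hd i j (by simp [images, h.length]) (by simp [images, h.length]) hij
    simpa [images, h.getElem] using this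
  rw [h.atom] at hi hj
  have hi' := (CTile.mem_image (p := p) (g := S.iso i)).2 hi
  have hj' := (CTile.mem_image (p := p) (g := S.iso j)).2 hj
  rcases lt_trichotomy i j with hlt | rfl | hlt
  · exact absurd (hxy ▸ hj') (Set.disjoint_left.1 (key i j hlt) hi')
  · exact (Isom.apply_bijective _).injective hxy
  · exact absurd (hxy ▸ hi') (Set.disjoint_left.1 (key j i hlt) hj')

/-- The images of the atoms cover the domain. -/
def ontoB (S : CSys) (c : Cert) : Bool := c.covers S.images S.dom

theorem Models.ontoDom (h : S.Models p X) (hp : Positive p) {c : Cert}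
    (hc : S.ontoB c = true) : X.OntoDom := by
  intro y hy
  rw [h.dom] at hy
  obtain ⟨U, hU, hyU⟩ := Cert.covers_sound hp hc y hy
  obtain ⟨c, hc, rfl⟩ := List.mem_map.1 hU
  obtain ⟨k, rfl⟩ := h.exists_index hc
  rw [CTile.set_image] at hyU
  obtain ⟨x, hx, rfl⟩ := hyU
  exact ⟨k, x, by rw [h.atom]; exact hx, by rw [h.iso]⟩

/-! ### Following words -/

/-- Follow the tile `T` along the word. The test `avoid` is applied to the tile before each
step, and to the atom that contains it, and the test `last` at the end. -/
def walkB (S : CSys) (last : CTile → Bool) (avoid : CTile → CTile → Bool) :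
    List (Fin n) → CTile → Bool
  | [], T => last T
  | k :: w, T => avoid (S.atom k) T && T.subsetB (S.atom k) &&
      walkB S last avoid w (T.image (S.iso k))

/-- The isometry of a word. -/
def composite (S : CSys) : List (Fin n) → CIso
  | [] => CIso.one
  | k :: w => (composite S w).comp (S.iso k)

/-- The tiles of the orbit of `T` along the word. -/
def orbit (S : CSys) : List (Fin n) → CTile → List CTile
  | [], _ => []
  | k :: w, T => T :: orbit S w (T.image (S.iso k))

theorem Models.image_tile (h : S.Models p X) (hX : X.IsDressed) {T : CTile} {k : Fin n}
    (hT : T.set p ⊆ X.atom k) : X.map '' T.set p = (T.image (S.iso k)).set p := by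
  rw [CTile.set_image]
  refine image_congr fun x hx => ?_
  rw [DressedDomain.map_of_mem hX (hT hx), h.iso]

theorem Models.walk (h : S.Models p X) (hp : Positive p) (hX : X.IsDressed)
    {last : CTile → Bool} {avoid : CTile → CTile → Bool} : ∀ (w : List (Fin n)) (T : CTile),
    walkB S last avoid w T = true → X.Follows (T.set p) w ∧
      (∀ i < w.length, ∃ U V : CTile, X.map^[i] '' T.set p = U.set p ∧ U.set p ⊆ V.set p ∧
        avoid V U = true) ∧
      (∃ U : CTile, X.map^[w.length] '' T.set p = U.set p ∧ last U = true) ∧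
      ∀ x ∈ T.set p, X.map^[w.length] x = ((composite S w).toIsom p).apply x
  | [], T, hw => by
    refine ⟨fun i hi => by simp at hi, fun i hi => by simp at hi, ⟨T, by simp, hw⟩, fun x _ => ?_⟩
    simp [composite, CIso.one_apply]
  | k :: w, T, hw => by
    simp only [walkB, Bool.and_eq_true] at hw
    have hT : T.set p ⊆ X.atom k := by
      rw [h.atom]
      exact CTile.subset_of_subsetB hp hw.1.2
    have him := h.image_tile hX hT
    obtain ⟨h1, h2, ⟨U, hU, hs⟩, h4⟩ := Models.walk h hp hX w _ hw.2
    rw [← him] at h1 h2 hU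
    refine ⟨?_, ?_, ⟨U, ?_, hs⟩, ?_⟩
    · rintro (_ | i) hi
      · simpa using hT
      · rw [Function.iterate_succ, image_comp]
        exact h1 i (by simpa using hi)
    · rintro (_ | i) hi
      · exact ⟨T, S.atom k, by simp, h.atom k ▸ hT, hw.1.1⟩
      · rw [Function.iterate_succ, image_comp]
        exact h2 i (by simpa using hi)
    · rw [List.length_cons, Function.iterate_succ, image_comp, hU]
    · intro x hx
      rw [List.length_cons, Function.iterate_succ_apply, composite, CIso.comp_apply]
      rw [h4 _ (by rw [← him]; exact mem_image_of_mem _ hx)]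
      rw [DressedDomain.map_of_mem hX (hT hx), h.iso]

theorem Models.orbit (h : S.Models p X) (hX : X.IsDressed) : ∀ (w : List (Fin n)) (T : CTile),
    X.Follows (T.set p) w → ∀ U ∈ CSys.orbit S w T, ∃ i < w.length,
      U.set p = X.map^[i] '' T.set p
  | [], T, _, U, hU => by simp [CSys.orbit] at hU
  | k :: w, T, hw, U, hU => by
    rcases List.mem_cons.1 hU with rfl | hU
    · exact ⟨0, by simp, by simp⟩
    · have hT : T.set p ⊆ X.atom k := by
        have := hw 0 (by simp)
        rwa [Function.iterate_zero, image_id] at this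
      have him := h.image_tile hX hT
      have hw' : X.Follows ((T.image (S.iso k)).set p) w := by
        intro i hi
        rw [← him, ← image_comp, ← Function.iterate_succ]
        exact hw (i + 1) (by simpa using hi)
      obtain ⟨i, hi, hiU⟩ := Models.orbit h hX w _ hw' U hU
      refine ⟨i + 1, by simpa using hi, ?_⟩
      rw [hiU, ← him, ← image_comp, ← Function.iterate_succ]

/-- The tile `T` is outside `D`, by itself or since the larger tile `U` is. -/
def avoidsB (D U T : CTile) : Bool := U.disjointB D || T.disjointB D

theorem disjoint_of_avoidsB (hp : Positive p) {D U T : CTile} (h : avoidsB D U T = true)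
    (hTU : T.set p ⊆ U.set p) : Disjoint (T.set p) (D.set p) := by
  rw [avoidsB, Bool.or_eq_true] at h
  rcases h with h | h
  · exact (CTile.disjoint_of_disjointB hp h).mono_left hTU
  · exact CTile.disjoint_of_disjointB hp h

/-- The tile returns to `D` for the first time along the word. -/
def returnB (S : CSys) (D T : CTile) : List (Fin n) → Bool
  | [] => false
  | k :: w => T.subsetB (S.atom k) &&
      walkB S (fun U => U.subsetB D) (avoidsB D) w (T.image (S.iso k))

theorem Models.hasReturnPath (h : S.Models p X) (hp : Positive p) (hX : X.IsDressed) {D T : CTile}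
    {w : List (Fin n)} (hw : S.returnB D T w = true) :
    X.HasReturnPath (D.set p) (T.set p) w ∧
      ∀ x ∈ T.set p, X.map^[w.length] x = ((composite S w).toIsom p).apply x := by
  match w with
  | [] => simp [returnB] at hw
  | k :: w =>
    simp only [returnB, Bool.and_eq_true] at hw
    have hT : T.set p ⊆ X.atom k := by
      rw [h.atom]
      exact CTile.subset_of_subsetB hp hw.1
    have him := h.image_tile hX hT
    obtain ⟨h1, h2, ⟨U, hU, hs⟩, h4⟩ := h.walk hp hX w _ hw.2
    rw [← him] at h1 h2 hU
    refine ⟨⟨by simp, ?_, ?_, ?_⟩, fun x hx => ?_⟩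
    · rintro (_ | i) hi
      · simpa using hT
      · rw [Function.iterate_succ, image_comp]
        exact h1 i (by simpa using hi)
    · rw [List.length_cons, Function.iterate_succ, image_comp, hU]
      exact CTile.subset_of_subsetB hp hs
    · rintro (_ | i) hi hi'
      · simp at hi
      · rw [Function.iterate_succ, image_comp]
        obtain ⟨U, V, hU, hUV, hd⟩ := h2 i (by simpa using hi')
        rw [hU]
        exact disjoint_of_avoidsB hp hd hUV
    · rw [List.length_cons, Function.iterate_succ_apply, composite, CIso.comp_apply,
        h4 _ (by rw [← him]; exact mem_image_of_mem _ hx), DressedDomain.map_of_mem hX (hT hx),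
        h.iso]

/-- The atoms of `S'` are empty, or return to the domain of `S'` along the words, with the
isometries of `S'`. -/
def subdomainB (S S' : CSys) (w : List (List (Fin n))) : Bool :=
  Nat.beq w.length S'.parts.length && S'.dom.subsetB S.dom &&
    (w.zip S'.parts).all fun c => c.2.1.emptyB ||
      (S.returnB S'.dom c.2.1 c.1 && (S.composite c.1).eqB c.2.2)

theorem Models.isSubdomain (h : S.Models p X) (hp : Positive p) (hX : X.IsDressed) {S' : CSys}
    {Y : DressedDomain m} (h' : S'.Models p Y) (hY : Y.IsDressed) {w : List (List (Fin n))}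
    (hw : S.subdomainB S' w = true) : Y.IsSubdomain X := by
  simp only [subdomainB, Bool.and_eq_true, List.all_eq_true, Nat.beq_eq] at hw
  refine ⟨hY, ?_, fun k x hx => ?_⟩
  · rw [h.dom, h'.dom]
    exact CTile.subset_of_subsetB hp hw.1.2
  have hk : (k : ℕ) < w.length := by rw [hw.1.1, h'.length]; exact k.2
  have hmem : (w[(k : ℕ)], (S'.atom k, S'.iso k)) ∈ w.zip S'.parts := by
    rw [← h'.getElem k, ← List.getElem_zip (h := by simp [hk, ← hw.1.1])]
    exact List.getElem_mem _
  have := hw.2 _ hmem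
  rw [h'.atom] at hx
  rw [Bool.or_eq_true, Bool.and_eq_true] at this
  rcases this with he | ⟨h1, h2⟩
  · rw [CTile.set_of_emptyB hp he] at hx
    exact hx.elim
  · obtain ⟨⟨hne, hf, hret, hfirst⟩, hiso⟩ := h.hasReturnPath hp hX h1
    refine ⟨_, List.length_pos_iff.2 hne, ?_, ?_, fun i hi hi' => ?_⟩
    · rw [hiso x hx, h'.iso, CIso.apply_eq h2]
    · rw [h'.dom]
      exact hret (mem_image_of_mem _ hx)
    · rw [h'.dom]
      exact Set.disjoint_left.1 (hfirst i hi hi') (mem_image_of_mem _ hx)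

/-! ### Periodic tiles -/

/-- The point `v / N` lies in the interior of the tile, or in the tile itself if `strict` is
false. -/
def _root_.RhombusPWI.CTile.containsB (strict : Bool) (T : CTile) (N : ℕ) (v : Vec) : Bool :=
  !Nat.beq N 0 && T.all fun c =>
    (fun g : Form => bif strict || isEven c.1 then g.pos else g.nonneg)
      ((c.2.smul ⟨N, 0⟩).sub (v.coord c.1))

theorem _root_.RhombusPWI.CTile.lt_of_containsB (hp : Positive p) {strict : Bool} {T : CTile}
    {N : ℕ} {v : Vec} (h : T.containsB strict N v = true) {c : Cond} (hc : c ∈ T) :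
    nd c.1 ((N : ℝ)⁻¹ • v.eval p) ≤ c.2.eval p ∧
      (strict = true ∨ c.1 % 2 = 0 → nd c.1 ((N : ℝ)⁻¹ • v.eval p) < c.2.eval p) := by
  simp only [CTile.containsB, Bool.and_eq_true, List.all_eq_true, Bool.not_eq_true',
    Bool.eq_false_iff, ne_eq, Nat.beq_eq] at h
  have hN : (0 : ℝ) < N := by exact_mod_cast Nat.pos_of_ne_zero h.1
  have hc := h.2 c hc
  have he : ((c.2.smul ⟨N, 0⟩).sub (v.coord c.1)).eval p = N * c.2.eval p - nd c.1 (v.eval p) := by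
    rw [Form.eval_sub, Form.eval_smul, Vec.eval_coord]
    simp [Zw.val]
  rw [nd_smul, inv_mul_le_iff₀ hN, inv_mul_lt_iff₀ hN]
  by_cases hb : (strict || isEven c.1) = true
  · rw [hb, cond_true] at hc
    have := Form.eval_pos hp hc
    rw [he] at this
    exact ⟨by linarith, fun _ => by linarith⟩
  · have hb' := Bool.eq_false_iff.2 hb
    rw [hb', cond_false] at hc
    have := Form.eval_nonneg hp hc
    rw [he] at this
    refine ⟨by linarith, fun h => absurd ?_ hb⟩
    rcases h with h | h <;> simp [h, isEven]

theorem _root_.RhombusPWI.CTile.nonempty (hp : Positive p) {T : CTile} {strict : Bool} {N : ℕ}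
    {v : Vec} (h : T.containsB strict N v = true) : (T.set p).Nonempty := by
  refine ⟨(N : ℝ)⁻¹ • v.eval p, fun c hc => ?_⟩
  obtain ⟨h1, h2⟩ := CTile.lt_of_containsB hp h hc
  unfold Cond.Holds
  split_ifs with h0
  · exact h2 (Or.inr h0)
  · exact h1

theorem _root_.RhombusPWI.continuous_nd (d : ℕ) : Continuous (nd d) := by
  unfold nd
  rcases mod_ten_cases d with h | h | h | h | h | h | h | h | h | h <;> simp only [h] <;> fun_prop

theorem _root_.RhombusPWI.CTile.interior_nonempty (hp : Positive p) {T : CTile} {N : ℕ} {v : Vec}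
    (h : T.containsB true N v = true) : (interior (T.set p)).Nonempty := by
  refine ⟨(N : ℝ)⁻¹ • v.eval p, mem_interior.2 ⟨{x | ∀ c ∈ T, nd c.1 x < c.2.eval p}, ?_, ?_, ?_⟩⟩
  · intro x hx c hc
    have := hx c hc
    unfold Cond.Holds
    split_ifs <;> linarith
  · have : {x | ∀ c ∈ T, nd c.1 x < c.2.eval p} =
        ⋂ c ∈ {c | c ∈ T}, {x | nd c.1 x < c.2.eval p} := by
      ext; simp
    rw [this]
    exact T.finite_toSet.isOpen_biInter fun c _ =>
      isOpen_lt (continuous_nd _) continuous_const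
  · exact fun c hc => (CTile.lt_of_containsB hp h hc).2 (Or.inl rfl)

/-- The tile is mapped onto itself along the word, outside the tile `D`. -/
def periodicB (S : CSys) (D T : CTile) (w : List (Fin n)) : Bool :=
  !w.isEmpty && T.boundedB &&
    walkB S (fun U => U.subsetB T && T.subsetB U) (avoidsB D) w T

theorem Models.isPeriodicTile (h : S.Models p X) (hp : Positive p) (hX : X.IsDressed)
    {D T : CTile} {w : List (Fin n)} (hw : S.periodicB D T w = true) (hT : (T.set p).Nonempty) :
    X.IsPeriodicTile (T.set p) w ∧
      ∀ i < w.length, Disjoint (X.map^[i] '' T.set p) (D.set p) := by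
  simp only [periodicB, Bool.and_eq_true, Bool.not_eq_true', List.isEmpty_eq_false_iff] at hw
  obtain ⟨h1, h2, ⟨U, hU, hs⟩, -⟩ := h.walk hp hX w _ hw.2
  rw [Bool.and_eq_true] at hs
  refine ⟨⟨CTile.isTile hw.1.2, hT, hw.1.1, h1, ?_⟩, fun i hi => ?_⟩
  · rw [hU]
    exact Subset.antisymm (CTile.subset_of_subsetB hp hs.1) (CTile.subset_of_subsetB hp hs.2)
  · obtain ⟨U, V, hU, hUV, hd⟩ := h2 i hi
    rw [hU]
    exact disjoint_of_avoidsB hp hd hUV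

end CSys

end

section

/-! ### Affine functions of the parameters and their values at the vertices of a cone -/

/-- The scalar product of two coefficient vectors. -/
def Form.dot (f v : Form) : Zw := ((f.x.mul v.x).add (f.y.mul v.y)).add (f.z.mul v.z)

/-- Three generators of a cone. -/
structure Verts where
  a : Form
  b : Form
  c : Form

/-- The point with coordinates `p` with respect to the generators. -/
noncomputable def Verts.point (V : Verts) (p : ℝ × ℝ × ℝ) : ℝ × ℝ × ℝ :=
  (p.1 * V.a.x.val + p.2.1 * V.b.x.val + p.2.2 * V.c.x.val,
    p.1 * V.a.y.val + p.2.1 * V.b.y.val + p.2.2 * V.c.y.val,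
    p.1 * V.a.z.val + p.2.1 * V.b.z.val + p.2.2 * V.c.z.val)

/-- The form, written in coordinates with respect to the generators. -/
def Form.atVerts (V : Verts) (f : Form) : Form := ⟨f.dot V.a, f.dot V.b, f.dot V.c⟩

variable {V : Verts} {p : ℝ × ℝ × ℝ}

theorem Form.eval_atVerts {f : Form} : (f.atVerts V).eval p = f.eval (V.point p) := by
  simp only [eval, atVerts, dot, Verts.point, Zw.val_add, Zw.val_mul]; ring

def Vec.atVerts (V : Verts) (v : Vec) : Vec := ⟨v.x.atVerts V, v.y.atVerts V⟩

theorem Vec.eval_atVerts {v : Vec} : (v.atVerts V).eval p = v.eval (V.point p) := by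
  simp only [eval, atVerts, Form.eval_atVerts]

def CIso.atVerts (V : Verts) (g : CIso) : CIso := ⟨g.rot, g.trans.atVerts V⟩

theorem CIso.toIsom_atVerts {g : CIso} : (g.atVerts V).toIsom p = g.toIsom (V.point p) := by
  simp only [toIsom, atVerts, Vec.eval_atVerts]

def CTile.atVerts (V : Verts) (T : CTile) : CTile := T.map fun c => (c.1, c.2.atVerts V)

theorem CTile.set_atVerts {T : CTile} : (T.atVerts V).set p = T.set (V.point p) := by
  ext x
  simp only [set, atVerts, mem_ofPred_eq, List.forall_mem_map, Cond.Holds, Form.eval_atVerts]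

/-- The data, written in coordinates with respect to the generators. -/
def CSys.atVerts (V : Verts) (S : CSys) : CSys :=
  ⟨S.dom.atVerts V, S.parts.map fun c => (c.1.atVerts V, c.2.atVerts V)⟩

theorem CSys.Models.atVerts {S : CSys} {n : ℕ} {X : DressedDomain n}
    (h : S.Models (V.point p) X) : (S.atVerts V).Models p X := by
  have hk : ∀ k : Fin n, (S.atVerts V).parts.getD k ([], CIso.one) =
      ((S.atom k).atVerts V, (S.iso k).atVerts V) := by
    intro k
    have h1 : (k : ℕ) < S.parts.length := h.length ▸ k.2
    rw [List.getD_eq_getElem _ _ (by simpa [CSys.atVerts] using h1)]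
    simp only [CSys.atVerts, List.getElem_map, h.getElem k]
  refine ⟨by simpa [CSys.atVerts] using h.length, ?_, fun k => ?_, fun k x => ?_⟩
  · rw [h.dom, ← CTile.set_atVerts]; rfl
  · simp only [CSys.atom, hk, CTile.set_atVerts]
    rw [← CSys.atom, h.atom]
  · simp only [CSys.iso, hk, CIso.toIsom_atVerts]
    rw [← CSys.iso, h.iso]

/-! ### Two-parameter tiles -/

theorem Zw.val_mem (x : Zw) : x.val ∈ QSqrt5 := by
  refine ⟨x.a + x.b / 2, x.b / 2, ?_⟩
  simp only [val, ω]; push_cast; ring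

/-- The condition with an affine edge coordinate, as part of a two-parameter tile. -/
noncomputable def Cond.toParam (c : Cond) : Fin 5 × ℤ × (ℝ × ℝ × ℝ) :=
  if c.1 % 2 = 0 then (Fin.ofNat 5 (c.1 / 2), 1, (c.2.x.val, c.2.y.val, c.2.z.val))
  else (Fin.ofNat 5 ((c.1 + 5) / 2), -1, (c.2.neg.x.val, c.2.neg.y.val, c.2.neg.z.val))

/-- The two-parameter tile given by the forms, with the variables `1`, `s`, `t`. -/
noncomputable def CTile.toParam (T : CTile) : ParamTile := T.map Cond.toParam

theorem CTile.overQSqrt5 (T : CTile) : T.toParam.OverQSqrt5 := by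
  simp only [ParamTile.OverQSqrt5, toParam, List.forall_mem_map]
  intro c _
  unfold Cond.toParam
  split_ifs <;> exact ⟨Zw.val_mem _, Zw.val_mem _, Zw.val_mem _⟩

theorem CTile.carrier_toParam (T : CTile) (s t : ℝ) :
    (T.toParam.at s t).carrier = T.set (1, s, t) := by
  rw [← carrier_toTile]
  congr 1
  simp only [ParamTile.at, toParam, toTile, List.map_map]
  refine List.map_congr_left fun c _ => ?_
  simp only [Function.comp, Cond.toParam, Cond.toTriple]
  split_ifs
  · simp [Form.eval]
  · simp [Form.eval, Form.neg, Zw.val_neg]; ring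

/-! ### Copies on another scale -/

theorem CSys.Models.scaleImage {S : CSys} {n : ℕ} {X : DressedDomain n} (h : S.Models p X)
    {G : CSim} (hG : 0 < G.scale.val) : ∃ Y : DressedDomain n,
      DressedDomain.IsImage (G.toSim p hG) X Y ∧ (S.scaleImage G).Models p Y := by
  have hk : ∀ k : Fin n, (S.scaleImage G).parts.getD k ([], CIso.one) =
      ((S.atom k).scaleImage G, (S.iso k).conj G) := by
    intro k
    have h1 : (k : ℕ) < S.parts.length := h.length ▸ k.2
    rw [List.getD_eq_getElem _ _ (by simpa [CSys.scaleImage] using h1)]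
    simp only [CSys.scaleImage, List.getElem_map, h.getElem k]
  refine ⟨⟨(G.toSim p hG).apply '' X.dom, fun k => (G.toSim p hG).apply '' X.atom k,
    fun k => ((S.iso k).conj G).toIsom p⟩, ⟨rfl, fun k => ⟨rfl, fun x => ?_⟩⟩, ?_, ?_, ?_, ?_⟩
  · have : (X.iso k).apply x = ((S.iso k).toIsom p).apply x := h.iso k x
    rw [this]
    exact CIso.conj_apply hG _ x
  · simpa [CSys.scaleImage] using h.length
  · simp only [h.dom, CSys.scaleImage, CTile.set_scaleImage hG]
  · intro k
    simp only [CSys.atom, hk, CTile.set_scaleImage hG]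
    rw [← CSys.atom, h.atom]
  · intro k x
    simp only [CSys.iso, hk]

end

section

/-! ### Vertices of tiles -/

/-- The common point of the two boundary lines, if the direction of `e` is one to four steps ahead
of that of `c`: the products `n_d · x` satisfy a linear recurrence in `d`. -/
def Cond.vertex (c e : Cond) : Vec :=
  (fun i : ℕ => (fun q : Form × Form => ⟨q.1, q.2.mulω.sub q.1⟩)
    ((fun q : Form × Form => (q.2, q.2.mulω.sub q.1))^[10 - c.1 % 10]
      (c.2, (fun g : Form => bif Nat.beq i 2 || Nat.beq i 3 then g.mulβ else g)
        (bif Nat.beq i 1 then e.2 else (c.2.mulSine (i - 1)).add e.2))))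
    ((e.1 + 9 * c.1) % 10)

/-- The sum of the vertices of a tile with conditions in cyclic order; `c` is the first of them, and
`prev` the one before the list. -/
def CTile.vertexSum (c : Cond) : Cond → CTile → Vec
  | prev, [] => prev.vertex c
  | prev, e :: T => (prev.vertex e).add (vertexSum c e T)

/-- The barycenter of the vertices lies in the tile, or in its interior if `strict` holds. -/
def CTile.hasCenterB (strict : Bool) (T : CTile) : Bool :=
  match T with
  | [] => false
  | c :: l => T.containsB strict T.length (vertexSum c c l)

variable {p : ℝ × ℝ × ℝ} {m n : ℕ}

theorem CTile.nonempty_of_hasCenterB (hp : Positive p) {T : CTile} {strict : Bool}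
    (h : T.hasCenterB strict = true) : (T.set p).Nonempty := by
  match T with
  | [] => simp [hasCenterB] at h
  | c :: l => exact CTile.nonempty hp h

theorem CTile.interior_nonempty_of_hasCenterB (hp : Positive p) {T : CTile}
    (h : T.hasCenterB true = true) : (interior (T.set p)).Nonempty := by
  match T with
  | [] => simp [hasCenterB] at h
  | c :: l => exact CTile.interior_nonempty hp h

/-! ### Orbits which meet a given set -/

namespace DressedDomain

variable {X : DressedDomain n}

/-- The points whose orbits visit `E`. -/
def basin (X : DressedDomain n) (E : Set Plane) : Set Plane := {x | ∃ i, X.map^[i] x ∈ E}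

theorem subset_basin (E : Set Plane) : E ⊆ X.basin E := fun _ hx => ⟨0, hx⟩

theorem mem_basin_of_iterate {E : Set Plane} {x : Plane} (i : ℕ) (h : X.map^[i] x ∈ X.basin E) :
    x ∈ X.basin E := by
  obtain ⟨j, hj⟩ := h
  exact ⟨j + i, by rwa [Function.iterate_add_apply]⟩

theorem IsSubdomain.mem_basin {Y : DressedDomain m} (hY : Y.IsSubdomain X) {E : Set Plane}
    {k : Fin m} {x : Plane} (hx : x ∈ Y.atom k) (h : (Y.iso k).apply x ∈ X.basin E) :
    x ∈ X.basin E := by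
  obtain ⟨j, -, hj, -⟩ := hY.2.2 k x hx
  exact mem_basin_of_iterate j (hj ▸ h)

theorem IsSubdomain.mem_basin_of_iterate {Y : DressedDomain m} (hY : Y.IsSubdomain X)
    {E : Set Plane} (i : ℕ) {x : Plane} (hx : x ∈ Y.dom) (h : Y.map^[i] x ∈ X.basin E) :
    x ∈ X.basin E := by
  induction i generalizing x with
  | zero => exact h
  | succ i ih =>
    obtain ⟨k, hk⟩ := exists_mem_atom hY.1 hx
    refine hY.mem_basin hk ?_
    rw [← map_of_mem hY.1 hk]
    exact ih (map_mem hY.1 hx) h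

end DressedDomain

namespace CSys

variable {S S' : CSys} {X : DressedDomain n} {Y : DressedDomain m} {E : Set Plane}

theorem Models.orbit_subset_basin (h : S.Models p X) (hX : X.IsDressed) {w : List (Fin n)}
    {T : CTile} (hw : X.Follows (T.set p) w) (hE : X.map^[w.length] '' T.set p ⊆ X.basin E)
    {U : CTile} (hU : U ∈ CSys.orbit S w T) : U.set p ⊆ X.basin E := by
  obtain ⟨i, hi, hiU⟩ := h.orbit hX w T hw U hU
  rw [hiU]
  rintro _ ⟨x, hx, rfl⟩
  refine DressedDomain.mem_basin_of_iterate (w.length - i) ?_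
  rw [← Function.iterate_add_apply, Nat.sub_add_cancel hi.le]
  exact hE (mem_image_of_mem _ hx)

theorem Models.periodic_orbit_subset_basin (h : S.Models p X) (hX : X.IsDressed)
    {w : List (Fin n)} {T : CTile} (hw : X.IsPeriodicTile (T.set p) w) (hE : T.set p ⊆ E)
    {U : CTile} (hU : U ∈ CSys.orbit S w T) : U.set p ⊆ X.basin E :=
  h.orbit_subset_basin hX hw.2.2.2.1
    (hw.2.2.2.2.symm ▸ hE.trans (DressedDomain.subset_basin E)) hU

theorem Models.return_orbit_subset_basin (h : S.Models p X) (hp : Positive p) (hX : X.IsDressed)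
    {w : List (List (Fin n))} (hw : S.subdomainB S' w = true)
    (hD : S'.dom.set p ⊆ X.basin E) {q : List (Fin n) × (CTile × CIso)} (hq : q ∈ w.zip S'.parts)
    {U : CTile} (hU : U ∈ CSys.orbit S q.1 q.2.1) : U.set p ⊆ X.basin E := by
  simp only [subdomainB, Bool.and_eq_true, List.all_eq_true] at hw
  have := hw.2 q hq
  rw [Bool.or_eq_true, Bool.and_eq_true] at this
  rcases this with he | ⟨h1, -⟩
  · have he := CTile.set_of_emptyB hp he
    refine h.orbit_subset_basin hX (w := q.1) (T := q.2.1) (fun i hi => ?_) ?_ hU <;>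
    simp [he]
  · obtain ⟨⟨-, hf, hret, -⟩, -⟩ := h.hasReturnPath hp hX h1
    exact h.orbit_subset_basin hX hf (hret.trans hD) hU

/-- Points can be moved by the isometries of a dressed sub-domain. -/
theorem Models.check_sound_subdomain (h' : S'.Models p Y) (hp : Positive p)
    (hY : Y.IsSubdomain X) {good lines : List (List CTile)} {c : Cert} {T : CTile}
    (hgood : ∀ l ∈ good, ∀ U ∈ l, U.set p ⊆ X.basin E)
    (hc : c.check S'.parts good lines T = true) : T.set p ⊆ X.basin E := by
  refine Cert.sound hp hgood (fun q hq x hx hx' => ?_) c T hc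
  obtain ⟨k, rfl⟩ := h'.exists_index hq
  refine hY.mem_basin (k := k) (by rw [h'.atom]; exact hx) ?_
  rw [h'.iso]
  exact hx'

/-- Points can be moved by the piecewise isometry itself. -/
theorem Models.check_sound (h : S.Models p X) (hp : Positive p)
    (hX : X.IsDressed) {good lines : List (List CTile)} {c : Cert} {T : CTile}
    (hgood : ∀ l ∈ good, ∀ U ∈ l, U.set p ⊆ X.basin E)
    (hc : c.check S.parts good lines T = true) : T.set p ⊆ X.basin E := by
  refine Cert.sound hp hgood (fun q hq x hx hx' => ?_) c T hc
  obtain ⟨k, rfl⟩ := h.exists_index hq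
  have hxk : x ∈ X.atom k := by rw [h.atom]; exact hx
  refine DressedDomain.mem_basin_of_iterate 1 ?_
  rw [Function.iterate_one, DressedDomain.map_of_mem hX hxk, h.iso]
  exact hx'

/-- The tests for a family of periodic tiles, with `M` repetitions of the itineraries for their
comparison. -/
def familyB (S : CSys) (D : CTile) (strict : Bool) (M : ℕ) {N : ℕ} (T : Fin N → CTile)
    (v : Fin N → List (Fin n)) : Bool :=
  (List.finRange N).all fun j => S.periodicB D (T j) (v j) && (T j).hasCenterB strict &&
    DressedDomain.unrelatedB M true (v j) (v j) &&
    (List.finRange N).all fun i => Nat.ble j i || DressedDomain.unrelatedB M false (v i) (v j)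

theorem Models.periodicFamily (h : S.Models p X) (hp : Positive p) (hX : X.IsDressed)
    {D : CTile} {strict : Bool} {M N : ℕ} {T : Fin N → CTile} {v : Fin N → List (Fin n)}
    (hf : S.familyB D strict M T v = true) :
    X.PeriodicFamily (D.set p) (fun j => (T j).set p) v := by
  simp only [familyB, List.all_eq_true, List.mem_finRange, forall_const, Bool.and_eq_true,
    Bool.or_eq_true, Nat.ble_eq] at hf
  have hper := fun j => h.isPeriodicTile hp hX (hf j).1.1.1
    (CTile.nonempty_of_hasCenterB hp (hf j).1.1.2)
  refine ⟨fun j => (hper j).1, fun j => (hper j).2, fun i j hij => ⟨M, ?_⟩,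
    fun j => ⟨M, (hf j).1.2⟩⟩
  exact ((hf j).2 i).resolve_left (not_le.2 hij)

theorem interior_nonempty_of_familyB (hp : Positive p)
    {D : CTile} {M N : ℕ} {T : Fin N → CTile} {v : Fin N → List (Fin n)}
    (hf : S.familyB D true M T v = true) (j : Fin N) : (interior ((T j).set p)).Nonempty := by
  simp only [familyB, List.all_eq_true, List.mem_finRange, forall_const, Bool.and_eq_true] at hf
  exact CTile.interior_nonempty_of_hasCenterB hp (hf j).1.1.2

theorem Models.hasReturnPath_of_subdomainB (h : S.Models p X) (hp : Positive p) (hX : X.IsDressed)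
    (h' : S'.Models p Y) {w : List (List (Fin n))} (hw : S.subdomainB S' w = true) {k : Fin m}
    (hk : (Y.atom k).Nonempty) : X.HasReturnPath Y.dom (Y.atom k) (w.getD k []) := by
  simp only [subdomainB, Bool.and_eq_true, List.all_eq_true, Nat.beq_eq] at hw
  have hkw : (k : ℕ) < w.length := by rw [hw.1.1, h'.length]; exact k.2
  have hmem : (w[(k : ℕ)], (S'.atom k, S'.iso k)) ∈ w.zip S'.parts := by
    rw [← h'.getElem k, ← List.getElem_zip (h := by simp [hkw, ← hw.1.1])]
    exact List.getElem_mem _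
  have := hw.2 _ hmem
  rw [h'.atom] at hk ⊢
  rw [Bool.or_eq_true, Bool.and_eq_true] at this
  rcases this with he | ⟨h1, h2⟩
  · rw [CTile.set_of_emptyB hp he] at hk
    exact absurd hk not_nonempty_empty
  · rw [List.getD_eq_getElem _ _ hkw, h'.dom]
    exact (h.hasReturnPath hp hX h1).1

end CSys

end

section

/-! ### The rhombus map and its induced maps -/

/-- The condition with direction `n_d` and edge coordinate `(a + b ω) + s₁ s + t₁ t`. -/
def cond (d : ℕ) (a b s₁ t₁ : ℤ) : Cond := (d, ⟨⟨a, b⟩, ⟨s₁, 0⟩, ⟨t₁, 0⟩⟩)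

/-- The constant form `a + b ω`. -/
def constant (a b : ℤ) : Form := ⟨⟨a, b⟩, ⟨0, 0⟩, ⟨0, 0⟩⟩

/-- The isometry `T_d R_r` with `d = (a + b ω, a' + b' ω)`. -/
def isometry (r : ℕ) (a b a' b' : ℤ) : CIso := ⟨r, constant a b, constant a' b'⟩

/-- The rhombus map `ℛ`. -/
def rhombusSys : CSys := ⟨[cond 0 1 0 0 (-1), cond 2 1 0 (-1) 0, cond 5 0 0 0 1, cond 7 0 0 1 0], [
  ([cond 2 1 0 (-1) 0, cond 5 0 0 0 1, cond 9 0 0 1 0], isometry 4 0 0 0 0),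
  ([cond 0 1 0 0 (-1), cond 2 1 0 (-1) 0, cond 4 0 0 (-1) 0, cond 5 0 0 0 1, cond 7 0 0 0 1,
    cond 9 1 0 1 0], isometry 4 0 0 1 0),
  ([cond 0 1 0 0 (-1), cond 4 (-1) 0 (-1) 0, cond 7 0 0 0 1], isometry 4 0 0 2 0),
  ([cond 2 0 0 0 (-1), cond 5 0 0 0 1, cond 7 0 0 1 0, cond 9 1 0 1 0], isometry 4 1 0 1 0),
  ([cond 0 1 0 0 (-1), cond 2 0 0 0 (-1), cond 4 (-1) 0 (-1) 0, cond 7 0 0 1 0],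
    isometry 4 1 0 2 0)]⟩

/-- The map induced on the atom `R₃`. -/
def sysR₃ : CSys := ⟨[cond 0 1 0 0 (-1), cond 4 (-1) 0 (-1) 0, cond 7 0 0 0 1], [
  ([cond 0 1 0 (-1) 0, cond 4 (-1) 0 (-1) 0, cond 6 4 (-3) (-1) 0], isometry 2 (-3) 3 3 (-2)),
  ([cond 0 1 0 0 (-1), cond 1 (-4) 3 0 1, cond 4 (-1) 0 (-1) 0, cond 7 0 0 0 1,
    cond 8 (-6) 4 (-1) 0], isometry 3 2 0 (-4) 3),
  ([cond 0 1 0 0 (-1), cond 4 (-1) 0 (-1) 0, cond 5 (-1) 0 1 0, cond 6 4 (-3) (-1) 0],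
    isometry 0 0 0 0 0),
  ([cond 0 1 0 0 (-1), cond 1 (-4) 3 1 0, cond 2 (-8) 5 (-1) 0, cond 6 4 (-3) 0 (-1)],
    isometry 1 7 (-4) (-9) 5),
  ([cond 0 1 0 (-1) 0, cond 3 6 (-4) 0 1, cond 7 0 0 0 1], isometry 2 (-8) 6 6 (-4)),
  ([cond 1 (-4) 3 1 0, cond 4 (-1) 0 (-1) 0, cond 6 4 (-3) 0 (-1), cond 7 8 (-5) 0 1],
    isometry 2 (-3) 3 11 (-7)),
  ([cond 1 (-4) 3 1 0, cond 2 (-8) 5 0 (-1), cond 6 4 (-3) 0 (-1), cond 7 8 (-5) 1 0],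
    isometry 2 (-3) 3 11 (-7)),
  ([cond 0 1 0 (-1) 0, cond 3 6 (-4) 1 0, cond 7 0 0 0 1, cond 8 (-6) 4 0 (-1)],
    isometry 0 0 0 (-8) 5),
  ([cond 0 1 0 0 (-1), cond 3 6 (-4) 0 1, cond 5 (-1) 0 1 0, cond 7 0 0 0 1], isometry 0 0 0 0 0),
  ([cond 0 1 0 0 (-1), cond 3 6 (-4) 1 0, cond 5 (-1) 0 1 0, cond 8 (-6) 4 0 (-1)],
    isometry 0 0 0 0 0)]⟩

/-- The map induced on the triangle `R₃₁`, which is the first atom of the map induced on `R₃`. -/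
def sysR₃₁ : CSys := ⟨[cond 0 1 0 (-1) 0, cond 4 (-1) 0 (-1) 0, cond 6 4 (-3) (-1) 0], [
  ([cond 0 1 0 (-1) 0, cond 2 5 (-3) (-1) 0, cond 4 (-1) 0 (-1) 0, cond 6 4 (-3) (-1) 0],
    isometry 2 (-3) 3 3 (-2)),
  ([cond 0 1 0 (-1) 0, cond 4 (-1) 0 (-1) 0, cond 6 12 (-8) (-1) 0], isometry 0 0 0 (-5) 3),
  ([cond 0 1 0 (-1) 0, cond 1 (-12) 8 0 1, cond 4 (-1) 0 (-1) 0, cond 7 (-5) 3 0 1,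
    cond 8 (-11) 7 (-1) 0], isometry 1 12 (-7) (-9) 5),
  ([cond 0 1 0 (-1) 0, cond 1 (-12) 8 1 0, cond 4 (-1) 0 (-1) 0, cond 6 12 (-8) 0 (-1)],
    isometry 1 12 (-7) (-9) 5),
  ([cond 2 5 (-3) 0 (-1), cond 4 (-1) 0 (-1) 0, cond 7 (-5) 3 1 0, cond 8 (-11) 7 (-1) 0],
    isometry 1 12 (-7) (-9) 5),
  ([cond 0 1 0 (-1) 0, cond 3 11 (-7) 0 1, cond 7 (-5) 3 0 1], isometry 0 0 0 (-13) 8),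
  ([cond 0 1 0 (-1) 0, cond 3 11 (-7) 1 0, cond 7 (-5) 3 0 1, cond 8 (-11) 7 0 (-1)],
    isometry 0 0 0 (-13) 8),
  ([cond 0 1 0 (-1) 0, cond 2 5 (-3) 0 (-1), cond 3 11 (-7) 0 1, cond 7 (-5) 3 1 0],
    isometry 0 0 0 (-13) 8),
  ([cond 2 5 (-3) 0 (-1), cond 3 11 (-7) 1 0, cond 7 (-5) 3 1 0, cond 8 (-11) 7 0 (-1)],
    isometry 0 0 0 (-13) 8)]⟩

/-- The dressed domain `𝒜`. -/
def sysA : CSys := ⟨[cond 0 1 0 (-1) 0, cond 4 (-1) 0 (-1) 0, cond 7 (-5) 3 1 0], [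
  ([cond 0 1 0 (-1) 0, cond 3 11 (-7) 0 1, cond 7 (-5) 3 0 1], isometry 2 (-24) 16 16 (-10)),
  ([cond 0 1 0 (-1) 0, cond 3 11 (-7) 1 0, cond 7 (-5) 3 0 1, cond 8 (-11) 7 0 (-1)],
    isometry 2 (-24) 16 16 (-10)),
  ([cond 0 1 0 (-1) 0, cond 2 5 (-3) 0 (-1), cond 3 11 (-7) 0 1, cond 7 (-5) 3 1 0],
    isometry 2 (-24) 16 16 (-10)),
  ([cond 2 5 (-3) 0 (-1), cond 3 11 (-7) 1 0, cond 7 (-5) 3 1 0, cond 8 (-11) 7 0 (-1)],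
    isometry 2 (-24) 16 16 (-10)),
  ([cond 0 1 0 (-1) 0, cond 1 (-12) 8 0 1, cond 4 (-1) 0 (-1) 0, cond 7 (-5) 3 0 1,
    cond 8 (-11) 7 (-1) 0], isometry 3 2 0 (-7) 5),
  ([cond 0 1 0 (-1) 0, cond 1 (-12) 8 1 0, cond 4 (-1) 0 (-1) 0, cond 6 12 (-8) 0 (-1)],
    isometry 3 2 0 (-7) 5),
  ([cond 2 5 (-3) 0 (-1), cond 4 (-1) 0 (-1) 0, cond 7 (-5) 3 1 0, cond 8 (-11) 7 (-1) 0],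
    isometry 3 2 0 (-7) 5),
  ([cond 0 1 0 (-1) 0, cond 4 (-1) 0 (-1) 0, cond 6 12 (-8) (-1) 0], isometry 2 (-11) 8 8 (-5))]⟩

/-- The dressed domain `𝒞`. -/
def sysC : CSys := ⟨[cond 0 1 0 (-1) 0, cond 4 (-1) 0 (-1) 0, cond 7 (-5) 3 1 0], [
  ([cond 0 1 0 (-1) 0, cond 4 (-1) 0 (-1) 0, cond 6 12 (-8) (-1) 0], isometry 2 (-11) 8 8 (-5)),
  ([cond 0 1 0 (-1) 0, cond 1 (-12) 8 1 0, cond 4 (-1) 0 (-1) 0, cond 7 (-5) 3 1 0,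
    cond 8 (-11) 7 (-1) 0], isometry 3 2 0 (-7) 5),
  ([cond 0 1 0 (-1) 0, cond 3 11 (-7) 1 0, cond 7 (-5) 3 1 0], isometry 2 (-24) 16 16 (-10))]⟩

/-- The return paths of the atoms of `R₃`, in the atoms of the rhombus. -/
def pathsR₃ : List (List (Fin 5)) := [
  word 4 31221221,
  word 4 312212121221,
  word 4 312212212422214,
  word 4 312212142221522214221221,
  word 4 31221212122122122121212212212212121221,
  word 4 31221214222152221422122122122121422214,
  word 4 31221214222152221422122124222142422214,
  word 4 31221212122124222142212212212212142221522214221221,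
  word 4 31221212122122122121212212212212121221242221422122122122121422214,
  word 4 31221212122124222142212212212212142221452221422122122122121422214]

/-- The return paths of the atoms of `R₃₁`, in the atoms of `R₃`. -/
def pathsR₃₁ : List (List (Fin 10)) := [word 9 1, word 9 12, word 9 1222, word 9 124, word 9 142,
  word 9 1252, word 9 128, word 9 1622, word 9 174]

/-- The return paths of the atoms of `𝒜`, in the atoms of `R₃₁`. -/
def pathsA : List (List (Fin 9)) := [word 8 61, word 8 71, word 8 81, word 8 91, word 8 31, word 8
  41, word 8 51, word 8 21]

/-- The return paths of the atoms of `𝒜`, in the atoms of the rhombus. -/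
def longPathsA : List (List (Fin 5)) := [
  word 4 312212213122121212213122121212212212212121221221221212122131221212122131221221,
  word 4 312212213122121212213122121212212422214221221221221214222152221422122131221221,
  word 4 312212213122121422215222142212212212212142221431221212122131221212122131221221,
  word 4 312212213122121422215222142212212422214242221431221214222152221422122131221221,
  word 4 3122122131221212122131221212122131221212122131221221,
  word 4 3122122131221212122131221214222152221422122131221221,
  word 4 3122122131221214222152221422122131221212122131221221,
  word 4 3122122131221212122131221221]

/-- The thirteen periodic tiles. -/
def periodicTiles : List CTile := [
  [cond 0 1 0 (-1) 0, cond 2 1 0 (-1) 0, cond 4 0 0 (-1) 0, cond 6 1 (-1) (-1) 0,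
    cond 8 0 0 (-1) 0],
  [cond 0 2 (-1) (-1) 0, cond 1 1 0 0 1, cond 2 1 0 (-1) 0, cond 3 1 0 0 1, cond 4 2 (-1) (-1) 0,
    cond 5 0 0 0 1, cond 6 1 (-1) (-1) 0, cond 7 1 (-1) 0 1, cond 8 1 (-1) (-1) 0, cond 9 0 0 0 1],
  [cond 1 (-9) 6 0 1, cond 3 (-1) 1 0 1, cond 5 (-5) 3 0 1, cond 7 (-7) 4 0 1, cond 9 0 0 0 1],
  [cond 1 (-1) 1 0 1, cond 3 (-1) 1 0 1, cond 5 0 0 0 1, cond 7 (-2) 1 0 1, cond 9 0 0 0 1],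
  [cond 0 5 (-3) (-1) 0, cond 2 1 0 (-1) 0, cond 4 2 (-1) (-1) 0, cond 6 4 (-3) (-1) 0, cond 8 (-1)
    0 (-1) 0],
  [cond 0 5 (-3) 0 (-1), cond 3 (-1) 1 0 1, cond 5 (-5) 3 1 0, cond 7 (-7) 4 0 1],
  [cond 2 1 0 (-1) 0, cond 3 1 0 1 0, cond 4 2 (-1) (-1) 0, cond 8 (-1) 0 0 (-1)],
  [cond 2 (-1) 1 0 (-1), cond 5 3 (-2) 0 1, cond 7 1 (-1) 1 0, cond 9 0 0 0 1],
  [cond 0 (-3) 2 0 (-1), cond 2 (-1) 1 0 (-1), cond 5 3 (-2) 1 0, cond 7 1 (-1) 1 0],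
  [cond 1 (-1) 1 1 0, cond 3 (-1) 1 0 1, cond 6 1 (-1) 0 (-1), cond 9 0 0 0 1],
  [cond 1 4 (-2) 0 1, cond 3 (-1) 1 0 1, cond 5 3 (-2) 0 1, cond 7 1 (-1) 0 1, cond 9 0 0 0 1],
  [cond 0 5 (-3) 0 (-1), cond 2 7 (-4) 0 (-1), cond 5 (-5) 3 1 0, cond 7 (-7) 4 1 0],
  [cond 1 (-1) 1 1 0, cond 3 (-1) 1 1 0, cond 6 1 (-1) 0 (-1), cond 8 1 (-1) 0 (-1)]]

/-- The itineraries of the periodic tiles. -/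
def itineraries : List (List (Fin 5)) := [
  word 4 2,
  word 4 122,
  word 4 121212213122,
  word 4 12,
  word 4 12212213,
  word 4 121212213122121212213122121212213122121422215222142212213122,
  word 4 122122124222143,
  word 4 12121221221221212122122122121212212422214221221221221214222143122,
  word 4 12121221242221422122122122121422214522214221221221221214222143122,
  word 4 1212121422,
  word 4 1212122122122,
  word 4 121212213122121422215222142212213122121422215222142212213122,
  word 4 1214221422]

/-- The vertices `(s, t)` of the triangle of parameters, as vectors `20 (1, s, t)`. -/
def triangleVerts : Verts :=
  ⟨⟨⟨20, 0⟩, ⟨-28, 16⟩, ⟨-28, 16⟩⟩, ⟨⟨20, 0⟩, ⟨160, -100⟩, ⟨-180, 110⟩⟩,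
    ⟨⟨20, 0⟩, ⟨160, -100⟩, ⟨160, -100⟩⟩⟩

/-- The atoms of the rhombus cover it. -/
def coverRhombus : Cert :=
  .cut 0 0 2 0x341 (.hit 0 0) 0x23145 (.cut 0 1 4 0x23451 (.cut 0 1 5 0x234561 (.hit 0 1) 0x216
  (.hit 0 2)) 0x2156 (.cut 0 3 3 0x3451 (.hit 0 3) 0x2315 (.hit 0 4)))

/-- The atoms of the map induced on `R₃` cover it. -/
def coverR₃ : Cert :=
  .cut 0 0 0 0x134 (.cut 0 0 2 0x231 (.hit 0 0) 0x2134 (.cut 0 1 1 0x2145 (.cut 0 1 4 0x23451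
  (.hit 0 1) 0x215 (.cut 0 4 1 0x214 (.hit 0 4) 0x2341 (.hit 0 7))) 0x2341 (.cut 0 3 2 0x2315
  (.hit 0 3) 0x3451 (.cut 0 5 3 0x2341 (.hit 0 5) 0x2145 (.hit 0 6))))) 0x2314 (.cut 0 1 1 0x2145
  (.cut 0 1 4 0x2341 (.hit 0 1) 0x2145 (.cut 0 8 1 0x2145 (.hit 0 8) 0x2341 (.hit 0 9))) 0x2341
  (.cut 0 2 3 0x2341 (.hit 0 2) 0x2145 (.hit 0 3)))

/-- The atoms of the map induced on `R₃₁` cover it. -/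
def coverR₃₁ : Cert :=
  .cut 0 0 1 0x2134 (.hit 0 0) 0x231 (.cut 0 1 2 0x231 (.hit 0 1) 0x2134 (.cut 0 2 1 0x2145 (.cut
  0 2 3 0x2341 (.cut 0 2 4 0x23451 (.hit 0 2) 0x215 (.cut 0 5 1 0x214 (.hit 0 5) 0x2341 (.hit 0
  6))) 0x2145 (.cut 0 4 3 0x3451 (.hit 0 4) 0x2315 (.cut 0 7 2 0x2315 (.hit 0 7) 0x3451 (.hit 0
  8)))) 0x2341 (.hit 0 3)))

/-- The atoms of `𝒜` cover it. -/
def coverA : Cert :=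
  .cut 0 0 1 0x214 (.cut 0 0 2 0x231 (.hit 0 0) 0x2134 (.hit 0 2)) 0x2341 (.cut 0 1 1 0x2145 (.cut
  0 1 2 0x2315 (.hit 0 1) 0x1345 (.hit 0 3)) 0x2341 (.cut 0 4 1 0x21345 (.cut 0 4 3 0x23416 (.hit
  0 4) 0x1456 (.hit 0 6)) 0x231 (.cut 0 5 1 0x2134 (.hit 0 5) 0x231 (.hit 0 7))))

/-- The atoms of `𝒞` cover it. -/
def coverC : Cert :=
  .cut 0 0 2 0x231 (.hit 0 0) 0x2134 (.cut 0 1 4 0x23451 (.hit 0 1) 0x215 (.hit 0 2))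

/-- The images of the atoms of `𝒜` cover it. -/
def ontoA : Cert :=
  .cut 0 0 1 0x231 (.cut 0 0 2 0x134 (.hit 0 0) 0x2314 (.cut 0 2 3 0x1345 (.hit 0 2) 0x2315 (.cut
  0 4 3 0x21345 (.hit 0 4) 0x231 (.cut 0 6 2 0x2134 (.hit 0 6) 0x231 (.hit 0 7))))) 0x2134 (.cut 0
  1 2 0x1345 (.hit 0 1) 0x2315 (.cut 0 3 2 0x1345 (.hit 0 3) 0x2315 (.hit 0 5)))

/-- The images of the atoms of `𝒞` cover it. -/
def ontoC : Cert :=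
  .cut 0 0 1 0x231 (.hit 0 0) 0x2134 (.cut 0 1 0 0x23415 (.hit 0 1) 0x145 (.hit 0 2))

/-- The tile `C₂` is covered by `A₅`, `A₆` and `A₇`. -/
def mergeC₂ : Cert :=
  .cut 0 0 1 0x21456 (.cut 0 0 3 0x23416 (.hit 0 0) 0x1456 (.hit 0 2)) 0x2341 (.hit 0 1)

/-- The tile `C₃` is covered by `A₁`, `A₂`, `A₃` and `A₄`. -/
def mergeC₃ : Cert :=
  .cut 0 0 1 0x214 (.cut 0 0 2 0x231 (.hit 0 0) 0x2134 (.hit 0 2)) 0x2341 (.cut 0 1 2 0x2315 (.hit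
  0 1) 0x1345 (.hit 0 3))

end

section

/-- The data of the rhombus map, in coordinates with respect to the vertices of the triangle of
parameters; the following definitions do the same for the induced maps and the periodic tiles. -/
def vR : CSys := rhombusSys.atVerts triangleVerts
def vR₃ : CSys := sysR₃.atVerts triangleVerts
def vR₃₁ : CSys := sysR₃₁.atVerts triangleVerts
def vA : CSys := sysA.atVerts triangleVerts
def vC : CSys := sysC.atVerts triangleVerts

def vPeriodic (j : Fin 13) : CTile := periodicTiles[j].atVerts triangleVerts

/-- The orbits of the periodic tiles. -/
def periodicOrbits : List (List CTile) :=
  (List.finRange 13).map fun j => vR.orbit itineraries[j] (vPeriodic j)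

/-- The return orbits of the atoms of the map induced on `R₃`. -/
def returnOrbits : List (List CTile) :=
  (pathsR₃.zip vR₃.parts).map fun q => vR.orbit q.1 q.2.1

/-- The points of `R₃₁` reach `A` or a periodic tile. -/
def reachR₃₁ : Cert :=
  .cut 0 0 2 0x231 (.hit 0 0) 0x2134 (.move 0 (.cut 0 0 2 0x521 (.hit 0 0) 0x51234 (.hit 5 7)))

/-- The points of `R₃` reach `R₃₁` or the orbit of a periodic tile. -/
def reachR₃ : Cert :=
  .cut 0 0 0 0x134 (.cut 0 0 2 0x231 (.hit 0 0) 0x2134 (.cut 3 8 0 0x23415 (.cut 3 8 2 0x34561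
  (.cut 3 8 3 0x13456 (.move 1 (.cut 3 8 2 0x45621 (.hit 3 8) 0x3412 (.cut 6 8 2 0x3451 (.hit 6 8)
  0x2315 (.cut 14 1 4 0x23451 (.move 1 (.move 1 (.hit 0 0))) 0x215 (.cut 14 4 1 0x214 (.move 4
  (.move 1 (.hit 0 0))) 0x2341 (.move 7 (.hit 0 0))))))) 0x2316 (.cut 6 32 3 0x2145 (.hit 6 32)
  0x2341 (.cut 12 32 3 0x2145 (.hit 12 32) 0x2341 (.cut 14 3 2 0x2145 (.move 3 (.move 1 (.hit 0
  0))) 0x2341 (.cut 14 5 3 0x2341 (.move 5 (.move 1 (.move 1 (.hit 0 0)))) 0x2145 (.move 6 (.move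
  3 (.hit 0 0)))))))) 0x2316 (.cut 6 8 2 0x3451 (.cut 6 8 3 0x1345 (.hit 6 8) 0x2315 (.hit 12 8))
  0x2315 (.cut 14 1 1 0x2145 (.cut 14 1 4 0x23451 (.move 1 (.move 1 (.hit 0 0))) 0x215 (.cut 14 4
  1 0x214 (.move 4 (.move 1 (.hit 0 0))) 0x2341 (.move 7 (.hit 0 0)))) 0x2341 (.move 3 (.hit 0
  0))))) 0x145 (.move 1 (.cut 0 0 2 0x341 (.hit 0 0) 0x3142 (.move 3 (.cut 0 0 2 0x2315 (.hit 0 0)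
  0x1345 (.cut 6 56 1 0x1345 (.hit 6 56) 0x2315 (.hit 12 32)))))))) 0x2314 (.cut 7 14 2 0x2341
  (.hit 7 14) 0x2145 (.cut 8 61 1 0x2145 (.hit 8 61) 0x2341 (.cut 9 61 2 0x2145 (.hit 9 61) 0x2341
  (.cut 14 1 1 0x2145 (.move 1 (.move 1 (.hit 0 0))) 0x2341 (.move 3 (.hit 0 0))))))

/-- The rhombus is covered by `R₃`, the return orbits to `R₃`, and the orbits of those periodic
tiles which never visit `R₃`. -/
def reachRhombus : Cert :=
  .cut 0 0 1 0x215 (.cut 0 0 2 0x231 (.hit 0 0) 0x2134 (.cut 17 12 0 0x2315 (.cut 17 12 2 0x3451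
  (.hit 17 12) 0x2315 (.cut 19 12 1 0x1345 (.cut 19 12 3 0x2315 (.hit 19 12) 0x3451 (.hit 20 12))
  0x2315 (.hit 23 39))) 0x1345 (.hit 21 38))) 0x23451 (.cut 1 0 0 0x13456 (.cut 1 0 2 0x231456
  (.cut 1 0 3 0x234167 (.cut 1 0 4 0x23451 (.hit 1 0) 0x21567 (.cut 2 1 0 0x234516 (.cut 2 1 1
  0x234561 (.cut 2 1 3 0x2134567 (.cut 2 1 4 0x23145678 (.cut 2 1 5 0x23416789 (.cut 2 1 6
  0x234516789 (.cut 2 1 7 0x234561789a (.cut 2 1 9 0x23456781ab (.hit 2 1) 0x189a (.hit 16 14))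
  0x167 (.cut 14 5 0 0x134 (.hit 14 5) 0x2314 (.hit 16 5))) 0x561 (.cut 11 5 0 0x1234 (.cut 11 5 2
  0x2315 (.cut 11 5 3 0x23415 (.cut 11 5 4 0x23451 (.hit 11 5) 0x2156 (.hit 22 48)) 0x145 (.cut 18
  9 0 0x134 (.cut 18 9 2 0x231 (.hit 18 9) 0x2134 (.hit 19 21)) 0x2314 (.cut 22 9 3 0x2341 (.hit
  22 9) 0x2145 (.hit 23 48)))) 0x1345 (.cut 15 9 0 0x21345 (.cut 15 9 3 0x23451 (.cut 15 9 4
  0x13456 (.hit 15 9) 0x2316 (.cut 21 9 0 0x2145 (.hit 21 9) 0x2341 (.hit 23 9))) 0x2156 (.cut 17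
  21 0 0x2315 (.cut 17 21 2 0x1345 (.hit 17 21) 0x2315 (.hit 20 21)) 0x1345 (.hit 21 47))) 0x231
  (.cut 18 35 0 0x134 (.hit 18 35) 0x2314 (.hit 22 35)))) 0x214 (.cut 18 22 0 0x214 (.cut 18 22 1
  0x231 (.hit 18 22) 0x2134 (.hit 21 22)) 0x1234 (.cut 22 22 1 0x2341 (.hit 22 22) 0x2145 (.hit 23
  22))))) 0x4561 (.cut 16 11 3 0x2315 (.hit 16 11) 0x3451 (.cut 17 9 0 0x1234 (.cut 17 9 2 0x2315
  (.hit 17 9) 0x3451 (.cut 19 9 3 0x2341 (.hit 19 9) 0x2145 (.hit 20 9))) 0x2145 (.cut 19 34 1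
  0x2145 (.cut 19 34 3 0x2341 (.hit 19 34) 0x2145 (.hit 20 34)) 0x1234 (.cut 21 35 0 0x1345 (.hit
  21 35) 0x2315 (.cut 22 61 1 0x1345 (.cut 22 61 3 0x2315 (.hit 22 61) 0x1345 (.hit 23 35)) 0x2315
  (.hit 23 61))))))) 0x341 (.cut 11 11 0 0x2341 (.cut 11 11 2 0x2145 (.cut 11 11 3 0x23145 (.cut
  11 11 4 0x23416 (.hit 11 11) 0x1456 (.hit 22 54)) 0x134 (.cut 18 15 0 0x134 (.cut 18 15 2 0x231
  (.hit 18 15) 0x2134 (.hit 19 27)) 0x2314 (.cut 22 15 3 0x2341 (.hit 22 15) 0x2145 (.hit 23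
  54)))) 0x2341 (.cut 20 27 2 0x1345 (.hit 20 27) 0x2315 (.cut 21 15 0 0x1345 (.hit 21 15) 0x2315
  (.cut 22 41 3 0x2315 (.hit 22 41) 0x1345 (.hit 23 15))))) 0x214 (.cut 18 28 0 0x214 (.cut 18 28
  1 0x231 (.hit 18 28) 0x2134 (.hit 21 28)) 0x2341 (.cut 22 28 1 0x2315 (.hit 22 28) 0x1345 (.hit
  23 28))))) 0x231 (.cut 14 2 0 0x231 (.cut 14 2 2 0x214 (.hit 14 2) 0x2341 (.cut 15 2 1 0x2341
  (.cut 15 2 3 0x2145 (.cut 15 2 4 0x23145 (.hit 15 2) 0x341 (.cut 18 2 1 0x231 (.hit 18 2) 0x2134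
  (.hit 21 2))) 0x2341 (.cut 17 14 0 0x1345 (.cut 17 14 2 0x2315 (.hit 17 14) 0x3451 (.cut 19 14 3
  0x2341 (.hit 19 14) 0x2145 (.hit 20 14))) 0x2315 (.hit 21 40))) 0x2145 (.cut 17 2 2 0x3451 (.hit
  17 2) 0x2315 (.cut 19 2 3 0x2315 (.hit 19 2) 0x3451 (.hit 20 2))))) 0x2134 (.cut 15 2 1 0x3451
  (.cut 15 2 3 0x2145 (.cut 15 2 4 0x2145 (.hit 15 2) 0x2341 (.cut 22 2 1 0x2341 (.hit 22 2)
  0x2145 (.hit 23 2))) 0x2341 (.hit 23 41)) 0x2315 (.cut 16 2 3 0x2315 (.hit 16 2) 0x3451 (.hit 17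
  2))))) 0x2167 (.hit 16 8)) 0x156 (.cut 11 8 0 0x2134 (.cut 11 8 1 0x2315 (.cut 11 8 2 0x2341
  (.cut 11 8 3 0x12345 (.cut 11 8 4 0x21456 (.hit 11 8) 0x2341 (.hit 22 51)) 0x215 (.cut 18 12 0
  0x214 (.cut 18 12 2 0x134 (.hit 18 12) 0x2314 (.hit 19 24)) 0x1234 (.cut 22 12 3 0x2145 (.hit 22
  12) 0x2341 (.hit 23 51)))) 0x2145 (.cut 20 24 2 0x2315 (.hit 20 24) 0x1345 (.cut 21 12 0 0x2315
  (.hit 21 12) 0x1345 (.cut 22 38 3 0x1345 (.hit 22 38) 0x2315 (.hit 23 12))))) 0x1345 (.cut 22 64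
  3 0x2341 (.hit 22 64) 0x2145 (.hit 23 38))) 0x123 (.cut 18 25 0 0x134 (.cut 18 25 1 0x214 (.cut
  18 25 2 0x231 (.hit 18 25) 0x2134 (.hit 19 37)) 0x2341 (.cut 20 37 2 0x1345 (.hit 20 37) 0x2315
  (.hit 21 25))) 0x2314 (.cut 22 25 1 0x2145 (.cut 22 25 3 0x2341 (.hit 22 25) 0x2145 (.hit 23
  64)) 0x2341 (.hit 23 25)))))) 0x1456 (.cut 2 2 0 0x23415 (.cut 2 2 1 0x23451 (.cut 2 2 2
  0x234561 (.cut 2 2 3 0x2345671 (.cut 2 2 4 0x12345678 (.cut 2 2 5 0x21456789 (.cut 2 2 6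
  0x231456789 (.cut 2 2 7 0x234156789a (.hit 2 2) 0x451 (.cut 14 6 0 0x231 (.hit 14 6) 0x2134
  (.hit 16 6))) 0x341 (.cut 11 6 0 0x2341 (.cut 11 6 2 0x2145 (.cut 11 6 3 0x23145 (.cut 11 6 4
  0x23416 (.hit 11 6) 0x1456 (.hit 22 49)) 0x134 (.cut 18 10 0 0x134 (.cut 18 10 2 0x231 (.hit 18
  10) 0x2134 (.hit 19 22)) 0x2314 (.cut 22 10 3 0x2341 (.hit 22 10) 0x2145 (.hit 23 49)))) 0x2341
  (.cut 15 10 0 0x12345 (.cut 15 10 3 0x23416 (.cut 15 10 4 0x23451 (.hit 15 10) 0x2156 (.cut 21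
  10 0 0x1345 (.hit 21 10) 0x2315 (.hit 23 10))) 0x1456 (.cut 17 22 0 0x2145 (.cut 17 22 2 0x2341
  (.hit 17 22) 0x2145 (.hit 20 22)) 0x1234 (.hit 21 48))) 0x215 (.cut 18 36 0 0x231 (.hit 18 36)
  0x2134 (.hit 22 36)))) 0x214 (.cut 18 23 0 0x214 (.cut 18 23 1 0x231 (.hit 18 23) 0x2134 (.hit
  21 23)) 0x2341 (.cut 22 23 1 0x2315 (.hit 22 23) 0x1345 (.hit 23 23))))) 0x2341 (.cut 16 12 3
  0x2315 (.hit 16 12) 0x3451 (.cut 17 10 0 0x1234 (.cut 17 10 2 0x2315 (.hit 17 10) 0x3451 (.cut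
  19 10 3 0x2341 (.hit 19 10) 0x2145 (.hit 20 10))) 0x2145 (.cut 19 35 1 0x2145 (.cut 19 35 3
  0x2341 (.hit 19 35) 0x2145 (.hit 20 35)) 0x2341 (.cut 21 36 0 0x2341 (.hit 21 36) 0x2145 (.cut
  22 62 1 0x2341 (.cut 22 62 3 0x2145 (.hit 22 62) 0x2341 (.hit 23 36)) 0x2145 (.hit 23 62)))))))
  0x218 (.cut 11 12 0 0x2314 (.cut 11 12 2 0x1345 (.cut 11 12 3 0x21345 (.cut 11 12 4 0x23156
  (.hit 11 12) 0x1345 (.hit 22 55)) 0x231 (.cut 18 16 0 0x231 (.cut 18 16 2 0x214 (.hit 18 16)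
  0x1234 (.hit 19 28)) 0x2134 (.cut 22 16 3 0x2315 (.hit 22 16) 0x1345 (.hit 23 55)))) 0x2315
  (.cut 20 28 2 0x1234 (.hit 20 28) 0x2145 (.cut 21 16 0 0x2341 (.hit 21 16) 0x2145 (.cut 22 42 3
  0x2145 (.hit 22 42) 0x2341 (.hit 23 16))))) 0x134 (.cut 18 29 0 0x134 (.cut 18 29 1 0x214 (.hit
  18 29) 0x1234 (.hit 21 29)) 0x2314 (.cut 22 29 1 0x2145 (.hit 22 29) 0x1234 (.hit 23 29)))))
  0x217 (.cut 14 3 0 0x214 (.cut 14 3 2 0x134 (.hit 14 3) 0x2314 (.cut 15 3 1 0x2315 (.cut 15 3 3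
  0x1345 (.cut 15 3 4 0x21345 (.hit 15 3) 0x231 (.cut 18 3 1 0x231 (.hit 18 3) 0x2134 (.hit 21
  3))) 0x2315 (.cut 17 15 0 0x1234 (.cut 17 15 2 0x2315 (.hit 17 15) 0x3451 (.cut 19 15 3 0x2341
  (.hit 19 15) 0x2145 (.hit 20 15))) 0x2145 (.hit 21 41))) 0x1345 (.cut 17 3 2 0x2341 (.hit 17 3)
  0x2145 (.cut 19 3 3 0x2145 (.hit 19 3) 0x2341 (.hit 20 3))))) 0x2341 (.cut 15 3 1 0x2315 (.cut
  15 3 3 0x1345 (.cut 15 3 4 0x1345 (.hit 15 3) 0x2315 (.cut 22 3 1 0x2315 (.hit 22 3) 0x1345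
  (.hit 23 3))) 0x2315 (.hit 23 42)) 0x1345 (.cut 16 3 3 0x1345 (.hit 16 3) 0x2315 (.hit 17 3)))))
  0x216 (.cut 4 1 0 0x2341 (.cut 4 1 1 0x1345 (.cut 4 1 2 0x2145 (.cut 4 1 3 0x23145 (.hit 4 1)
  0x134 (.cut 10 3 0 0x2314 (.hit 10 3) 0x134 (.cut 11 3 0 0x2314 (.cut 11 3 2 0x3451 (.cut 11 3 3
  0x12345 (.hit 11 3) 0x215 (.cut 18 7 0 0x214 (.hit 18 7) 0x1234 (.hit 22 7))) 0x2315 (.cut 15 7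
  0 0x23415 (.cut 15 7 4 0x23156 (.hit 15 7) 0x3451 (.cut 21 7 0 0x2315 (.hit 21 7) 0x1345 (.hit
  23 7))) 0x145 (.cut 18 33 0 0x214 (.hit 18 33) 0x2341 (.hit 22 33)))) 0x134 (.cut 18 20 0 0x134
  (.hit 18 20) 0x2314 (.hit 22 20))))) 0x2341 (.cut 10 9 1 0x2315 (.hit 10 9) 0x1345 (.cut 13 9 1
  0x2315 (.hit 13 9) 0x1345 (.cut 17 19 0 0x1345 (.cut 17 19 2 0x2315 (.hit 17 19) 0x3451 (.cut 19
  19 1 0x2145 (.cut 19 19 3 0x2341 (.hit 19 19) 0x2145 (.hit 20 19)) 0x1234 (.cut 21 20 0 0x1345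
  (.hit 21 20) 0x2315 (.cut 22 46 1 0x1345 (.cut 22 46 3 0x2315 (.hit 22 46) 0x1345 (.hit 23 20))
  0x2315 (.hit 23 46))))) 0x2315 (.hit 21 45))))) 0x2315 (.cut 10 5 1 0x2145 (.hit 10 5) 0x2341
  (.hit 13 5))) 0x214 (.cut 10 1 0 0x2341 (.cut 10 1 1 0x1345 (.hit 10 1) 0x2315 (.hit 13 1))
  0x214 (.cut 11 1 0 0x2341 (.cut 11 1 1 0x1345 (.cut 11 1 2 0x2145 (.cut 11 1 3 0x23145 (.hit 11
  1) 0x134 (.cut 18 5 0 0x134 (.hit 18 5) 0x2314 (.hit 22 5))) 0x2341 (.cut 15 5 0 0x12345 (.cut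
  15 5 4 0x23451 (.hit 15 5) 0x2156 (.cut 21 5 0 0x1345 (.hit 21 5) 0x2315 (.hit 23 5))) 0x215
  (.cut 18 31 0 0x231 (.hit 18 31) 0x2134 (.hit 22 31)))) 0x2315 (.cut 17 5 0 0x1234 (.cut 17 5 2
  0x2315 (.hit 17 5) 0x3451 (.cut 19 5 3 0x2341 (.hit 19 5) 0x2145 (.hit 20 5))) 0x2145 (.cut 21
  31 0 0x2341 (.hit 21 31) 0x2145 (.cut 22 57 3 0x2145 (.hit 22 57) 0x2341 (.hit 23 31))))) 0x214
  (.cut 18 18 0 0x214 (.cut 18 18 2 0x134 (.hit 18 18) 0x2314 (.hit 19 30)) 0x2341 (.cut 22 18 3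
  0x1345 (.hit 22 18) 0x2315 (.hit 23 57))))))) 0x2156 (.cut 10 7 1 0x3451 (.cut 10 7 3 0x2145
  (.hit 10 7) 0x1234 (.cut 13 3 0 0x2315 (.hit 13 3) 0x1345 (.cut 16 9 3 0x3451 (.hit 16 9) 0x2315
  (.cut 17 7 0 0x2315 (.cut 17 7 2 0x3451 (.hit 17 7) 0x2315 (.cut 19 7 3 0x2315 (.hit 19 7)
  0x3451 (.hit 20 7))) 0x1345 (.cut 19 32 1 0x1345 (.cut 19 32 3 0x2315 (.hit 19 32) 0x3451 (.hit
  20 32)) 0x2315 (.cut 21 33 0 0x2315 (.hit 21 33) 0x3451 (.cut 22 59 1 0x2145 (.cut 22 59 3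
  0x2341 (.hit 22 59) 0x2145 (.hit 23 33)) 0x1234 (.hit 23 59)))))))) 0x2315 (.cut 13 7 1 0x3451
  (.hit 13 7) 0x2315 (.cut 17 17 0 0x2315 (.cut 17 17 2 0x3451 (.hit 17 17) 0x2315 (.cut 19 17 1
  0x1345 (.cut 19 17 3 0x2315 (.hit 19 17) 0x3451 (.hit 20 17)) 0x2315 (.cut 20 30 2 0x2315 (.hit
  20 30) 0x1345 (.cut 21 18 0 0x2315 (.hit 21 18) 0x3451 (.cut 22 44 1 0x2145 (.cut 22 44 3 0x2341
  (.hit 22 44) 0x2145 (.hit 23 18)) 0x1234 (.hit 23 44)))))) 0x1345 (.hit 21 43))))) 0x145 (.cut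
  11 9 0 0x2134 (.cut 11 9 2 0x2341 (.cut 11 9 3 0x23451 (.cut 11 9 4 0x13456 (.hit 11 9) 0x2316
  (.hit 22 52)) 0x215 (.cut 18 13 0 0x214 (.cut 18 13 2 0x134 (.hit 18 13) 0x2314 (.hit 19 25))
  0x2341 (.cut 22 13 3 0x1345 (.hit 22 13) 0x2315 (.hit 23 52)))) 0x2145 (.cut 20 25 2 0x2315
  (.hit 20 25) 0x1345 (.cut 21 13 0 0x2315 (.hit 21 13) 0x3451 (.cut 22 39 3 0x2341 (.hit 22 39)
  0x2145 (.hit 23 13))))) 0x231 (.cut 18 26 0 0x231 (.cut 18 26 1 0x134 (.hit 18 26) 0x2314 (.hit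
  21 26)) 0x2134 (.cut 22 26 1 0x1345 (.hit 22 26) 0x2315 (.hit 23 26)))))) 0x341 (.cut 2 0 0
  0x1234 (.cut 2 0 1 0x21345 (.cut 2 0 3 0x234156 (.cut 2 0 4 0x2345167 (.cut 2 0 6 0x23456718
  (.cut 2 0 7 0x234567819 (.cut 2 0 8 0x234567891a (.cut 2 0 9 0x23456789a1 (.hit 2 0) 0x21ab
  (.hit 16 13)) 0x19a (.cut 11 0 0 0x1234 (.cut 11 0 1 0x2145 (.cut 11 0 2 0x23145 (.cut 11 0 4
  0x23451 (.hit 11 0) 0x2156 (.hit 22 43)) 0x134 (.cut 18 30 0 0x134 (.hit 18 30) 0x2314 (.hit 22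
  30))) 0x2341 (.cut 21 30 0 0x1345 (.hit 21 30) 0x2315 (.cut 22 56 3 0x2315 (.hit 22 56) 0x1345
  (.hit 23 30)))) 0x214 (.cut 18 17 0 0x214 (.cut 18 17 1 0x231 (.cut 18 17 2 0x134 (.hit 18 17)
  0x2314 (.hit 19 29)) 0x2134 (.cut 20 29 2 0x2315 (.hit 20 29) 0x1345 (.hit 21 17))) 0x1234 (.cut
  22 17 1 0x2341 (.cut 22 17 3 0x2145 (.hit 22 17) 0x2341 (.hit 23 56)) 0x2145 (.hit 23 17)))))
  0x189 (.cut 14 4 0 0x134 (.cut 14 4 2 0x231 (.hit 14 4) 0x2134 (.cut 15 4 1 0x2145 (.cut 15 4 3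
  0x2341 (.cut 15 4 4 0x12345 (.hit 15 4) 0x215 (.cut 18 4 1 0x214 (.hit 18 4) 0x1234 (.hit 21
  4))) 0x2145 (.cut 17 16 0 0x2315 (.cut 17 16 2 0x1345 (.hit 17 16) 0x2315 (.cut 19 16 3 0x2315
  (.hit 19 16) 0x1345 (.hit 20 16))) 0x1345 (.hit 21 42))) 0x2341 (.cut 17 4 2 0x2315 (.hit 17 4)
  0x3451 (.cut 19 4 3 0x2341 (.hit 19 4) 0x2145 (.hit 20 4))))) 0x2314 (.cut 15 4 1 0x2145 (.cut
  15 4 3 0x2341 (.cut 15 4 4 0x1234 (.hit 15 4) 0x2145 (.cut 22 4 1 0x2145 (.hit 22 4) 0x1234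
  (.hit 23 4))) 0x2145 (.hit 23 43)) 0x2341 (.cut 16 4 3 0x2341 (.hit 16 4) 0x2145 (.hit 17 4)))))
  0x178 (.cut 4 0 0 0x134 (.cut 4 0 1 0x2134 (.cut 4 0 3 0x23415 (.cut 4 0 4 0x23451 (.hit 4 0)
  0x2156 (.hit 10 6)) 0x145 (.cut 10 2 0 0x2314 (.cut 10 2 1 0x2341 (.hit 10 2) 0x2145 (.hit 13
  2)) 0x134 (.cut 11 2 0 0x2314 (.cut 11 2 1 0x2341 (.cut 11 2 2 0x1345 (.cut 11 2 3 0x21345 (.hit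
  11 2) 0x231 (.cut 18 6 0 0x231 (.hit 18 6) 0x2134 (.hit 22 6))) 0x2315 (.cut 15 6 0 0x23415
  (.cut 15 6 4 0x23156 (.hit 15 6) 0x1345 (.cut 21 6 0 0x2341 (.hit 21 6) 0x2145 (.hit 23 6)))
  0x145 (.cut 18 32 0 0x214 (.hit 18 32) 0x1234 (.hit 22 32)))) 0x2145 (.cut 17 6 0 0x2315 (.cut
  17 6 2 0x1345 (.hit 17 6) 0x2315 (.cut 19 6 3 0x2315 (.hit 19 6) 0x1345 (.hit 20 6))) 0x1345
  (.cut 21 32 0 0x2315 (.hit 21 32) 0x1345 (.cut 22 58 3 0x1345 (.hit 22 58) 0x2315 (.hit 23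
  32))))) 0x134 (.cut 18 19 0 0x134 (.cut 18 19 2 0x231 (.hit 18 19) 0x2134 (.hit 19 31)) 0x2314
  (.cut 22 19 3 0x2341 (.hit 22 19) 0x2145 (.hit 23 58)))))) 0x231 (.cut 10 4 0 0x2134 (.hit 10 4)
  0x231 (.cut 11 4 0 0x2134 (.cut 11 4 2 0x2341 (.cut 11 4 3 0x23451 (.hit 11 4) 0x215 (.cut 18 8
  0 0x214 (.hit 18 8) 0x2341 (.hit 22 8))) 0x2145 (.cut 15 8 0 0x23145 (.cut 15 8 4 0x21456 (.hit
  15 8) 0x2341 (.cut 21 8 0 0x2315 (.hit 21 8) 0x3451 (.hit 23 8))) 0x341 (.cut 18 34 0 0x134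
  (.hit 18 34) 0x2314 (.hit 22 34)))) 0x231 (.cut 18 21 0 0x231 (.hit 18 21) 0x2134 (.hit 22
  21))))) 0x2314 (.cut 10 0 1 0x2145 (.cut 10 0 3 0x2341 (.hit 10 0) 0x2145 (.hit 13 6)) 0x2341
  (.cut 13 0 1 0x2145 (.hit 13 0) 0x2341 (.cut 17 20 0 0x1234 (.cut 17 20 2 0x2315 (.hit 17 20)
  0x3451 (.cut 19 20 1 0x2145 (.cut 19 20 3 0x2341 (.hit 19 20) 0x2145 (.hit 20 20)) 0x2341 (.cut
  21 21 0 0x2341 (.hit 21 21) 0x2145 (.cut 22 47 1 0x2341 (.cut 22 47 3 0x2145 (.hit 22 47) 0x2341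
  (.hit 23 21)) 0x2145 (.hit 23 47))))) 0x2145 (.hit 21 46)))))) 0x561 (.cut 11 10 0 0x1234 (.cut
  11 10 3 0x23415 (.cut 11 10 4 0x23451 (.hit 11 10) 0x2156 (.hit 22 53)) 0x145 (.cut 18 14 0
  0x134 (.cut 18 14 2 0x231 (.hit 18 14) 0x2134 (.hit 19 26)) 0x2314 (.cut 22 14 3 0x2341 (.hit 22
  14) 0x2145 (.hit 23 53)))) 0x214 (.cut 18 27 0 0x214 (.cut 18 27 1 0x231 (.hit 18 27) 0x2134
  (.hit 21 27)) 0x1234 (.cut 22 27 1 0x2341 (.hit 22 27) 0x2145 (.hit 23 27))))) 0x451 (.cut 14 1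
  0 0x231 (.cut 14 1 2 0x214 (.hit 14 1) 0x2341 (.cut 15 1 1 0x2341 (.cut 15 1 4 0x23145 (.hit 15
  1) 0x134 (.cut 18 1 1 0x134 (.hit 18 1) 0x2314 (.hit 21 1))) 0x2145 (.cut 17 1 2 0x1345 (.hit 17
  1) 0x2315 (.cut 19 1 3 0x2315 (.hit 19 1) 0x1345 (.hit 20 1))))) 0x2134 (.cut 15 1 1 0x3451
  (.cut 15 1 4 0x2145 (.hit 15 1) 0x1234 (.cut 22 1 1 0x1345 (.hit 22 1) 0x2315 (.hit 23 1)))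
  0x2315 (.cut 16 1 3 0x2315 (.hit 16 1) 0x3451 (.hit 17 1))))) 0x231 (.cut 14 7 0 0x231 (.hit 14
  7) 0x2134 (.hit 16 7))) 0x214 (.cut 11 7 0 0x2314 (.cut 11 7 1 0x2341 (.cut 11 7 2 0x1345 (.cut
  11 7 3 0x21345 (.cut 11 7 4 0x23156 (.hit 11 7) 0x1345 (.hit 22 50)) 0x231 (.cut 18 11 0 0x231
  (.cut 18 11 2 0x214 (.hit 18 11) 0x1234 (.hit 19 23)) 0x2134 (.cut 22 11 3 0x2315 (.hit 22 11)
  0x1345 (.hit 23 50)))) 0x2315 (.cut 15 11 0 0x23415 (.cut 15 11 3 0x21456 (.cut 15 11 4 0x23156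
  (.hit 15 11) 0x1345 (.cut 21 11 0 0x2341 (.hit 21 11) 0x2145 (.hit 23 11))) 0x1234 (.cut 17 23 0
  0x2145 (.cut 17 23 2 0x2341 (.hit 17 23) 0x2145 (.hit 20 23)) 0x2341 (.hit 21 49))) 0x145 (.cut
  18 37 0 0x214 (.hit 18 37) 0x1234 (.hit 22 37)))) 0x2145 (.cut 17 11 0 0x2315 (.cut 17 11 2
  0x1345 (.hit 17 11) 0x2315 (.cut 19 11 3 0x2315 (.hit 19 11) 0x1345 (.hit 20 11))) 0x1345 (.cut
  21 37 0 0x2315 (.hit 21 37) 0x1345 (.cut 22 63 3 0x1345 (.hit 22 63) 0x2315 (.hit 23 37)))))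
  0x134 (.cut 18 24 0 0x134 (.cut 18 24 1 0x214 (.cut 18 24 2 0x231 (.hit 18 24) 0x2134 (.hit 19
  36)) 0x1234 (.cut 20 36 2 0x2145 (.hit 20 36) 0x2341 (.hit 21 24))) 0x2314 (.cut 22 24 1 0x2145
  (.cut 22 24 3 0x2341 (.hit 22 24) 0x2145 (.hit 23 63)) 0x1234 (.hit 23 24)))))) 0x2316 (.cut 10
  8 1 0x2341 (.cut 10 8 3 0x2145 (.hit 10 8) 0x2341 (.cut 13 4 0 0x2145 (.hit 13 4) 0x2341 (.cut
  16 10 1 0x2145 (.cut 16 10 3 0x2341 (.hit 16 10) 0x2145 (.cut 17 8 0 0x2145 (.cut 17 8 2 0x2341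
  (.hit 17 8) 0x2145 (.cut 19 8 3 0x2145 (.hit 19 8) 0x2341 (.hit 20 8))) 0x2341 (.cut 19 33 1
  0x2341 (.cut 19 33 3 0x2145 (.hit 19 33) 0x2341 (.hit 20 33)) 0x2145 (.cut 21 34 0 0x2145 (.hit
  21 34) 0x2341 (.cut 22 60 1 0x2145 (.cut 22 60 3 0x2341 (.hit 22 60) 0x2145 (.hit 23 34)) 0x2341
  (.hit 23 60)))))) 0x2341 (.cut 17 13 0 0x2145 (.cut 17 13 2 0x2341 (.hit 17 13) 0x2145 (.cut 19
  13 1 0x2341 (.cut 19 13 3 0x2145 (.hit 19 13) 0x2341 (.hit 20 13)) 0x2145 (.cut 20 26 2 0x2145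
  (.hit 20 26) 0x2341 (.cut 21 14 0 0x2145 (.hit 21 14) 0x2341 (.cut 22 40 1 0x2145 (.cut 22 40 3
  0x2341 (.hit 22 40) 0x2145 (.hit 23 14)) 0x2341 (.hit 23 40)))))) 0x2341 (.hit 21 39))))) 0x2145
  (.cut 13 8 1 0x2341 (.hit 13 8) 0x2145 (.cut 17 18 0 0x2145 (.cut 17 18 2 0x2341 (.hit 17 18)
  0x2145 (.cut 19 18 1 0x2341 (.cut 19 18 3 0x2145 (.hit 19 18) 0x2341 (.hit 20 18)) 0x2145 (.cut
  20 31 2 0x2145 (.hit 20 31) 0x2341 (.cut 21 19 0 0x2145 (.hit 21 19) 0x2341 (.cut 22 45 1 0x2145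
  (.cut 22 45 3 0x2341 (.hit 22 45) 0x2145 (.hit 23 19)) 0x2341 (.hit 23 45)))))) 0x2341 (.hit 21
  44)))))

end

section

/-! ### The rhombus map and `𝒜` in terms of parametric data -/

theorem β_sq : β ^ 2 = 2 - ω := by
  have := ω_sq; rw [β_eq]; grind

theorem β_pow_three : β ^ 3 = 2 * ω - 3 := by
  have := ω_sq; rw [β_eq]; grind

theorem β_pow_four : β ^ 4 = 5 - 3 * ω := by
  have := ω_sq; rw [β_eq]; grind

theorem β_pow_five : β ^ 5 = 5 * ω - 8 := by
  have := ω_sq; rw [β_eq]; grind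

theorem β_pow_six : β ^ 6 = 13 - 8 * ω := by
  have := ω_sq; rw [β_eq]; grind

theorem α_mul_β_pow_four : α * (5 - 3 * ω) = 7 * ω - 11 := by
  have := ω_sq; rw [α_eq]; grind

/-- A tile in the notation of triples is described by parametric conditions if its triples are
those of the conditions, up to the order. -/
theorem carrier_eq_set {p : ℝ × ℝ × ℝ} {T : Tile} {U : CTile}
    (h : ∀ c, c ∈ T ↔ c ∈ U.toTile p) : T.carrier = U.set p := by
  rw [← CTile.carrier_toTile]
  ext x
  simp only [Tile.carrier, h]

theorem mem_rhombusAtom (s t : ℝ) (k : Fin 5) (c : Fin 5 × ℤ × ℝ) :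
    c ∈ rhombusAtom s t k ↔ c ∈ (rhombusSys.atom k).toTile (1, s, t) := by
  fin_cases k <;> simp [rhombusAtom, tile, rhombusSys, CSys.atom, cond, CTile.toTile,
    Cond.toTriple, Form.eval, Zw.val, ← sub_eq_add_neg] <;> grind

theorem models_rhombus (s t : ℝ) : rhombusSys.Models (1, s, t) (rhombus s t) := by
  refine ⟨rfl, carrier_eq_set fun c => ?_, fun k => carrier_eq_set (mem_rhombusAtom s t k),
    fun k x => ?_⟩
  · simp [tile, rhombusSys, cond, CTile.toTile, Cond.toTriple, Form.eval, Zw.val,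
      ← sub_eq_add_neg]
    grind
  · fin_cases k <;> simp [rhombus, rhombusSys, CSys.iso, isometry, constant, CIso.toIsom, Vec.eval,
      Form.eval, Zw.val]

theorem mem_atomA (s t : ℝ) (k : Fin 8) (c : Fin 5 × ℤ × ℝ) :
    c ∈ atomA s t k ↔ c ∈ (sysA.atom k).toTile (1, s, t) := by
  fin_cases k <;> simp [atomA, tile, sysA, CSys.atom, cond, CTile.toTile, Cond.toTriple, Form.eval,
    Zw.val, ← sub_eq_add_neg, α_mul_β_pow_four, β_pow_four, β_pow_three] <;> grind

theorem models_domA (s t : ℝ) : sysA.Models (1, s, t) (domA s t) := by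
  refine ⟨rfl, carrier_eq_set fun c => ?_, fun k => carrier_eq_set (mem_atomA s t k),
    fun k x => ?_⟩
  · simp [tile, sysA, cond, CTile.toTile, Cond.toTriple, Form.eval, Zw.val, ← sub_eq_add_neg,
      β_pow_four]
    grind
  · fin_cases k <;> simp [domA, isoA1, isoA5, isoA8, sysA, CSys.iso, isometry, constant,
      CIso.toIsom, Vec.eval, Form.eval, Zw.val, Isom.apply, β_pow_six, β_pow_three, β_pow_five] <;>
      ring_nf <;> trivial

/-! ### The triangle of parameters -/

/-- A point in the interior of a half-plane is not on its boundary line. -/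
theorem pos_of_mem_interior {u v w : ℝ} (huv : 0 < u ^ 2 + v ^ 2) {S : Set (ℝ × ℝ)}
    (hS : ∀ q ∈ S, 0 ≤ u * q.1 + v * q.2 + w) {q : ℝ × ℝ} (hq : q ∈ interior S) :
    0 < u * q.1 + v * q.2 + w := by
  have hc : Continuous fun e : ℝ => (q.1 - e * u, q.2 - e * v) := by fun_prop
  have h0 : (fun e : ℝ => (q.1 - e * u, q.2 - e * v)) 0 ∈ interior S := by simpa using hq
  obtain ⟨e, he, h⟩ := Metric.isOpen_iff.1 (isOpen_interior.preimage hc) 0 h0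
  have := hS _ (interior_subset (h (show e / 2 ∈ Metric.ball (0 : ℝ) e by
    rw [Metric.mem_ball, Real.dist_eq, sub_zero, abs_of_pos] <;> linarith)))
  nlinarith

theorem mem_paramTriangle_iff {s t : ℝ} : (s, t) ∈ paramTriangle ↔
    s < (11 - 5 * α) / 2 ∧ t < s ∧ (2 - β) * (-1 + 2 / α) < 2 * t - β * s := by
  have h5 := α_sq
  have h0 := α_pos
  have hb : β = (α - 1) / 2 := rfl
  have hinv : 2 / α = 2 * α / 5 := by field_simp; linarith
  have hub : α < 2.2361 := by nlinarith
  have hlb : 2.236 < α := by nlinarith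
  constructor
  · intro h
    have hconv : ∀ u v w : ℝ, Convex ℝ {q : ℝ × ℝ | 0 ≤ u * q.1 + v * q.2 + w} := by
      intro u v w x hx y hy a b ha hb hab
      simp only [mem_ofPred_eq, Prod.fst_add, Prod.smul_fst, Prod.snd_add, Prod.smul_snd,
        smul_eq_mul] at hx hy ⊢
      have : u * (a * x.1 + b * y.1) + v * (a * x.2 + b * y.2) + w =
          a * (u * x.1 + v * x.2 + w) + b * (u * y.1 + v * y.2 + w) := by
        linear_combination (-w) * hab
      rw [this]
      positivity
    have key : ∀ u v w : ℝ, 0 < u ^ 2 + v ^ 2 →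
        (∀ q ∈ ({(-1 + 2 / α, -1 + 2 / α), ((11 - 5 * α) / 2, (-25 + 11 * α) / 4),
          ((11 - 5 * α) / 2, (11 - 5 * α) / 2)} : Set (ℝ × ℝ)), 0 ≤ u * q.1 + v * q.2 + w) →
        0 < u * s + v * t + w := fun u v w huv hq =>
      pos_of_mem_interior huv (fun q hq' => convexHull_min hq (hconv u v w) hq') h
    refine ⟨?_, ?_, ?_⟩
    · have := key (-1) 0 ((11 - 5 * α) / 2) (by norm_num) (by
        simp only [mem_insert_iff, mem_singleton_iff, forall_eq_or_imp, forall_eq, hinv]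
        refine ⟨?_, ?_, ?_⟩ <;> linarith)
      linarith
    · have := key 1 (-1) 0 (by norm_num) (by
        simp only [mem_insert_iff, mem_singleton_iff, forall_eq_or_imp, forall_eq, hinv]
        refine ⟨?_, ?_, ?_⟩ <;> linarith)
      linarith
    · have := key (-β) 2 (-((2 - β) * (-1 + 2 / α))) (by positivity) (by
        simp only [mem_insert_iff, mem_singleton_iff, forall_eq_or_imp, forall_eq, hinv, hb]
        refine ⟨?_, ?_, ?_⟩ <;> nlinarith)
      linarith
  · intro h
    refine interior_maximal (t := {q : ℝ × ℝ | q.1 < (11 - 5 * α) / 2 ∧ q.2 < q.1 ∧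
      (2 - β) * (-1 + 2 / α) < 2 * q.2 - β * q.1}) ?_ ?_ h
    · rintro ⟨s, t⟩ ⟨h1, h2, h3⟩
      have hc := convex_convexHull ℝ ({(-1 + 2 / α, -1 + 2 / α),
        ((11 - 5 * α) / 2, (-25 + 11 * α) / 4), ((11 - 5 * α) / 2, (11 - 5 * α) / 2)} : Set (ℝ × ℝ))
      have := hc.sum_mem (t := Finset.univ) (w := ![(65 + 29 * α) / 2 * ((11 - 5 * α) / 2 - s),
        (47 + 21 * α) * (s - t), (47 + 21 * α) / 2 * (2 * t - β * s - (2 - β) * (-1 + 2 / α))])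
        (z := ![(-1 + 2 / α, -1 + 2 / α),
        ((11 - 5 * α) / 2, (-25 + 11 * α) / 4), ((11 - 5 * α) / 2, (11 - 5 * α) / 2)]) ?_ ?_ ?_
      · convert this using 1
        simp only [Fin.sum_univ_three, Matrix.cons_val, hinv, hb, Prod.smul_mk, smul_eq_mul,
          Prod.mk_add_mk, Prod.mk.injEq]
        constructor <;> grind
      · intro i _
        fin_cases i <;> simp only [Fin.zero_eta, Fin.mk_one, Fin.reduceFinMk, Matrix.cons_val]
        · exact mul_nonneg (by linarith) (by linarith)
        · exact mul_nonneg (by linarith) (by linarith)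
        · exact mul_nonneg (by linarith) (by linarith)
      · simp only [Fin.sum_univ_three, Matrix.cons_val, hinv, hb]
        grind
      · intro i _
        apply subset_convexHull
        fin_cases i <;> simp
    · have h1 : IsOpen {q : ℝ × ℝ | q.1 < (11 - 5 * α) / 2} := isOpen_lt (by fun_prop) (by fun_prop)
      have h2 : IsOpen {q : ℝ × ℝ | q.2 < q.1} := isOpen_lt (by fun_prop) (by fun_prop)
      have h3 : IsOpen {q : ℝ × ℝ | (2 - β) * (-1 + 2 / α) < 2 * q.2 - β * q.1} :=
        isOpen_lt (by fun_prop) (by fun_prop)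
      exact h1.inter (h2.inter h3)

/-- The triangle consists of the positive combinations of its vertices. -/
theorem exists_positive_of_mem {s t : ℝ} (h : (s, t) ∈ paramTriangle) :
    ∃ p, Positive p ∧ triangleVerts.point p = (1, s, t) := by
  have h5 := α_sq
  have h0 := α_pos
  have hb : β = (α - 1) / 2 := rfl
  have hw : ω = (α + 1) / 2 := rfl
  have hinv : 2 / α = 2 * α / 5 := by field_simp; linarith
  obtain ⟨h1, h2, h3⟩ := mem_paramTriangle_iff.1 h
  refine ⟨((65 + 29 * α) / 40 * ((11 - 5 * α) / 2 - s), (47 + 21 * α) / 20 * (s - t),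
    (47 + 21 * α) / 40 * (2 * t - β * s - (2 - β) * (-1 + 2 / α))), ⟨?_, ?_, ?_⟩, ?_⟩
  · exact mul_pos (by linarith) (by linarith)
  · exact mul_pos (by linarith) (by linarith)
  · exact mul_pos (by linarith) (by linarith)
  · simp only [Verts.point, triangleVerts, Zw.val, hinv, hb, hw, Prod.mk.injEq]
    push_cast
    refine ⟨?_, ?_, ?_⟩ <;> grind

end

section

/-! ### Edges and bifurcations -/

variable {p : ℝ × ℝ × ℝ}

theorem nd_toTriple {c : Cond} {x : Plane} :
    dotU (c.toTriple p).1 x = (c.toTriple p).2.2 ↔ nd c.1 x = c.2.eval p := by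
  unfold Cond.toTriple
  by_cases h : c.1 % 2 = 0
  · simp only [h, if_true, dotU_eq_nd]
    rw [nd_congr (d := 2 * (Fin.ofNat 5 (c.1 / 2) : ℕ)) (e := c.1)
      (by simp only [Fin.ofNat]; lia)]
  · simp only [h, if_false, dotU_eq_nd]
    rw [nd_congr (d := 2 * (Fin.ofNat 5 ((c.1 + 5) / 2) : ℕ)) (e := c.1 + 5)
      (by simp only [Fin.ofNat]; lia), nd_add_five, neg_inj]

theorem closed_toTriple {c : Cond} {x : Plane} :
    (if (c.toTriple p).2.1 = 1 then dotU (c.toTriple p).1 x ≤ (c.toTriple p).2.2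
      else (c.toTriple p).2.2 ≤ dotU (c.toTriple p).1 x) ↔ nd c.1 x ≤ c.2.eval p := by
  unfold Cond.toTriple
  by_cases h : c.1 % 2 = 0
  · simp only [h, if_true, dotU_eq_nd]
    rw [nd_congr (d := 2 * (Fin.ofNat 5 (c.1 / 2) : ℕ)) (e := c.1)
      (by simp only [Fin.ofNat]; lia)]
  · simp only [h, if_false, dotU_eq_nd, show (-1 : ℤ) ≠ 1 by decide]
    rw [nd_congr (d := 2 * (Fin.ofNat 5 ((c.1 + 5) / 2) : ℕ)) (e := c.1 + 5)
      (by simp only [Fin.ofNat]; lia), nd_add_five, neg_le_neg_iff]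

/-- The point lies in the closure of the tile. -/
def CTile.closedB (T : CTile) (v : Vec) : Bool := T.all fun c => (c.2.sub (v.coord c.1)).nonneg

/-- The vertices of the tile at the ends of the edge of `c`, between `prev` and `next`, are
different points of this edge. -/
def CTile.edgeB (T : CTile) (prev c next : Cond) : Bool :=
  (fun v w : Vec => T.closedB v && T.closedB w && (v.coord c.1).eqB c.2 && (w.coord c.1).eqB c.2 &&
    ((w.coord next.1).sub (v.coord next.1)).pos) (Cond.vertex prev c) (Cond.vertex c next)

/-- All the edges have positive length. -/
def CTile.edgesB (T : CTile) : Bool :=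
  T.all fun c => T.any fun prev => T.any fun next => T.edgeB prev c next

theorem CTile.edge_nontrivial (hp : Positive p) {T : CTile} {U : Tile}
    (hU : ∀ c, c ∈ U ↔ c ∈ T.toTile p) (h : T.edgesB = true) {c : Fin 5 × ℤ × ℝ} (hc : c ∈ U) :
    (U.edge c).Nontrivial := by
  obtain ⟨c, hcT, rfl⟩ := List.mem_map.1 ((hU c).1 hc)
  have h := List.all_eq_true.1 h c hcT
  simp only [List.any_eq_true] at h
  obtain ⟨prev, -, next, -, h⟩ := h
  simp only [edgeB, Bool.and_eq_true] at h
  obtain ⟨⟨⟨⟨h1, h2⟩, h3⟩, h4⟩, h5⟩ := h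
  have hmem : ∀ v : Vec, T.closedB v = true → (v.coord c.1).eqB c.2 = true →
      v.eval p ∈ U.edge (c.toTriple p) := by
    intro v hv hvc
    refine ⟨nd_toTriple.2 ?_, fun d hd => ?_⟩
    · rw [← Vec.eval_coord, Form.eval_eq hvc]
    · obtain ⟨d, hdT, rfl⟩ := List.mem_map.1 ((hU d).1 hd)
      rw [closed_toTriple, ← Vec.eval_coord]
      have := Form.eval_nonneg hp (List.all_eq_true.1 hv d hdT)
      rw [Form.eval_sub] at this
      linarith
  refine ⟨_, hmem _ h1 h3, _, hmem _ h2 h4, fun he => ?_⟩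
  have := Form.eval_pos hp h5
  rw [Form.eval_sub, Vec.eval_coord, Vec.eval_coord, he] at this
  linarith

theorem CTile.toTile_atVerts {V : Verts} {T : CTile} :
    (T.atVerts V).toTile p = T.toTile (V.point p) := by
  simp only [toTile, atVerts, List.map_map]
  refine List.map_congr_left fun c _ => ?_
  simp only [Function.comp, Cond.toTriple, Form.eval_atVerts]

theorem edges_rhombus : (List.finRange 5).all fun k =>
    ((rhombusSys.atom k).atVerts triangleVerts).edgesB := by decide +kernel

theorem edges_A : (List.finRange 8).all fun k =>
    ((sysA.atom k).atVerts triangleVerts).edgesB := by decide +kernel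

theorem edge_rhombusAtom {s t : ℝ} (h : (s, t) ∈ paramTriangle) (k : Fin 5) :
    ∀ c ∈ rhombusAtom s t k, ((rhombusAtom s t k).edge c).Nontrivial := by
  obtain ⟨p, hp, hpst⟩ := exists_positive_of_mem h
  intro c hc
  refine CTile.edge_nontrivial (T := (rhombusSys.atom k).atVerts triangleVerts) hp (fun c => ?_)
    (List.all_eq_true.1 edges_rhombus k (List.mem_finRange k)) hc
  rw [CTile.toTile_atVerts, hpst]
  exact mem_rhombusAtom s t k c

theorem edge_atomA {s t : ℝ} (h : (s, t) ∈ paramTriangle) (k : Fin 8) :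
    ∀ c ∈ atomA s t k, ((atomA s t k).edge c).Nontrivial := by
  obtain ⟨p, hp, hpst⟩ := exists_positive_of_mem h
  intro c hc
  refine CTile.edge_nontrivial (T := (sysA.atom k).atVerts triangleVerts) hp (fun c => ?_)
    (List.all_eq_true.1 edges_A k (List.mem_finRange k)) hc
  rw [CTile.toTile_atVerts, hpst]
  exact mem_atomA s t k c

/-- The edges of `A₁`, `A₄` and `A₈` on the lines `u₀ · x = 1 - s`, `u₁ · x = β⁴ - t` and
`u₀ · x = 1 - s` can only be non-degenerate for parameters in the triangle. -/
theorem mem_paramTriangle_of_edges {s t : ℝ}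
    (h : ∀ k, ∀ c ∈ atomA s t k, ((atomA s t k).edge c).Nontrivial) : (s, t) ∈ paramTriangle := by
  have h5 := α_sq
  have h0 := α_pos
  have hinv : 2 / α = 2 * α / 5 := by field_simp; linarith
  have hb : α = 2 * β + 1 := by simp only [β]; ring
  have hb2 : β ^ 2 = 1 - β := by rw [hb] at h5; linarith
  have hb3 : β ^ 3 = 2 * β - 1 := by linear_combination (β - 1) * hb2
  have hb4 : β ^ 4 = 2 - 3 * β := by linear_combination β * hb3 + 2 * hb2
  have hb0 : 0 < β := by linarith [show (1 : ℝ) < α by nlinarith]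
  have h1 := h 0 (0, 1, 1 - s) (by simp [atomA, tile])
  have h4 := h 3 (1, 1, β ^ 4 - t) (by simp [atomA, tile])
  have h8 := h 7 (0, 1, 1 - s) (by simp [atomA, tile])
  have key : ∀ {S : Set Plane} {P : Prop}, S.Nontrivial →
      (∀ x ∈ S, ∀ y ∈ S, (x.1 < y.1 ∨ x.2 < y.2) → P) → P := by
    rintro S P ⟨x, hx, y, hy, hne⟩ hP
    by_contra hcon
    have hle : ∀ x ∈ S, ∀ y ∈ S, y.1 ≤ x.1 ∧ y.2 ≤ x.2 := fun x hx y hy =>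
      ⟨not_lt.1 fun h => hcon (hP x hx y hy (Or.inl h)),
        not_lt.1 fun h => hcon (hP x hx y hy (Or.inr h))⟩
    have a := hle x hx y hy
    have b := hle y hy x hx
    exact hne (Prod.ext (le_antisymm b.1 a.1) (le_antisymm b.2 a.2))
  rw [mem_paramTriangle_iff, hinv, hb]
  refine ⟨key h8 fun x hx y hy hlt => ?_, key h4 fun x hx y hy hlt => ?_,
    key h1 fun x hx y hy hlt => ?_⟩ <;>
  simp [Tile.edge, atomA, tile, dotU, hb, hb3, hb4] at hx hy
  · have hlt' := mul_lt_mul_of_pos_left (hlt.resolve_left (by linarith)) hb0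
    rw [hx.1] at hx
    rw [hy.1] at hy
    have : (3 + β) * s < (3 + β) * (3 - 5 * β) := by linarith
    linarith [lt_of_mul_lt_mul_left this (by linarith)]
  · have hlt' := mul_lt_mul_of_pos_left (hlt.resolve_right (by linarith)) hb0
    linarith
  · have hlt' := hlt.resolve_left (by linarith)
    rw [hx.1] at hx
    rw [hy.1] at hy
    linarith

theorem isOpen_paramTriangle : IsOpen paramTriangle := isOpen_interior

theorem bifurcationFree_atomA : bifurcationFree atomA = paramTriangle := by
  have : {p : ℝ × ℝ | ∀ k, ∀ c ∈ atomA p.1 p.2 k, ((atomA p.1 p.2 k).edge c).Nontrivial} =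
      paramTriangle :=
    Subset.antisymm (fun _ h => mem_paramTriangle_of_edges h) fun _ h k => edge_atomA h k
  rw [bifurcationFree, this, isOpen_paramTriangle.interior_eq]

theorem paramTriangle_subset_rhombus : paramTriangle ⊆ bifurcationFree rhombusAtom :=
  interior_maximal (fun _ h k => edge_rhombusAtom h k) isOpen_paramTriangle

end

section

/-! ### Triple induction and the tiling of the rhombus -/

theorem dressedR : vR.dressedB coverRhombus = true := by decide +kernel
theorem dressedR₃ : vR₃.dressedB coverR₃ = true := by decide +kernel
theorem dressedR₃₁ : vR₃₁.dressedB coverR₃₁ = true := by decide +kernel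
theorem dressedA : vA.dressedB coverA = true := by decide +kernel
theorem dressedC : vC.dressedB coverC = true := by decide +kernel
theorem reversibleR : vR.reversibleB = true := by decide +kernel
theorem ontoBA : vA.ontoB ontoA = true := by decide +kernel
theorem ontoBC : vC.ontoB ontoC = true := by decide +kernel
theorem subdomainR₃ : vR.subdomainB vR₃ pathsR₃ = true := by decide +kernel
theorem subdomainR₃₁ : vR₃.subdomainB vR₃₁ pathsR₃₁ = true := by decide +kernel
theorem subdomainA : vR₃₁.subdomainB vA pathsA = true := by decide +kernel
theorem subdomainA' : vR.subdomainB vA longPathsA = true := by decide +kernel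

theorem familyR : vR.familyB vA.dom true 100 vPeriodic (fun j : Fin 13 => itineraries[j]) =
    true := by decide +kernel

theorem checkR₃₁ : reachR₃₁.check vR₃₁.parts ([vA.dom] :: periodicOrbits)
    ([vA.dom] :: periodicOrbits ++ [vR₃₁.atoms]) vR₃₁.dom = true := by decide +kernel

theorem checkR₃ : reachR₃.check vR₃.parts ([vR₃₁.dom] :: periodicOrbits)
    ([vR₃₁.dom] :: periodicOrbits ++ [vR₃.atoms]) vR₃.dom = true := by decide +kernel

theorem checkR : reachRhombus.check [] ([vR₃.dom] :: periodicOrbits ++ returnOrbits)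
    ([vR₃.dom] :: periodicOrbits ++ returnOrbits ++ [vR.atoms]) vR.dom = true := by decide +kernel

end

section

variable {p : ℝ × ℝ × ℝ} {s t : ℝ}

theorem models_vR (h : triangleVerts.point p = (1, s, t)) : vR.Models p (rhombus s t) :=
  CSys.Models.atVerts (h ▸ models_rhombus s t)

theorem models_vA (h : triangleVerts.point p = (1, s, t)) : vA.Models p (domA s t) :=
  CSys.Models.atVerts (h ▸ models_domA s t)

theorem set_atom_vA (h : triangleVerts.point p = (1, s, t)) (k : Fin 8) :
    (domA s t).atom k = (vA.atom k).set p := (models_vA h).atom k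

/-- The union of the tiles in the list is the tile `T`. -/
theorem set_eq_of_covers (hp : Positive p) {l : List CTile} {T : CTile} {c : Cert}
    (h : (c.covers l T && l.all fun U => U.subsetB T) = true) :
    T.set p = {x | ∃ U ∈ l, x ∈ U.set p} := by
  rw [Bool.and_eq_true, List.all_eq_true] at h
  exact Subset.antisymm (Cert.covers_sound hp h.1) fun x ⟨U, hU, hx⟩ =>
    CTile.subset_of_subsetB hp (h.2 U hU) hx

theorem merge₂ : (mergeC₂.covers [vA.atom 4, vA.atom 5, vA.atom 6] (vC.atom 1) &&
    [vA.atom 4, vA.atom 5, vA.atom 6].all fun U => U.subsetB (vC.atom 1)) = true := by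
  decide +kernel

theorem merge₃ : (mergeC₃.covers [vA.atom 0, vA.atom 1, vA.atom 2, vA.atom 3] (vC.atom 2) &&
    [vA.atom 0, vA.atom 1, vA.atom 2, vA.atom 3].all fun U => U.subsetB (vC.atom 2)) = true := by
  decide +kernel

theorem models_vC (hp : Positive p) (h : triangleVerts.point p = (1, s, t)) :
    vC.Models p (domC s t) := by
  have hA := models_vA h
  have hatom : ∀ k : Fin 8, (domA s t).atom k = (vA.atom k).set p := hA.atom
  refine ⟨rfl, hA.dom, fun k => ?_, fun k x => ?_⟩
  · fin_cases k
    · exact hA.atom 7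
    · change (domA s t).atom 4 ∪ (domA s t).atom 5 ∪ (domA s t).atom 6 = (vC.atom 1).set p
      rw [set_eq_of_covers hp merge₂, hatom, hatom, hatom]
      ext x
      simp [or_assoc]
    · change (domA s t).atom 0 ∪ (domA s t).atom 1 ∪ (domA s t).atom 2 ∪ (domA s t).atom 3 =
        (vC.atom 2).set p
      rw [set_eq_of_covers hp merge₃, hatom, hatom, hatom, hatom]
      ext x
      simp [or_assoc]
  · fin_cases k
    · exact hA.iso 7 x
    · exact hA.iso 4 x
    · exact hA.iso 0 x

theorem isDressed_rhombus (hp : Positive p) (h : triangleVerts.point p = (1, s, t)) :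
    (rhombus s t).IsDressed := (models_vR h).isDressed hp dressedR

/-- A dressed domain whose atoms and isometries are those of `Y`, with some of the atoms merged, is
a dressed sub-domain if `Y` is one. -/
theorem DressedDomain.IsSubdomain.merge {l m n : ℕ} {X : DressedDomain n} {Y : DressedDomain m}
    {Z : DressedDomain l} (hY : Y.IsSubdomain X) (hZ : Z.IsDressed) (hdom : Z.dom = Y.dom)
    (h : ∀ k, ∀ x ∈ Z.atom k, ∃ j, x ∈ Y.atom j ∧ Y.iso j = Z.iso k) : Z.IsSubdomain X := by
  refine ⟨hZ, hdom ▸ hY.2.1, fun k x hx => ?_⟩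
  obtain ⟨j, hj, hjk⟩ := h k x hx
  obtain ⟨i, hi⟩ := hY.2.2 j x hj
  exact ⟨i, by rwa [← hjk, hdom]⟩

theorem isSubdomain_domA (hp : Positive p) (h : triangleVerts.point p = (1, s, t)) :
    (domA s t).IsSubdomain (rhombus s t) :=
  (models_vR h).isSubdomain hp (isDressed_rhombus hp h) (models_vA h)
    ((models_vA h).isDressed hp dressedA) subdomainA'

theorem isSubdomain_domC (hp : Positive p) (h : triangleVerts.point p = (1, s, t)) :
    (domC s t).IsSubdomain (rhombus s t) := by
  refine (isSubdomain_domA hp h).merge ((models_vC hp h).isDressed hp dressedC) rfl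
    fun k x hx => ?_
  fin_cases k
  · exact ⟨7, hx, rfl⟩
  · rcases hx with (hx | hx) | hx
    exacts [⟨4, hx, rfl⟩, ⟨5, hx, rfl⟩, ⟨6, hx, rfl⟩]
  · rcases hx with ((hx | hx) | hx) | hx
    exacts [⟨0, hx, rfl⟩, ⟨1, hx, rfl⟩, ⟨2, hx, rfl⟩, ⟨3, hx, rfl⟩]

/-- The induced map on `R₃`. -/
noncomputable def domR₃ (p : ℝ × ℝ × ℝ) : DressedDomain 10 := vR₃.toDressed p

/-- The induced map on `R₃₁`. -/
noncomputable def domR₃₁ (p : ℝ × ℝ × ℝ) : DressedDomain 9 := vR₃₁.toDressed p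

theorem models_vR₃ : vR₃.Models p (domR₃ p) := vR₃.models_toDressed p

theorem models_vR₃₁ : vR₃₁.Models p (domR₃₁ p) := vR₃₁.models_toDressed p

theorem isSubdomain_R₃ (hp : Positive p) (h : triangleVerts.point p = (1, s, t)) :
    (domR₃ p).IsSubdomain (rhombus s t) :=
  (models_vR h).isSubdomain hp (isDressed_rhombus hp h) models_vR₃
    (models_vR₃.isDressed hp dressedR₃) subdomainR₃

theorem isSubdomain_R₃₁ (hp : Positive p) : (domR₃₁ p).IsSubdomain (domR₃ p) :=
  models_vR₃.isSubdomain hp (models_vR₃.isDressed hp dressedR₃) models_vR₃₁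
    (models_vR₃₁.isDressed hp dressedR₃₁) subdomainR₃₁

theorem domA_isSubdomain_R₃₁ (hp : Positive p) (h : triangleVerts.point p = (1, s, t)) :
    (domA s t).IsSubdomain (domR₃₁ p) :=
  models_vR₃₁.isSubdomain hp (models_vR₃₁.isDressed hp dressedR₃₁) (models_vA h)
    ((models_vA h).isDressed hp dressedA) subdomainA

/-- The tile `T` lies in `U`, outside of which there is the tile `W`. -/
theorem ssubset_of_disjoint (hp : Positive p) {T U W : CTile}
    (h : (T.subsetB U && W.subsetB U && W.disjointB T && W.hasCenterB true) = true) :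
    T.set p ⊂ U.set p := by
  simp only [Bool.and_eq_true] at h
  obtain ⟨⟨⟨h1, h2⟩, h3⟩, h4⟩ := h
  refine ⟨CTile.subset_of_subsetB hp h1, fun hUT => ?_⟩
  obtain ⟨x, hx⟩ := CTile.nonempty_of_hasCenterB hp h4
  exact Set.disjoint_left.1 (CTile.disjoint_of_disjointB hp h3) hx
    (hUT (CTile.subset_of_subsetB hp h2 hx))

theorem strictA : (vA.dom.subsetB vR₃₁.dom && (vR₃₁.atom 0).subsetB vR₃₁.dom &&
    (vR₃₁.atom 0).disjointB vA.dom && (vR₃₁.atom 0).hasCenterB true) = true := by decide +kernel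

theorem strictR₃₁ : (vR₃₁.dom.subsetB vR₃.dom && (vR₃.atom 1).subsetB vR₃.dom &&
    (vR₃.atom 1).disjointB vR₃₁.dom && (vR₃.atom 1).hasCenterB true) = true := by decide +kernel


theorem triple_induction : ∃ T : ParamTile, T.length = 3 ∧ T.OverQSqrt5 ∧
    ∀ s t : ℝ, (s, t) ∈ paramTriangle → (rhombus s t).IsDressed ∧
      (∃ (n₁ n₂ : ℕ) (X₁ : DressedDomain n₁) (X₂ : DressedDomain n₂),
        X₁.dom = (rhombus s t).atom 2 ∧ X₂.dom = (T.at s t).carrier ∧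
        (domA s t).dom ⊂ X₂.dom ∧ X₂.dom ⊂ X₁.dom ∧
        X₁.IsSubdomain (rhombus s t) ∧ X₂.IsSubdomain X₁ ∧ (domA s t).IsSubdomain X₂) ∧
      (domA s t).IsSubdomain (rhombus s t) := by
  refine ⟨sysR₃₁.dom.toParam, rfl, CTile.overQSqrt5 _, fun s t hst => ?_⟩
  obtain ⟨p, hp, h⟩ := exists_positive_of_mem hst
  refine ⟨isDressed_rhombus hp h, ⟨_, _, domR₃ p, domR₃₁ p, ?_, ?_, ?_, ?_, isSubdomain_R₃ hp h,
    isSubdomain_R₃₁ hp, domA_isSubdomain_R₃₁ hp h⟩, isSubdomain_domA hp h⟩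
  · exact ((models_vR h).atom 2).symm
  · rw [CTile.carrier_toParam, ← h, ← CTile.set_atVerts]
    rfl
  · rw [(models_vA h).dom]
    exact ssubset_of_disjoint hp strictA
  · exact ssubset_of_disjoint hp strictR₃₁

theorem periodicFamily_rhombus (hp : Positive p) (h : triangleVerts.point p = (1, s, t)) :
    (rhombus s t).PeriodicFamily (domA s t).dom (fun j => (vPeriodic j).set p)
      (fun j : Fin 13 => itineraries[j]) := by
  rw [(models_vA h).dom]
  exact (models_vR h).periodicFamily hp (isDressed_rhombus hp h) familyR

/-- Every orbit visits `A` or a periodic tile: the points of `R` reach `R₃` or one of those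
periodic orbits which avoid `R₃`, those of `R₃` reach `R₃₁` or a periodic orbit under the induced
map on `R₃`, and those of `R₃₁` reach `A` or a periodic orbit under the induced map on `R₃₁`. -/
theorem rhombus_subset_basin (hp : Positive p) (h : triangleVerts.point p = (1, s, t)) :
    (rhombus s t).dom ⊆
      (rhombus s t).basin ((domA s t).dom ∪ ⋃ j : Fin 13, (vPeriodic j).set p) := by
  set E := (domA s t).dom ∪ ⋃ j : Fin 13, (vPeriodic j).set p
  have hR := models_vR h
  have hX := isDressed_rhombus hp h
  have hper : ∀ l ∈ periodicOrbits, ∀ U ∈ l, U.set p ⊆ (rhombus s t).basin E := by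
    intro l hl U hU
    obtain ⟨j, -, rfl⟩ := List.mem_map.1 hl
    exact hR.periodic_orbit_subset_basin hX ((periodicFamily_rhombus hp h).periodic j)
      ((subset_iUnion (fun j : Fin 13 => (vPeriodic j).set p) j).trans subset_union_right) hU
  have hcons : ∀ {T : CTile}, T.set p ⊆ (rhombus s t).basin E →
      ∀ l ∈ [T] :: periodicOrbits, ∀ U ∈ l, U.set p ⊆ (rhombus s t).basin E := by
    intro T hT l hl U hU
    rcases List.mem_cons.1 hl with rfl | hl
    · rwa [List.mem_singleton.1 hU]
    · exact hper l hl U hU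
  have hA : vA.dom.set p ⊆ (rhombus s t).basin E := by
    rw [← (models_vA h).dom]
    exact subset_union_left.trans (DressedDomain.subset_basin E)
  have hsub₃ := isSubdomain_R₃ hp h
  have hR₃₁ : vR₃₁.dom.set p ⊆ (rhombus s t).basin E := by
    refine Cert.sound hp (hcons hA) (fun q hq x hx hx' => ?_) _ _ checkR₃₁
    obtain ⟨k, rfl⟩ := (models_vR₃₁ (p := p)).exists_index hq
    -- The isometry is a power of the map on `R₃`, whose steps are powers of the rhombus map.
    obtain ⟨i, -, hi, -⟩ := (isSubdomain_R₃₁ hp).2.2 k x hx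
    exact hsub₃.mem_basin_of_iterate i ((isSubdomain_R₃₁ hp).2.1
      (DressedDomain.atom_subset (isSubdomain_R₃₁ hp).1 k hx)) (hi ▸ hx')
  have hR₃ : vR₃.dom.set p ⊆ (rhombus s t).basin E :=
    models_vR₃.check_sound_subdomain hp hsub₃ (hcons hR₃₁) checkR₃
  rw [hR.dom]
  refine Cert.sound hp ?_ (by simp) _ _ checkR
  intro l hl U hU
  rcases List.mem_append.1 hl with hl | hl
  · exact hcons hR₃ l hl U hU
  · obtain ⟨q, hq, rfl⟩ := List.mem_map.1 hl
    exact hR.return_orbit_subset_basin hp hX subdomainR₃ hR₃ hq hU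

theorem tiledBy_rhombus {m : ℕ} {Y : DressedDomain m} (hp : Positive p)
    (h : triangleVerts.point p = (1, s, t)) (hY : Y.IsSubdomain (rhombus s t))
    (hdom : Y.dom = (domA s t).dom) (hYo : Y.OntoDom) :
    (rhombus s t).TiledBy Y (fun j => (vPeriodic j).set p)
      (fun j : Fin 13 => (itineraries[j]).length) := by
  have hX := isDressed_rhombus hp h
  refine DressedDomain.tiledBy_of_hits hX ((models_vR h).reversible hp hX reversibleR) hY hYo
    (hdom ▸ periodicFamily_rhombus hp h) fun x hx => ?_
  obtain ⟨i, hi⟩ := rhombus_subset_basin hp h hx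
  rw [hdom]
  exact ⟨i, hi.imp id fun hi => mem_iUnion.1 hi⟩

theorem itineraries_not_isRotated (i j : Fin 13) (hij : i ≠ j) :
    ¬ (itineraries[i] : List (Fin 5)).IsRotated itineraries[j] := by
  have key : ∀ i j : Fin 13, i ≠ j → ((itineraries[i]).length ≠ (itineraries[j]).length ∨
      (itineraries[i]).count 3 ≠ (itineraries[j]).count 3 ∨
      (itineraries[i]).count 4 ≠ (itineraries[j]).count 4) := by decide +kernel
  intro hr
  rcases key i j hij with h | h | h
  · exact h hr.perm.length_eq
  · exact h (hr.perm.count_eq 3)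
  · exact h (hr.perm.count_eq 4)

theorem tiling : ∃ (w : Fin 8 → List (Fin 5)) (P : Fin 13 → ParamTile) (v : Fin 13 → List (Fin 5)),
    Function.Injective w ∧ (∀ k, k < 4 → (w k).length = 78) ∧
    (∀ i j, i ≠ j → ¬ (v i).IsRotated (v j)) ∧ (∀ j, (P j).OverQSqrt5) ∧
    ∀ s t : ℝ, (s, t) ∈ paramTriangle →
      (∀ k, (rhombus s t).HasReturnPath (domA s t).dom ((domA s t).atom k) (w k)) ∧
      (∀ j, (rhombus s t).IsPeriodicTile ((P j).at s t).carrier (v j) ∧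
        (interior ((P j).at s t).carrier).Nonempty) ∧
      (rhombus s t).TiledBy (domA s t) (fun j => ((P j).at s t).carrier)
        (fun j => (v j).length) ∧
      (rhombus s t).TiledBy (domC s t) (fun j => ((P j).at s t).carrier)
        (fun j => (v j).length) := by
  refine ⟨fun k => longPathsA.getD k [], fun j => (periodicTiles[j]).toParam,
    fun j => itineraries[j], ?_, by decide +kernel, itineraries_not_isRotated,
    fun j => CTile.overQSqrt5 _, fun s t hst => ?_⟩
  · have : ∀ i j : Fin 8, longPathsA.getD i [] = longPathsA.getD j [] → i = j := by decide +kernel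
    exact fun i j => this i j
  obtain ⟨p, hp, h⟩ := exists_positive_of_mem hst
  have hcar : ∀ j : Fin 13, ((periodicTiles[j]).toParam.at s t).carrier = (vPeriodic j).set p := by
    intro j
    rw [CTile.carrier_toParam, ← h, ← CTile.set_atVerts]
    rfl
  simp only [hcar]
  refine ⟨fun k => ?_, fun j => ⟨(periodicFamily_rhombus hp h).periodic j,
    CSys.interior_nonempty_of_familyB hp familyR j⟩,
    tiledBy_rhombus hp h (isSubdomain_domA hp h) rfl ((models_vA h).ontoDom hp ontoBA),
    tiledBy_rhombus hp h (isSubdomain_domC hp h) rfl ((models_vC hp h).ontoDom hp ontoBC)⟩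
  have hc : ∀ k : Fin 8, (vA.atom k).hasCenterB true = true := by decide +kernel
  refine (models_vR h).hasReturnPath_of_subdomainB hp (isDressed_rhombus hp h) (models_vA h)
    subdomainA' ?_
  rw [set_atom_vA h]
  exact CTile.nonempty_of_hasCenterB hp (hc k)

end

section

/-! ### The base triangles in terms of parametric data -/

/-- The form `(a + b ω) + (a' + b' ω) τ`, for the parameters `(1, τ, 0)`. -/
def affine (a b a' b' : ℤ) : Form := ⟨⟨a, b⟩, ⟨a', b'⟩, ⟨0, 0⟩⟩

/-- The condition with direction `n_d` and edge coordinate `(a + b ω) + (a' + b' ω) τ`. -/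
def affineCond (d : ℕ) (a b a' b' : ℤ) : Cond := (d, affine a b a' b')

/-- The base triangle `ℬ`. -/
def baseSys : CSys := ⟨[affineCond 0 0 0 0 0, affineCond 4 0 0 0 0, affineCond 7 1 1 (-1) 0], [
  ([affineCond 0 0 0 0 0, affineCond 4 0 0 0 0, affineCond 6 0 1 0 (-1)],
    ⟨2, affine 0 (-1) 0 1, affine (-1) (-1) 1 1⟩),
  ([affineCond 0 0 0 0 0, affineCond 1 0 (-1) 0 1, affineCond 4 0 0 0 0, affineCond 7 1 1 (-1) 0,
    affineCond 8 1 1 0 (-1)], ⟨3, affine 0 0 0 0, affine (-1) (-2) 1 1⟩),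
  ([affineCond 0 0 0 0 0, affineCond 3 (-1) (-1) 0 1, affineCond 7 1 1 (-1) 0],
    ⟨2, affine 0 (-2) 0 1, affine (-2) (-2) 1 1⟩)]⟩

/-- Change of sign of all edge coordinates and inclusion indices: the normals of all the half-planes
are reversed. -/
def CTile.opposite (T : CTile) : CTile := T.map fun c => ((c.1 + 5) % 10, c.2)

/-- The companion `ℬ̃` of the base triangle. -/
def CSys.opposite (S : CSys) : CSys :=
  ⟨S.dom.opposite, S.parts.map fun c =>
    (c.1.opposite, ⟨c.2.rot, c.2.trans.x.neg, c.2.trans.y.neg⟩)⟩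

/-- The data of the base triangles `ℬ` (for `true`) and `ℬ̃` (for `false`). -/
def baseData (kind : Bool) : CSys := bif kind then baseSys else baseSys.opposite

theorem mem_baseAtom (τ : ℝ) (k : Fin 3) (c : Fin 5 × ℤ × ℝ) :
    c ∈ baseAtom τ k ↔ c ∈ (baseSys.atom k).toTile (1, τ, 0) := by
  fin_cases k <;> simp [baseAtom, tile, baseSys, CSys.atom, affineCond, affine, CTile.toTile,
    Cond.toTriple, Form.eval, Zw.val, ← sub_eq_add_neg, ω_sq] <;> grind

theorem mem_baseAtom_neg (τ : ℝ) (k : Fin 3) (c : Fin 5 × ℤ × ℝ) :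
    c ∈ (baseAtom τ k).neg ↔ c ∈ (baseSys.opposite.atom k).toTile (1, τ, 0) := by
  fin_cases k <;> simp [baseAtom, tile, baseSys, CSys.opposite, CTile.opposite, Tile.neg, CSys.atom,
    affineCond, affine, CTile.toTile, Cond.toTriple, Form.eval, Zw.val, ← sub_eq_add_neg, ω_sq] <;>
    grind

theorem ω_pow_three : ω ^ 3 = 2 * ω + 1 := by
  have := ω_sq; grind

theorem models_base (kind : Bool) (τ : ℝ) :
    (baseData kind).Models (1, τ, 0) (base (kind, τ)) := by
  cases kind
  · refine ⟨rfl, carrier_eq_set fun c => ?_, fun k => carrier_eq_set (mem_baseAtom_neg τ k),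
      fun k x => ?_⟩
    · simp [baseTriangle, tile, baseData, baseSys, CSys.opposite, CTile.opposite, Tile.neg,
        affineCond, affine, CTile.toTile, Cond.toTriple, Form.eval, Zw.val, ← sub_eq_add_neg, ω_sq]
      grind
    · fin_cases k <;> simp [base, baseTrans, baseData, baseSys, CSys.opposite, CSys.iso, affine,
        CIso.toIsom, Vec.eval, Form.eval, Form.neg, Zw.neg, Zw.val, Isom.apply, ω_sq,
        ω_pow_three] <;> grind
  · refine ⟨rfl, carrier_eq_set fun c => ?_, fun k => carrier_eq_set (mem_baseAtom τ k),
      fun k x => ?_⟩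
    · simp [baseTriangle, tile, baseData, baseSys,
        affineCond, affine, CTile.toTile, Cond.toTriple, Form.eval, Zw.val, ← sub_eq_add_neg, ω_sq]
      grind
    · fin_cases k <;> simp [base, baseTrans, baseData, baseSys, CSys.iso, affine,
        CIso.toIsom, Vec.eval, Form.eval, Zw.val, Isom.apply, ω_sq,
        ω_pow_three] <;> grind

end

section

/-! ### Renormalization of the base triangles over a range of the parameter -/

/-- The parameters `(1, τ, 0)` with `τ` between `l` and `u`, which are positive combinations of the
first two generators. -/
def Verts.interval (l u : Zw) : Verts := ⟨⟨⟨1, 0⟩, l, ⟨0, 0⟩⟩, ⟨⟨1, 0⟩, u, ⟨0, 0⟩⟩, Form.zero⟩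

/-- The single parameter `(1, τ, 0)`. -/
def Verts.single (τ : Zw) : Verts := ⟨⟨⟨1, 0⟩, τ, ⟨0, 0⟩⟩, Form.zero, Form.zero⟩

/-- The renormalization data of a base triangle over a range of its parameter: the range of the
parameter and, in corresponding coordinates, the parameter of the renormalized triangle; the kinds
of the two triangles; the similarity from the latter to the induced domain; the return paths; the
periodic tiles with their itineraries; and the certificate that all orbits visit the induced domain
or a periodic tile. -/
structure BaseCase where
  range : Verts
  image : Verts
  kind : Bool
  kind' : Bool
  sim : CSim
  words : List (List (Fin 3))
  periodic : List (CTile × List (Fin 3))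
  reach : Cert

/-- The atoms of a base triangle cover it. -/
def coverBase : Cert :=
  .cut 0 0 2 0x231 (.hit 0 0) 0x2134 (.cut 0 1 4 0x23451 (.hit 0 1) 0x215 (.hit 0 2))

/-- The images of the atoms of a base triangle cover it. -/
def ontoBase : Cert :=
  .cut 0 0 1 0x231 (.hit 0 0) 0x2134 (.cut 0 1 0 0x23415 (.hit 0 1) 0x145 (.hit 0 2))

namespace BaseCase

variable (C : BaseCase)

/-- The similarity, in coordinates with respect to the generators of the range. -/
def similarity : CSim := ⟨C.sim.refl, C.sim.rot, C.sim.scale, C.sim.trans.atVerts C.range⟩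

/-- The base triangle. -/
def source : CSys := (baseData C.kind).atVerts C.range

/-- The renormalized base triangle. -/
def target : CSys := (baseData C.kind').atVerts C.image

/-- The induced domain. -/
def induced : CSys := C.target.scaleImage C.similarity

def periodicTile (j : Fin C.periodic.length) : CTile := C.periodic[j].1.atVerts C.range

def itinerary (j : Fin C.periodic.length) : List (Fin 3) := C.periodic[j].2

def periodicOrbits : List (List CTile) :=
  (List.finRange _).map fun j => C.source.orbit (C.itinerary j) (C.periodicTile j)

/-- The test of the renormalization data. -/
def check : Bool :=
  C.sim.scale.pos && ((⟨1, 0⟩ : Zw).sub C.sim.scale).pos &&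
  C.source.dressedB coverBase && C.source.reversibleB &&
  C.induced.dressedB coverBase && C.induced.ontoB ontoBase &&
  C.source.subdomainB C.induced C.words &&
  C.source.familyB C.induced.dom false 20 C.periodicTile C.itinerary &&
  C.reach.check C.source.parts ([C.induced.dom] :: C.periodicOrbits)
    ([C.induced.dom] :: C.periodicOrbits ++ [C.source.atoms]) C.source.dom

variable {C}

theorem sound (h : C.check = true) {p : ℝ × ℝ × ℝ} (hp : Positive p) {τ τ' : ℝ}
    (hτ : C.range.point p = (1, τ, 0)) (hτ' : C.image.point p = (1, τ', 0)) :
    ∃ (Y : DressedDomain 3) (G : Similarity), G.scale < 1 ∧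
      DressedDomain.IsImage G (base (C.kind', τ')) Y ∧ Y.IsSubdomain (base (C.kind, τ)) ∧
      Y.RecursivelyTiles (base (C.kind, τ)) := by
  simp only [check, Bool.and_eq_true] at h
  obtain ⟨⟨⟨⟨⟨⟨⟨⟨hpos, hlt⟩, hX⟩, hrev⟩, hY⟩, honto⟩, hsub⟩, hfam⟩, hreach⟩ := h
  have hG : 0 < C.similarity.scale.val := Zw.val_pos hpos
  have hlt : C.similarity.scale.val < 1 := by
    have := Zw.val_pos hlt
    rw [Zw.val_sub] at this
    simpa [similarity, Zw.val] using this
  have hsource : C.source.Models p (base (C.kind, τ)) :=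
    CSys.Models.atVerts (hτ ▸ models_base C.kind τ)
  have htarget : C.target.Models p (base (C.kind', τ')) :=
    CSys.Models.atVerts (hτ' ▸ models_base C.kind' τ')
  obtain ⟨Y, hYim, hYmod⟩ := htarget.scaleImage hG
  change C.induced.Models p Y at hYmod
  have hX := hsource.isDressed hp hX
  have hYsub := hsource.isSubdomain hp hX hYmod (hYmod.isDressed hp hY) hsub
  have hper := hsource.periodicFamily hp hX hfam
  refine ⟨Y, _, hlt, hYim, hYsub, _, _, C.itinerary, hper.periodic,
    DressedDomain.tiledBy_of_hits hX (hsource.reversible hp hX hrev) hYsub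
      (hYmod.ontoDom hp honto) (hYmod.dom ▸ hper) fun x hx => ?_⟩
  have hbasin : C.source.dom.set p ⊆ (base (C.kind, τ)).basin
      (Y.dom ∪ ⋃ j, (C.periodicTile j).set p) := by
    refine hsource.check_sound hp hX ?_ hreach
    intro l hl U hU
    rcases List.mem_cons.1 hl with rfl | hl
    · rw [List.mem_singleton.1 hU, ← hYmod.dom]
      exact subset_union_left.trans (DressedDomain.subset_basin _)
    · obtain ⟨j, -, rfl⟩ := List.mem_map.1 hl
      exact hsource.periodic_orbit_subset_basin hX (hper.periodic j)
        ((subset_iUnion (fun j => (C.periodicTile j).set p) j).trans subset_union_right) hU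
  rw [hsource.dom] at hx
  obtain ⟨i, hi⟩ := hbasin hx
  exact ⟨i, hi.imp id fun hi => mem_iUnion.1 hi⟩

end BaseCase

/-! ### The renormalizations of the base triangles -/

/-- The renormalization of `ℬ` for `0 < τ < β²`. -/
def caseLowerTrue : BaseCase where
  range := .interval ⟨0, 0⟩ ⟨2, -1⟩
  image := .interval ⟨0, 0⟩ ⟨1, 0⟩
  kind := true
  kind' := true
  sim := ⟨false, 0, ⟨2, -1⟩, affine 0 0 0 0, affine 0 0 0 0⟩
  words := [word 2 121, word 2 12221, word 2 12321]
  periodic := [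
    ([affineCond 0 0 0 0 0, affineCond 2 (-1) 0 1 0, affineCond 4 0 0 0 0, affineCond 6 0 1 0 (-1),
      affineCond 8 0 1 0 (-1)], word 2 1),
    ([affineCond 1 0 (-1) 0 1, affineCond 3 0 (-1) 0 1, affineCond 5 1 0 0 0,
      affineCond 7 1 1 (-1) 0,
      affineCond 9 1 0 0 0], word 2 2)]
  reach :=
    .cut 0 0 2 0x231 (.hit 0 0) 0x2134 (.cut 1 0 3 0x2341 (.cut 1 0 4 0x23451 (.hit 1 0) 0x215
    (.move 0 (.hit 0 0))) 0x2145 (.cut 2 0 1 0x23145 (.cut 2 0 2 0x23416 (.cut 2 0 4 0x34561 (.hit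
    2 0) 0x2316 (.cut 3 1 4 0x23451 (.move 1 (.move 1 (.move 0 (.hit 0 0)))) 0x215 (.move 2 (.move
    1 (.move 0 (.hit 0 0)))))) 0x1456 (.move 1 (.move 0 (.hit 0 0)))) 0x341 (.move 1 (.cut 3 0 2
    0x341 (.move 0 (.hit 0 0)) 0x3142 (.cut 3 1 4 0x23451 (.move 1 (.move 1 (.move 0 (.hit 0 0))))
    0x215 (.move 2 (.move 1 (.move 0 (.hit 0 0)))))))))

/-- The renormalization of `ℬ̃` for `0 < τ < β²`. -/
def caseLowerFalse : BaseCase where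
  range := .interval ⟨0, 0⟩ ⟨2, -1⟩
  image := .interval ⟨0, 0⟩ ⟨1, 0⟩
  kind := false
  kind' := false
  sim := ⟨false, 0, ⟨2, -1⟩, affine 0 0 0 0, affine 0 0 0 0⟩
  words := [word 2 121, word 2 12221, word 2 12321]
  periodic := [
    ([affineCond 1 0 1 0 (-1), affineCond 3 0 1 0 (-1), affineCond 5 0 0 0 0,
      affineCond 7 (-1) 0 1 0,
      affineCond 9 0 0 0 0], word 2 1),
    ([affineCond 0 1 0 0 0, affineCond 2 1 1 (-1) 0, affineCond 4 1 0 0 0, affineCond 6 0 (-1) 0 1,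
      affineCond 8 0 (-1) 0 1], word 2 2)]
  reach :=
    .cut 0 0 2 0x123 (.hit 0 0) 0x4213 (.cut 1 0 0 0x1345 (.cut 1 0 1 0x21345 (.hit 1 0) 0x231
    (.move 0 (.hit 0 0))) 0x2315 (.cut 2 0 0 0x12345 (.cut 2 0 2 0x23156 (.cut 2 0 4 0x23451 (.hit
    2 0) 0x2156 (.move 1 (.cut 3 1 4 0x41523 (.move 1 (.move 1 (.move 0 (.hit 0 0)))) 0x451 (.move
    2 (.move 1 (.move 0 (.hit 0 0))))))) 0x3451 (.cut 3 1 4 0x21345 (.move 1 (.move 1 (.move 0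
    (.hit 0 0)))) 0x231 (.move 2 (.move 1 (.move 0 (.hit 0 0)))))) 0x215 (.move 1 (.move 0 (.hit 0
    0)))))

/-- The renormalization of `ℬ` for `τ = 0`. -/
def caseZero : BaseCase where
  range := .single ⟨0, 0⟩
  image := .single ⟨0, 0⟩
  kind := true
  kind' := true
  sim := ⟨false, 0, ⟨2, -1⟩, affine 0 0 0 0, affine 0 0 0 0⟩
  words := [word 2 121, word 2 12221, word 2 0]
  periodic := [
    ([affineCond 0 0 0 0 0, affineCond 2 (-1) 0 0 0, affineCond 4 0 0 0 0, affineCond 6 0 1 0 0,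
      affineCond 8 0 1 0 0], word 2 1),
    ([affineCond 1 0 (-1) 0 0, affineCond 3 0 (-1) 0 0, affineCond 5 1 0 0 0, affineCond 7 1 1 0 0,
      affineCond 9 1 0 0 0], word 2 2)]
  reach :=
    .cut 0 0 2 0x231 (.hit 0 0) 0x2134 (.cut 1 0 3 0x2341 (.cut 1 0 4 0x23451 (.hit 1 0) 0x215
    (.move 0 (.hit 0 0))) 0x2145 (.cut 2 0 1 0x23145 (.cut 2 0 2 0x23416 (.cut 2 0 4 0x34561 (.hit
    2 0) 0x2316 (.move 1 (.move 1 (.move 0 (.hit 0 0))))) 0x1456 (.move 1 (.move 0 (.hit 0 0))))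
    0x341 (.move 1 (.cut 3 0 2 0x341 (.move 0 (.hit 0 0)) 0x3142 (.move 1 (.move 1 (.move 0 (.hit
    0 0))))))))

/-- The renormalization of `ℬ` for `β² < τ < β`. -/
def caseMiddleTrue : BaseCase where
  range := .interval ⟨2, -1⟩ ⟨-1, 1⟩
  image := .interval ⟨1, 0⟩ ⟨0, 0⟩
  kind := true
  kind' := false
  sim := ⟨true, 1, ⟨-3, 2⟩, affine 0 0 (-1) 0, affine 0 (-1) 1 0⟩
  words := [word 2 232, word 2 11232, word 2 112221122211232]
  periodic := [
    ([affineCond 0 0 0 0 0, affineCond 2 (-1) 0 1 0, affineCond 4 0 0 0 0, affineCond 6 0 1 0 (-1),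
      affineCond 8 0 1 0 (-1)], word 2 1),
    ([affineCond 0 0 0 0 0, affineCond 1 0 (-1) 0 1, affineCond 2 0 (-1) 1 0,
      affineCond 3 0 (-1) 0 1,
      affineCond 4 0 0 0 0, affineCond 5 1 0 0 0, affineCond 6 1 1 0 (-1), affineCond 7 1 1 (-1) 0,
      affineCond 8 1 1 0 (-1), affineCond 9 1 0 0 0], word 2 2),
    ([affineCond 0 0 0 0 0, affineCond 2 0 (-1) 1 0, affineCond 4 1 (-1) 0 0,
      affineCond 6 0 1 0 (-1),
      affineCond 8 2 0 0 (-1)], word 2 11222)]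
  reach :=
    .cut 0 0 0 0x231 (.cut 0 0 1 0x214 (.hit 0 0) 0x2341 (.cut 1 0 1 0x21345 (.cut 1 0 3 0x23416
    (.hit 1 0) 0x1456 (.move 1 (.move 2 (.move 1 (.hit 0 0))))) 0x231 (.move 0 (.move 1 (.cut 3 3
    1 0x231 (.cut 3 3 2 0x2341 (.move 1 (.move 1 (.move 0 (.move 0 (.move 1 (.cut 3 3 2 0x34521
    (.hit 3 3) 0x312 (.move 2 (.move 1 (.hit 0 0))))))))) 0x214 (.move 2 (.move 1 (.hit 0 0))))
    0x2134 (.cut 4 1 4 0x341 (.move 1 (.move 1 (.move 0 (.move 0 (.move 1 (.move 1 (.move 1 (.move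
    0 (.move 0 (.move 1 (.move 2 (.move 1 (.hit 0 0))))))))))))) 0x23145 (.move 2 (.move 1 (.hit 0
    0))))))))) 0x2134 (.cut 2 0 1 0x21345 (.cut 2 0 3 0x234156 (.cut 2 0 5 0x2345617 (.cut 2 0 6
    0x23456718 (.cut 2 0 8 0x234567891 (.move 1 (.move 1 (.cut 2 0 1 0xa123456789 (.hit 2 0) 0xa21
    (.move 0 (.move 0 (.move 1 (.cut 3 3 2 0x4231 (.move 1 (.move 1 (.move 0 (.move 0 (.move 1
    (.cut 3 3 2 0x34521 (.hit 3 3) 0x312 (.move 2 (.move 1 (.hit 0 0))))))))) 0x413 (.move 2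
    (.move 1 (.hit 0 0)))))))))) 0x219 (.move 2 (.move 1 (.hit 0 0)))) 0x178 (.move 1 (.hit 0 0)))
    0x167 (.move 1 (.move 0 (.move 0 (.move 1 (.cut 3 3 1 0x231 (.cut 3 3 2 0x2341 (.move 1 (.move
    1 (.move 0 (.move 0 (.move 1 (.cut 3 3 2 0x34521 (.hit 3 3) 0x312 (.move 2 (.move 1 (.hit 0
    0))))))))) 0x214 (.move 2 (.move 1 (.hit 0 0)))) 0x2134 (.cut 4 1 4 0x341 (.move 1 (.move 1
    (.move 0 (.move 0 (.move 1 (.move 1 (.move 1 (.move 0 (.move 0 (.move 1 (.move 2 (.move 1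
    (.hit 0 0))))))))))))) 0x23145 (.move 2 (.move 1 (.hit 0 0)))))))))) 0x451 (.move 1 (.move 1
    (.move 1 (.move 0 (.move 0 (.move 1 (.cut 3 3 2 0x4231 (.move 1 (.move 1 (.move 0 (.move 0
    (.move 1 (.cut 3 3 2 0x34521 (.hit 3 3) 0x312 (.move 2 (.move 1 (.hit 0 0))))))))) 0x413
    (.move 2 (.move 1 (.hit 0 0))))))))))) 0x231 (.move 0 (.move 0 (.move 1 (.cut 3 3 2 0x4231
    (.move 1 (.move 1 (.move 0 (.move 0 (.move 1 (.cut 3 3 2 0x34521 (.hit 3 3) 0x312 (.move 2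
    (.move 1 (.hit 0 0))))))))) 0x413 (.move 2 (.move 1 (.hit 0 0))))))))

/-- The renormalization of `ℬ̃` for `β² < τ < β`. -/
def caseMiddleFalse : BaseCase where
  range := .interval ⟨2, -1⟩ ⟨-1, 1⟩
  image := .interval ⟨1, 0⟩ ⟨0, 0⟩
  kind := false
  kind' := true
  sim := ⟨true, 1, ⟨-3, 2⟩, affine 0 0 1 0, affine 0 1 (-1) 0⟩
  words := [word 2 232, word 2 11232, word 2 112221122211232]
  periodic := [
    ([affineCond 1 0 1 0 (-1), affineCond 3 0 1 0 (-1), affineCond 5 0 0 0 0,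
      affineCond 7 (-1) 0 1 0,
      affineCond 9 0 0 0 0], word 2 1),
    ([affineCond 0 1 0 0 0, affineCond 1 1 1 0 (-1), affineCond 2 1 1 (-1) 0,
      affineCond 3 1 1 0 (-1),
      affineCond 4 1 0 0 0, affineCond 5 0 0 0 0, affineCond 6 0 (-1) 0 1, affineCond 7 0 (-1) 1 0,
      affineCond 8 0 (-1) 0 1, affineCond 9 0 0 0 0], word 2 2),
    ([affineCond 1 0 1 0 (-1), affineCond 3 2 0 0 (-1), affineCond 5 0 0 0 0,
      affineCond 7 0 (-1) 1 0,
      affineCond 9 1 (-1) 0 0], word 2 11222)]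
  reach :=
    .cut 0 0 0 0x123 (.cut 0 0 1 0x231 (.hit 0 0) 0x2134 (.cut 1 0 0 0x1345 (.move 0 (.cut 1 0 0
    0x15234 (.hit 1 0) 0x514 (.move 1 (.cut 3 3 1 0x3412 (.cut 3 3 3 0x1345 (.cut 3 3 4 0x21345
    (.hit 3 3) 0x231 (.move 2 (.move 1 (.hit 0 0)))) 0x2315 (.cut 4 1 4 0x145 (.move 1 (.move 1
    (.move 0 (.move 0 (.move 1 (.move 1 (.move 1 (.move 0 (.move 0 (.move 1 (.move 2 (.move 1
    (.hit 0 0))))))))))))) 0x23415 (.move 2 (.move 1 (.hit 0 0))))) 0x142 (.move 1 (.move 1 (.move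
    0 (.move 0 (.move 1 (.move 2 (.move 1 (.hit 0 0)))))))))))) 0x2315 (.move 1 (.move 2 (.move 1
    (.hit 0 0)))))) 0x4213 (.cut 2 0 0 0x12345 (.cut 2 0 1 0x213456 (.cut 2 0 3 0x2341567 (.cut 2
    0 4 0x23451678 (.cut 2 0 6 0x234567189 (.move 1 (.move 1 (.move 1 (.cut 2 0 6 0x4567891a23
    (.hit 2 0) 0x19a (.move 0 (.move 0 (.move 1 (.cut 3 3 1 0x4213 (.cut 3 3 4 0x21345 (.hit 3 3)
    0x231 (.move 2 (.move 1 (.hit 0 0)))) 0x123 (.move 1 (.move 1 (.move 0 (.move 0 (.move 1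
    (.move 2 (.move 1 (.hit 0 0)))))))))))))))) 0x178 (.move 0 (.move 0 (.move 1 (.cut 3 3 1
    0x4213 (.cut 3 3 4 0x21345 (.hit 3 3) 0x231 (.move 2 (.move 1 (.hit 0 0)))) 0x123 (.move 1
    (.move 1 (.move 0 (.move 0 (.move 1 (.move 2 (.move 1 (.hit 0 0))))))))))))) 0x561 (.move 1
    (.move 1 (.move 0 (.move 0 (.move 1 (.cut 3 3 1 0x3412 (.cut 3 3 4 0x21345 (.hit 3 3) 0x231
    (.move 2 (.move 1 (.hit 0 0)))) 0x142 (.move 1 (.move 1 (.move 0 (.move 0 (.move 1 (.move 2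
    (.move 1 (.hit 0 0))))))))))))))) 0x451 (.move 2 (.move 1 (.hit 0 0)))) 0x231 (.move 1 (.hit 0
    0))) 0x215 (.move 1 (.move 0 (.move 0 (.move 1 (.cut 3 3 1 0x2314 (.cut 3 3 3 0x1345 (.cut 3 3
    4 0x21345 (.hit 3 3) 0x231 (.move 2 (.move 1 (.hit 0 0)))) 0x2315 (.cut 4 1 4 0x145 (.move 1
    (.move 1 (.move 0 (.move 0 (.move 1 (.move 1 (.move 1 (.move 0 (.move 0 (.move 1 (.move 2
    (.move 1 (.hit 0 0))))))))))))) 0x23415 (.move 2 (.move 1 (.hit 0 0))))) 0x134 (.move 1 (.move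
    1 (.move 0 (.move 0 (.move 1 (.move 2 (.move 1 (.hit 0 0))))))))))))))

/-- The renormalization of `ℬ` for `β < τ < 1`. -/
def caseUpperTrue : BaseCase where
  range := .interval ⟨-1, 1⟩ ⟨1, 0⟩
  image := .interval ⟨1, 0⟩ ⟨0, 0⟩
  kind := true
  kind' := false
  sim := ⟨false, 1, ⟨2, -1⟩, affine 0 (-1) 0 1, affine (-1) (-1) 1 0⟩
  words := [word 2 3, word 2 223, word 2 21123]
  periodic := [
    ([affineCond 0 0 0 0 0, affineCond 2 (-1) 0 1 0, affineCond 4 0 0 0 0, affineCond 6 0 1 0 (-1),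
      affineCond 8 0 1 0 (-1)], word 2 1),
    ([affineCond 0 0 0 0 0, affineCond 2 0 (-1) 1 0, affineCond 4 0 0 0 0, affineCond 6 1 1 0 (-1),
      affineCond 8 1 1 0 (-1)], word 2 2)]
  reach :=
    .cut 0 0 1 0x134 (.hit 0 0) 0x2314 (.cut 1 0 1 0x21345 (.cut 1 0 3 0x2341 (.cut 1 0 4 0x23451
    (.hit 1 0) 0x215 (.move 0 (.move 0 (.move 1 (.move 2 (.hit 0 0)))))) 0x21456 (.cut 2 0 1
    0x21456 (.cut 2 0 4 0x23451 (.hit 2 0) 0x2156 (.move 2 (.hit 0 0))) 0x2341 (.move 1 (.move 2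
    (.hit 0 0))))) 0x231 (.move 0 (.move 1 (.move 2 (.hit 0 0)))))

/-- The renormalization of `ℬ̃` for `β < τ < 1`. -/
def caseUpperFalse : BaseCase where
  range := .interval ⟨-1, 1⟩ ⟨1, 0⟩
  image := .interval ⟨1, 0⟩ ⟨0, 0⟩
  kind := false
  kind' := true
  sim := ⟨false, 1, ⟨2, -1⟩, affine 0 1 0 (-1), affine 1 1 (-1) 0⟩
  words := [word 2 3, word 2 223, word 2 21123]
  periodic := [
    ([affineCond 1 0 1 0 (-1), affineCond 3 0 1 0 (-1), affineCond 5 0 0 0 0,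
      affineCond 7 (-1) 0 1 0,
      affineCond 9 0 0 0 0], word 2 1),
    ([affineCond 1 1 1 0 (-1), affineCond 3 1 1 0 (-1), affineCond 5 0 0 0 0,
      affineCond 7 0 (-1) 1 0,
      affineCond 9 0 0 0 0], word 2 2)]
  reach :=
    .cut 0 0 1 0x413 (.hit 0 0) 0x1423 (.cut 1 0 0 0x145 (.move 0 (.cut 1 0 0 0x1423 (.move 0
    (.cut 1 0 0 0x15234 (.hit 1 0) 0x514 (.move 1 (.move 2 (.hit 0 0))))) 0x413 (.move 1 (.move 2
    (.hit 0 0))))) 0x23415 (.cut 2 0 1 0x21456 (.move 1 (.cut 2 0 1 0x41623 (.hit 2 0) 0x4561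
    (.move 2 (.hit 0 0)))) 0x2341 (.move 2 (.hit 0 0))))

/-- The renormalization of `ℬ` for `τ = β²`. -/
def caseβSqTrue : BaseCase where
  range := .single ⟨2, -1⟩
  image := .single ⟨0, 0⟩
  kind := true
  kind' := true
  sim := ⟨true, 0, ⟨-3, 2⟩, affine 0 0 0 0, affine 0 (-1) 0 0⟩
  words := [word 2 11222, word 2 11232, word 2 0]
  periodic := [
    ([affineCond 0 0 0 0 0, affineCond 2 1 (-1) 0 0, affineCond 4 0 0 0 0, affineCond 6 1 0 0 0,
      affineCond 8 1 0 0 0], word 2 1),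
    ([affineCond 0 0 0 0 0, affineCond 1 (-1) 0 0 0, affineCond 2 2 (-2) 0 0,
      affineCond 3 (-1) 0 0 0,
      affineCond 4 0 0 0 0, affineCond 5 1 0 0 0, affineCond 6 2 0 0 0, affineCond 7 (-1) 2 0 0,
      affineCond 8 2 0 0 0, affineCond 9 1 0 0 0], word 2 2),
    ([affineCond 3 0 (-1) 0 0, affineCond 5 1 0 0 0, affineCond 9 2 (-1) 0 0], word 2 223)]
  reach :=
    .cut 0 0 1 0x231 (.cut 0 0 2 0x214 (.hit 0 0) 0x2341 (.cut 1 0 1 0x21345 (.hit 1 0) 0x231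
    (.move 0 (.move 1 (.cut 4 1 4 0x231 (.move 1 (.move 1 (.hit 0 0))) 0x2134 (.move 2 (.move 1
    (.hit 0 0)))))))) 0x2134 (.cut 2 0 2 0x23145 (.cut 2 0 3 0x234156 (.cut 2 0 5 0x2345617 (.cut
    2 0 6 0x23456718 (.cut 2 0 8 0x234567891 (.cut 2 0 9 0x23456789a1 (.hit 2 0) 0x21a (.move 1
    (.move 1 (.hit 0 0)))) 0x219 (.cut 3 2 2 0x134 (.hit 3 2) 0x2314 (.move 2 (.move 1 (.hit 0
    0))))) 0x178 (.hit 3 0)) 0x167 (.move 1 (.hit 0 0))) 0x451 (.move 1 (.move 1 (.move 1 (.hit 0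
    0))))) 0x341 (.cut 3 1 2 0x214 (.hit 3 1) 0x1234 (.move 1 (.move 2 (.move 1 (.hit 0 0))))))

/-- The renormalization of `ℬ̃` for `τ = β²`. -/
def caseβSqFalse : BaseCase where
  range := .single ⟨2, -1⟩
  image := .single ⟨0, 0⟩
  kind := false
  kind' := true
  sim := ⟨false, 1, ⟨5, -3⟩, affine 0 0 0 0, affine (-1) 1 0 0⟩
  words := [word 2 12321, word 2 122211222112321, word 2 0]
  periodic := [
    ([affineCond 1 1 0 0 0, affineCond 3 1 0 0 0, affineCond 5 0 0 0 0, affineCond 7 1 (-1) 0 0,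
      affineCond 9 0 0 0 0], word 2 1),
    ([affineCond 0 1 0 0 0, affineCond 2 (-1) 2 0 0, affineCond 4 1 0 0 0, affineCond 6 (-1) 0 0 0,
      affineCond 8 (-1) 0 0 0], word 2 2),
    ([affineCond 1 1 0 0 0, affineCond 3 0 1 0 0, affineCond 7 0 (-1) 0 0], word 2 112),
    ([affineCond 1 1 0 0 0, affineCond 3 3 (-1) 0 0, affineCond 5 0 0 0 0, affineCond 7 2 (-2) 0 0,
      affineCond 9 1 (-1) 0 0], word 2 11222)]
  reach :=
    .cut 0 0 0 0x123 (.cut 0 0 1 0x214 (.hit 0 0) 0x1234 (.cut 3 1 2 0x145 (.hit 3 1) 0x23415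
    (.cut 4 1 1 0x23416 (.cut 4 1 4 0x21456 (.hit 4 1) 0x2341 (.move 0 (.move 1 (.move 2 (.move 1
    (.move 0 (.hit 0 0))))))) 0x1456 (.move 0 (.move 1 (.move 1 (.move 1 (.move 0 (.move 0 (.move
    1 (.move 2 (.move 1 (.move 0 (.hit 0 0)))))))))))))) 0x4213 (.cut 1 0 0 0x1345 (.cut 1 0 1
    0x21345 (.hit 1 0) 0x231 (.cut 3 0 2 0x231 (.hit 3 0) 0x2134 (.cut 4 0 1 0x2145 (.cut 4 0 3
    0x23415 (.cut 4 0 4 0x23451 (.hit 4 0) 0x2156 (.move 0 (.move 0 (.move 1 (.move 2 (.move 1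
    (.move 0 (.hit 0 0)))))))) 0x145 (.move 0 (.hit 0 0))) 0x2341 (.move 0 (.move 0 (.move 1
    (.move 1 (.move 1 (.move 0 (.move 0 (.move 1 (.move 2 (.move 1 (.move 0 (.hit 0
    0))))))))))))))) 0x2315 (.cut 2 0 0 0x12345 (.cut 2 0 2 0x23156 (.cut 2 0 4 0x23451 (.hit 2 0)
    0x2156 (.cut 4 2 1 0x1345 (.cut 4 2 3 0x23145 (.cut 4 2 4 0x23416 (.hit 4 2) 0x1456 (.move 1
    (.move 2 (.move 1 (.move 0 (.hit 0 0)))))) 0x134 (.move 1 (.cut 5 1 4 0x4123 (.move 1 (.move 1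
    (.move 0 (.move 0 (.move 1 (.move 1 (.move 1 (.move 0 (.move 0 (.move 1 (.move 2 (.move 1
    (.move 0 (.hit 0 0)))))))))))))) 0x421 (.move 2 (.move 1 (.move 0 (.hit 0 0))))))) 0x2315
    (.move 1 (.move 1 (.move 1 (.move 0 (.move 0 (.move 1 (.move 2 (.move 1 (.move 0 (.hit 0
    0)))))))))))) 0x3451 (.cut 4 3 1 0x2315 (.cut 4 3 3 0x12345 (.cut 4 3 4 0x21456 (.hit 4 3)
    0x2341 (.move 2 (.move 1 (.move 0 (.hit 0 0))))) 0x215 (.cut 5 1 4 0x2134 (.move 1 (.move 1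
    (.move 0 (.move 0 (.move 1 (.move 1 (.move 1 (.move 0 (.move 0 (.move 1 (.move 2 (.move 1
    (.move 0 (.hit 0 0)))))))))))))) 0x231 (.move 2 (.move 1 (.move 0 (.hit 0 0)))))) 0x1345
    (.move 1 (.move 1 (.move 0 (.move 0 (.move 1 (.move 2 (.move 1 (.move 0 (.hit 0 0)))))))))))
    0x215 (.cut 3 2 1 0x134 (.hit 3 2) 0x2314 (.cut 4 4 0 0x12345 (.cut 4 4 1 0x21456 (.cut 4 4 3
    0x23416 (.hit 4 4) 0x1456 (.move 1 (.move 0 (.move 0 (.move 1 (.move 1 (.move 1 (.move 0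
    (.move 0 (.move 1 (.move 2 (.move 1 (.move 0 (.hit 0 0)))))))))))))) 0x2341 (.move 1 (.move 0
    (.move 0 (.move 1 (.move 2 (.move 1 (.move 0 (.hit 0 0))))))))) 0x215 (.move 1 (.move 0 (.hit
    0 0)))))))

/-- The renormalization of `ℬ` for `τ = β`. -/
def caseβTrue : BaseCase where
  range := .single ⟨-1, 1⟩
  image := .single ⟨0, 0⟩
  kind := true
  kind' := true
  sim := ⟨false, 0, ⟨2, -1⟩, affine 0 0 0 0, affine 0 0 0 0⟩
  words := [word 2 1, word 2 232, word 2 0]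
  periodic := [
    ([affineCond 0 0 0 0 0, affineCond 2 (-1) 0 0 0, affineCond 4 0 0 0 0, affineCond 6 0 1 0 0,
      affineCond 8 0 1 0 0], word 2 2),
    ([affineCond 1 0 (-1) 0 0, affineCond 5 (-1) 1 0 0, affineCond 9 (-1) 1 0 0], word 2 3)]
  reach :=
    .cut 0 0 2 0x231 (.hit 0 0) 0x2134 (.cut 1 0 3 0x23415 (.cut 1 0 4 0x23451 (.hit 1 0) 0x2156
    (.move 2 (.move 1 (.hit 0 0)))) 0x145 (.cut 2 0 1 0x214 (.hit 2 0) 0x1234 (.move 1 (.hit 0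
    0))))

/-- The renormalization of `ℬ̃` for `τ = β`. -/
def caseβFalse : BaseCase where
  range := .single ⟨-1, 1⟩
  image := .single ⟨0, 0⟩
  kind := false
  kind' := true
  sim := ⟨true, 1, ⟨-3, 2⟩, affine (-1) 1 0 0, affine 1 0 0 0⟩
  words := [word 2 232, word 2 11232, word 2 0]
  periodic := [
    ([affineCond 1 (-1) 1 0 0, affineCond 3 (-1) 1 0 0, affineCond 5 0 0 0 0,
      affineCond 7 (-2) 1 0 0,
      affineCond 9 0 0 0 0], word 2 1),
    ([affineCond 0 1 0 0 0, affineCond 1 0 1 0 0, affineCond 2 2 0 0 0, affineCond 3 0 1 0 0,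
      affineCond 4 1 0 0 0, affineCond 5 0 0 0 0, affineCond 6 1 (-1) 0 0, affineCond 7 (-1) 0 0 0,
      affineCond 8 1 (-1) 0 0, affineCond 9 0 0 0 0], word 2 2),
    ([affineCond 1 (-1) 1 0 0, affineCond 3 1 0 0 0, affineCond 7 (-1) 0 0 0], word 2 11222)]
  reach :=
    .cut 0 0 0 0x123 (.cut 0 0 1 0x231 (.hit 0 0) 0x2134 (.cut 1 0 0 0x1345 (.cut 1 0 3 0x23415
    (.hit 1 0) 0x145 (.cut 3 1 2 0x134 (.hit 3 1) 0x2314 (.move 0 (.move 1 (.move 2 (.move 1 (.hit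
    0 0))))))) 0x2315 (.move 1 (.move 2 (.move 1 (.hit 0 0)))))) 0x4213 (.cut 2 0 0 0x12345 (.cut
    2 0 1 0x213456 (.cut 2 0 3 0x2341567 (.cut 2 0 4 0x23451678 (.cut 2 0 6 0x234567189 (.cut 2 0
    8 0x234567891a (.hit 2 0) 0x19a (.hit 3 2)) 0x178 (.hit 3 0)) 0x561 (.hit 3 3)) 0x451 (.move 2
    (.move 1 (.hit 0 0)))) 0x231 (.move 1 (.hit 0 0))) 0x215 (.cut 3 4 0 0x134 (.hit 3 4) 0x2314
    (.move 1 (.hit 0 0))))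
theorem check_caseLowerTrue : caseLowerTrue.check = true := by decide +kernel
theorem check_caseLowerFalse : caseLowerFalse.check = true := by decide +kernel
theorem check_caseZero : caseZero.check = true := by decide +kernel
theorem check_caseMiddleTrue : caseMiddleTrue.check = true := by decide +kernel
theorem check_caseMiddleFalse : caseMiddleFalse.check = true := by decide +kernel
theorem check_caseUpperTrue : caseUpperTrue.check = true := by decide +kernel
theorem check_caseUpperFalse : caseUpperFalse.check = true := by decide +kernel
theorem check_caseβSqTrue : caseβSqTrue.check = true := by decide +kernel
theorem check_caseβSqFalse : caseβSqFalse.check = true := by decide +kernel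
theorem check_caseβTrue : caseβTrue.check = true := by decide +kernel
theorem check_caseβFalse : caseβFalse.check = true := by decide +kernel

end

section

variable {l u l' u' : Zw} {τ τ' : ℝ}

/-- The affine function that maps `l` to `l'` and `u` to `u'` preserves the coordinates with respect
to the ends of the intervals. -/
theorem Verts.exists_point_interval (hl : l.val < τ) (hu : τ < u.val)
    (h : (τ' - l'.val) * (u.val - l.val) = (u'.val - l'.val) * (τ - l.val)) :
    ∃ p, Positive p ∧ (interval l u).point p = (1, τ, 0) ∧
      (interval l' u').point p = (1, τ', 0) := by
  have h0 : 0 < u.val - l.val := by linarith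
  have e0 : (⟨0, 0⟩ : Zw).val = 0 := by simp [Zw.val]
  have e1 : (⟨1, 0⟩ : Zw).val = 1 := by simp [Zw.val]
  refine ⟨((u.val - τ) / (u.val - l.val), (τ - l.val) / (u.val - l.val), 1),
    ⟨div_pos (by linarith) h0, div_pos (by linarith) h0, one_pos⟩, ?_, ?_⟩ <;>
  simp only [point, interval, Form.zero, Prod.mk.injEq, e0, e1] <;>
  refine ⟨?_, ?_, ?_⟩ <;> field_simp <;> linarith

theorem Verts.exists_point_single (hτ : l.val = τ) (hτ' : l'.val = τ') :
    ∃ p, Positive p ∧ (single l).point p = (1, τ, 0) ∧ (single l').point p = (1, τ', 0) := by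
  refine ⟨(1, 1, 1), ⟨one_pos, one_pos, one_pos⟩, ?_, ?_⟩ <;>
  simp [point, single, Form.zero, ← hτ, ← hτ', Zw.val]

theorem β_pos : 0 < β := by
  have := α_sq; have := α_pos; have hb : β = (α - 1) / 2 := rfl
  nlinarith

theorem β_lt_one : β < 1 := by
  have := ω_sq; have := ω_pos; rw [β_eq]
  nlinarith

theorem β_sq_lt : β ^ 2 < β := by
  have := β_pos; have := β_lt_one; nlinarith

theorem renormalizableVia_base : DressedDomain.RenormalizableVia base baseParam baseRenorm := by
  have hω := ω_sq
  have h0 := β_pos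
  have h1 := β_lt_one
  have h2 := β_sq_lt
  have hω0 := ω_pos
  have hb := β_eq
  have hb2 := β_sq
  have hω3 := ω_pow_three
  rintro ⟨kind, τ⟩ hτ
  have hzero : (true, (0 : ℝ)) ∈ baseParam := Or.inr rfl
  rcases hτ with ⟨hτ0, hτ1⟩ | hτ
  · simp only at hτ0 hτ1
    rcases lt_trichotomy τ (β ^ 2) with hlt | rfl | hgt
    · have hr : baseRenorm (kind, τ) = (kind, ω ^ 2 * τ) := if_pos ⟨hτ0, hlt⟩
      rw [hr]
      obtain ⟨p, hp, hp1, hp2⟩ := Verts.exists_point_interval (l := ⟨0, 0⟩) (u := ⟨2, -1⟩)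
        (l' := ⟨0, 0⟩) (u' := ⟨1, 0⟩) (τ := τ) (τ' := ω ^ 2 * τ) (by simpa [Zw.val] using hτ0)
        (by simp [Zw.val]; linarith) (by simp [Zw.val]; grind)
      refine ⟨Or.inl ⟨by positivity, ?_⟩, ?_⟩
      · have : ω ^ 2 * τ < ω ^ 2 * β ^ 2 := by gcongr
        have h : ω ^ 2 * β ^ 2 = 1 := by grind
        simpa only [h] using this
      · cases kind
        · exact BaseCase.sound check_caseLowerFalse hp hp1 hp2
        · exact BaseCase.sound check_caseLowerTrue hp hp1 hp2
    · have hr : baseRenorm (kind, β ^ 2) = (true, 0) := by simp [baseRenorm, h2.not_gt]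
      rw [hr]
      refine ⟨hzero, ?_⟩
      obtain ⟨p, hp, hp1, hp2⟩ := Verts.exists_point_single (l := ⟨2, -1⟩)
        (l' := ⟨0, 0⟩) (τ := β ^ 2) (τ' := 0) (by simp [Zw.val]; linarith)
        (by simp [Zw.val])
      cases kind
      · exact BaseCase.sound check_caseβSqFalse hp hp1 hp2
      · exact BaseCase.sound check_caseβSqTrue hp hp1 hp2
    rcases lt_trichotomy τ β with hlt | rfl | hgt'
    · have hr : baseRenorm (kind, τ) = (!kind, ω ^ 3 * (β - τ)) := by
        simp [baseRenorm, hgt, hlt, hgt.not_gt]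
      rw [hr]
      obtain ⟨p, hp, hp1, hp2⟩ := Verts.exists_point_interval (l := ⟨2, -1⟩) (u := ⟨-1, 1⟩)
        (l' := ⟨1, 0⟩) (u' := ⟨0, 0⟩) (τ := τ) (τ' := ω ^ 3 * (β - τ)) (by simp [Zw.val]; linarith)
        (by simp [Zw.val]; linarith) (by simp [Zw.val]; grind)
      refine ⟨Or.inl ⟨mul_pos (by positivity) (by simpa using hlt), ?_⟩, ?_⟩
      · have : ω ^ 3 * (β - τ) < ω ^ 3 * (β - β ^ 2) := by gcongr
        have h : ω ^ 3 * (β - β ^ 2) = 1 := by grind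
        simpa only [h] using this
      · cases kind
        · exact BaseCase.sound check_caseMiddleFalse hp hp1 hp2
        · exact BaseCase.sound check_caseMiddleTrue hp hp1 hp2
    · have hr : baseRenorm (kind, β) = (true, 0) := by simp [baseRenorm, h2.not_gt]
      rw [hr]
      refine ⟨hzero, ?_⟩
      obtain ⟨p, hp, hp1, hp2⟩ := Verts.exists_point_single (l := ⟨-1, 1⟩)
        (l' := ⟨0, 0⟩) (τ := β) (τ' := 0) (by simp [Zw.val]; linarith)
        (by simp [Zw.val])
      cases kind
      · exact BaseCase.sound check_caseβFalse hp hp1 hp2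
      · exact BaseCase.sound check_caseβTrue hp hp1 hp2
    · have hr : baseRenorm (kind, τ) = (!kind, ω ^ 2 * (1 - τ)) := by
        simp [baseRenorm, hgt', hτ1, hgt.not_gt, hgt'.not_gt]
      rw [hr]
      obtain ⟨p, hp, hp1, hp2⟩ := Verts.exists_point_interval (l := ⟨-1, 1⟩) (u := ⟨1, 0⟩)
        (l' := ⟨1, 0⟩) (u' := ⟨0, 0⟩) (τ := τ) (τ' := ω ^ 2 * (1 - τ)) (by simp [Zw.val]; linarith)
        (by simp [Zw.val]; linarith) (by simp [Zw.val]; grind)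
      refine ⟨Or.inl ⟨mul_pos (by positivity) (by simpa using hτ1), ?_⟩, ?_⟩
      · have : ω ^ 2 * (1 - τ) < ω ^ 2 * (1 - β) := by gcongr
        have h : ω ^ 2 * (1 - β) = 1 := by grind
        simpa only [h] using this
      · cases kind
        · exact BaseCase.sound check_caseUpperFalse hp hp1 hp2
        · exact BaseCase.sound check_caseUpperTrue hp hp1 hp2
  · obtain ⟨rfl, rfl⟩ : kind = true ∧ τ = 0 := by simpa using hτ
    have hr : baseRenorm (true, 0) = (true, 0) := by
      simp [baseRenorm, h0.not_gt, (sq_nonneg β).not_gt]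
    rw [hr]
    refine ⟨hzero, ?_⟩
    obtain ⟨p, hp, hp1, hp2⟩ := Verts.exists_point_single (l := ⟨0, 0⟩)
      (l' := ⟨0, 0⟩) (τ := 0) (τ' := 0) (by simp [Zw.val]) (by simp [Zw.val])
    exact BaseCase.sound check_caseZero hp hp1 hp2

end

section

/-! ### The induced domain `𝒞` as a base triangle -/

variable {p : ℝ × ℝ × ℝ} {s t : ℝ} {m n : ℕ}

/-- The two sets of data define the same domains. -/
def CSys.equivB (S S' : CSys) : Bool :=
  (fun T U : CTile => T.subsetB U && U.subsetB T) S.dom S'.dom &&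
    Nat.beq S.parts.length S'.parts.length &&
    (S.parts.zip S'.parts).all fun c =>
      c.1.1.subsetB c.2.1 && c.2.1.subsetB c.1.1 && c.1.2.eqB c.2.2

theorem CSys.Models.isImage {S S' : CSys} {X Y Z : DressedDomain n} {G : Similarity}
    (h : S.Models p Y) (h' : S'.Models p Z) (hp : Positive p) (he : S.equivB S' = true)
    (hG : DressedDomain.IsImage G X Y) : DressedDomain.IsImage G X Z := by
  simp only [equivB, Bool.and_eq_true, List.all_eq_true] at he
  obtain ⟨⟨hd, -⟩, hparts⟩ := he
  have hset : ∀ {T U : CTile}, T.subsetB U = true → U.subsetB T = true → U.set p = T.set p :=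
    fun h1 h2 => Subset.antisymm (CTile.subset_of_subsetB hp h2) (CTile.subset_of_subsetB hp h1)
  refine ⟨?_, fun k => ?_⟩
  · rw [h'.dom, hset hd.1 hd.2, ← h.dom, hG.1]
  · have hmem : ((S.atom k, S.iso k), (S'.atom k, S'.iso k)) ∈ S.parts.zip S'.parts := by
      rw [← h.getElem k, ← h'.getElem k, ← List.getElem_zip (h := by simp [h.length, h'.length])]
      exact List.getElem_mem _
    obtain ⟨⟨h1, h2⟩, h3⟩ := hparts _ hmem
    refine ⟨?_, fun x => ?_⟩
    · rw [h'.atom, hset h1 h2, ← h.atom, (hG.2 k).1]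
    · rw [h'.iso, ← CIso.apply_eq h3, ← h.iso, (hG.2 k).2]

/-- The parameter `(1, τ, 0)` with `τ = ω⁷ (√5 s + β³)`, as a function of `(1, s, t)`. -/
def shapeVerts : Verts := ⟨⟨⟨1, 0⟩, ⟨2, 3⟩, ⟨0, 0⟩⟩, ⟨⟨0, 0⟩, ⟨18, 29⟩, ⟨0, 0⟩⟩, Form.zero⟩

theorem shapeVerts_point (s t : ℝ) :
    shapeVerts.point (1, s, t) = (1, ω ^ 7 * (α * s + β ^ 3), 0) := by
  have h := ω_sq
  have h7 : ω ^ 7 = 8 + 13 * ω := by grind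
  simp only [Verts.point, shapeVerts, Form.zero, Zw.val, β_pow_three, α_eq, h7, Prod.mk.injEq]
  push_cast
  refine ⟨?_, ?_, ?_⟩ <;> grind


/-- The similarity from the base triangle to `C`: its scale is `β⁷`, and its translation vector
`(1 - s, -2 ω s)` is the image of the origin, the common vertex of `B` and `B₁`. -/
def simC : CSim :=
  ⟨false, 0, ⟨-21, 13⟩, ⟨⟨⟨1, 0⟩, ⟨-1, 0⟩, ⟨0, 0⟩⟩, ⟨⟨0, 0⟩, ⟨0, -2⟩, ⟨0, 0⟩⟩⟩⟩

theorem equivC : (((baseSys.atVerts shapeVerts).scaleImage simC).atVerts triangleVerts).equivB vC =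
    true := by decide +kernel

theorem similar_domC (hst : (s, t) ∈ paramTriangle) :
    DressedDomain.Similar (base (true, ω ^ 7 * (α * s + β ^ 3))) (domC s t) := by
  obtain ⟨p, hp, h⟩ := exists_positive_of_mem hst
  have hbase : (baseSys.atVerts shapeVerts).Models (triangleVerts.point p)
      (base (true, ω ^ 7 * (α * s + β ^ 3))) := by
    rw [h]
    exact CSys.Models.atVerts (shapeVerts_point s t ▸ models_base true _)
  obtain ⟨Y, hY, hYm⟩ := hbase.scaleImage (G := simC) (Zw.val_pos (by decide))
  exact ⟨_, hYm.atVerts.isImage (models_vC hp h) hp equivC hY⟩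

/-! ### The shape parameter -/

theorem width_of_eq_Ico {m : Fin 5} {S : Set Plane} {a b : ℝ} (h : dotU m '' S = Ico a b)
    (hab : a < b) : width m S = b - a := by
  rw [width, h, csSup_Ico hab, csInf_Ico hab]

theorem mem_dom_C {x : Plane} : x ∈ (domC s t).dom ↔
    -x.1 + β * x.2 < -1 - s ∧ β ^ 4 - s ≤ x.2 ∧ x.1 < 1 - s := by
  simp [domC, domA, tile, Tile.carrier, dotU]

theorem mem_atom_C (hst : (s, t) ∈ paramTriangle) {x : Plane} : x ∈ (domC s t).atom 2 ↔
    x.1 < 1 - s ∧ α * β ^ 4 - s ≤ β * x.1 - x.2 ∧ β ^ 4 - s ≤ x.2 := by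
  obtain ⟨p, hp, h⟩ := exists_positive_of_mem hst
  have he : (domC s t).atom 2 = (sysC.atom 2).set (1, s, t) := by
    rw [(models_vC hp h).atom, ← h, ← CTile.set_atVerts]
    rfl
  rw [he, β_pow_four, α_mul_β_pow_four]
  simp only [sysC, CSys.atom, CTile.set, cond, Cond.Holds, nd, Form.eval, Zw.val,
    List.getD_cons_succ,
    List.getD_cons_zero, mem_ofPred_eq, List.forall_mem_cons]
  norm_num
  grind

/-- The triangle `C` reaches from its side on the line `u₁ · x = β⁴ - s` to its apex. -/
theorem dotU_image_dom_C (s t : ℝ) :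
    dotU 1 '' (domC s t).dom = Ico (β ^ 4 - s) (-2 * ω * s) := by
  have h0 := ω_pos
  have h2 : ω * β = 1 := by have := ω_sq; rw [β_eq]; grind
  ext y
  simp only [mem_image, mem_dom_C, mem_Ico]
  constructor
  · rintro ⟨x, ⟨h3, h4, h5⟩, rfl⟩
    refine ⟨h4, ?_⟩
    have : ω * (-x.1 + β * x.2 + x.1) < ω * (-1 - s + (1 - s)) :=
      mul_lt_mul_of_pos_left (by linarith) h0
    change x.2 < _
    linear_combination this - x.2 * h2
  · rintro ⟨h3, h4⟩
    have h5 : β * y < -2 * s := by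
      have := mul_lt_mul_of_pos_left h4 β_pos
      linear_combination this - 2 * s * h2
    exact ⟨((1 + s + β * y + (1 - s)) / 2, y), ⟨by linarith, h3, by linarith⟩, rfl⟩

/-- The triangle `C₃` reaches from its apex to its side on the line `u₀ · x = 1 - s`. -/
theorem dotU_image_atom_C (hst : (s, t) ∈ paramTriangle) :
    dotU 0 '' (domC s t).atom 2 = Ico (2 * β ^ 2 - 2 * ω * s) (1 - s) := by
  have h0 := ω_pos
  have h2 : ω * β = 1 := by have := ω_sq; rw [β_eq]; grind
  have h3 : α * β ^ 4 + β ^ 4 = 2 * β ^ 3 := by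
    rw [β_pow_four, α_mul_β_pow_four, β_pow_three]; ring
  ext y
  simp only [mem_image, mem_atom_C hst, mem_Ico]
  constructor
  · rintro ⟨x, ⟨h4, h5, h6⟩, rfl⟩
    refine ⟨?_, h4⟩
    have : ω * (2 * β ^ 3 - 2 * s) ≤ ω * (β * x.1) :=
      mul_le_mul_of_nonneg_left (by linarith) h0.le
    change _ ≤ x.1
    linear_combination this + (x.1 - 2 * β ^ 2) * h2
  · rintro ⟨h4, h5⟩
    have h6 : 2 * β ^ 3 - 2 * s ≤ β * y := by
      have := mul_le_mul_of_nonneg_left h4 β_pos.le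
      linear_combination this + 2 * s * h2
    exact ⟨(y, β ^ 4 - s), ⟨h5, by linarith, le_rfl⟩, rfl⟩

theorem bounds_of_mem (hst : (s, t) ∈ paramTriangle) :
    0 < α * s + β ^ 3 ∧ α * s + β ^ 3 < β ^ 7 := by
  have h5 := α_sq
  have h0 := α_pos
  have h2 := ω_sq
  obtain ⟨h1, h3, h4⟩ := mem_paramTriangle_iff.1 hst
  have hub : α < 2.2361 := by nlinarith
  have hlb : 2.236 < α := by nlinarith
  have hinv : 2 / α = 2 * α / 5 := by field_simp; linarith
  have hω : ω = (α + 1) / 2 := rfl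
  have h7 : β ^ 7 = 13 * ω - 21 := by rw [β_eq]; grind
  rw [β_pow_three, h7, hω]
  rw [hinv, show β = (α - 1) / 2 from rfl] at h4
  have h6 : -1 + 2 * α / 5 < s := by nlinarith
  constructor <;> nlinarith

theorem shapeC_eq (hst : (s, t) ∈ paramTriangle) : shapeC s t = ω ^ 7 * (α * s + β ^ 3) := by
  have h2 := ω_sq
  obtain ⟨h1, h3⟩ := bounds_of_mem hst
  have hβ := β_pos
  have h7 : β ^ 7 < β ^ 5 := pow_lt_pow_right_of_lt_one₀ hβ β_lt_one (by norm_num)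
  have e3 := β_pow_three
  have e4 := β_pow_four
  have e5 := β_pow_five
  have eβ := β_eq
  have eα := α_eq
  have w0 : width 0 ((domC s t).atom 2) = α * s + β ^ 3 := by
    have he : 1 - s - (2 * β ^ 2 - 2 * ω * s) = α * s + β ^ 3 := by
      rw [e3, β_sq, eα]; ring
    rw [width_of_eq_Ico (dotU_image_atom_C hst) (by linarith), he]
  have w1 : width 1 (domC s t).dom = -(α * s) - β ^ 4 := by
    have he : -2 * ω * s - (β ^ 4 - s) = -(α * s) - β ^ 4 := by rw [eα]; ring
    rw [width_of_eq_Ico (dotU_image_dom_C s t) (by linarith), he]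
  have hsum : -(α * s) - β ^ 4 + (α * s + β ^ 3) = β ^ 5 := by linarith
  have hω : ω ^ 7 * β ^ 5 = ω ^ 2 := by
    have : ω * β = 1 := by rw [eβ]; linarith
    linear_combination ω ^ 2 * ((ω * β) ^ 4 + (ω * β) ^ 3 + (ω * β) ^ 2 + ω * β + 1) * this
  have hd : 0 < -(α * s) - β ^ 4 := by linarith
  have hne := hd.ne'
  have hβ5 : (0 : ℝ) < β ^ 5 := by positivity
  simp only [shapeC, w0, w1]
  rw [one_add_div hne, hsum, ← mul_div_assoc, div_div_div_cancel_right₀ hne, div_eq_iff hβ5.ne',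
    ← hω]
  ring

theorem shapeC_mem (hst : (s, t) ∈ paramTriangle) : 0 < shapeC s t ∧ shapeC s t < 1 := by
  obtain ⟨h1, h3⟩ := bounds_of_mem hst
  have h0 := ω_pos
  rw [shapeC_eq hst]
  have hω : ω ^ 7 * β ^ 7 = 1 := by
    rw [← mul_pow, show ω * β = 1 by rw [β_eq]; linear_combination ω_sq, one_pow]
  exact ⟨by positivity, hω ▸ mul_lt_mul_of_pos_left h3 (by positivity)⟩

end

section

/-! ### Eventually periodic parameters -/

namespace QSqrt5

theorem add_mem {x y : ℝ} (hx : x ∈ QSqrt5) (hy : y ∈ QSqrt5) : x + y ∈ QSqrt5 := by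
  obtain ⟨a, b, rfl⟩ := hx
  obtain ⟨c, d, rfl⟩ := hy
  exact ⟨a + c, b + d, by push_cast; ring⟩

theorem mul_mem {x y : ℝ} (hx : x ∈ QSqrt5) (hy : y ∈ QSqrt5) : x * y ∈ QSqrt5 := by
  obtain ⟨a, b, rfl⟩ := hx
  obtain ⟨c, d, rfl⟩ := hy
  refine ⟨a * c + 5 * b * d, a * d + b * c, ?_⟩
  push_cast
  linear_combination b * d * α_sq

theorem neg_mem {x : ℝ} (hx : x ∈ QSqrt5) : -x ∈ QSqrt5 := by
  obtain ⟨a, b, rfl⟩ := hx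
  exact ⟨-a, -b, by push_cast; ring⟩

theorem sub_mem {x y : ℝ} (hx : x ∈ QSqrt5) (hy : y ∈ QSqrt5) : x - y ∈ QSqrt5 :=
  sub_eq_add_neg x y ▸ add_mem hx (neg_mem hy)

theorem rat_mem (a : ℚ) : (a : ℝ) ∈ QSqrt5 := ⟨a, 0, by simp⟩

theorem inv_mem {x : ℝ} (hx : x ∈ QSqrt5) : x⁻¹ ∈ QSqrt5 := by
  obtain ⟨a, b, rfl⟩ := hx
  by_cases h0 : (a + b * α : ℝ) = 0
  · rw [h0, inv_zero]
    exact ⟨0, 0, by simp⟩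
  have h : ((a + b * α) * (a - b * α) : ℝ) = ((a ^ 2 - 5 * b ^ 2 : ℚ) : ℝ) := by
    push_cast
    linear_combination (-b ^ 2 : ℝ) * α_sq
  by_cases h1 : a ^ 2 - 5 * b ^ 2 = 0
  · rw [h1, Rat.cast_zero] at h
    have h2 : (a + b * α : ℝ) = ((2 * a : ℚ) : ℝ) := by
      push_cast
      linarith [(mul_eq_zero.1 h).resolve_left h0]
    rw [h2, ← Rat.cast_inv]
    exact rat_mem _
  · have h2 : (a + b * α : ℝ)⁻¹ = (a - b * α) * (((a ^ 2 - 5 * b ^ 2)⁻¹ : ℚ) : ℝ) := by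
      rw [Rat.cast_inv, ← h]
      have : (a - b * α : ℝ) ≠ 0 := by
        intro h3
        rw [h3, mul_zero] at h
        exact h1 (by exact_mod_cast h.symm)
      field_simp
    rw [h2]
    exact mul_mem (sub_mem (rat_mem a) (mul_mem (rat_mem b) ⟨0, 1, by simp⟩)) (rat_mem _)

theorem β_mem : β ∈ QSqrt5 := ⟨-1 / 2, 1 / 2, by rw [β]; push_cast; ring⟩

theorem ω_mem : ω ∈ QSqrt5 := ⟨1 / 2, 1 / 2, by rw [ω]; push_cast; ring⟩

theorem pow_mem {x : ℝ} (hx : x ∈ QSqrt5) (n : ℕ) : x ^ n ∈ QSqrt5 := by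
  induction n with
  | zero => simpa using rat_mem 1
  | succ n ih => exact pow_succ x n ▸ mul_mem ih hx

end QSqrt5

open QSqrt5

/-- The branches of the renormalization function are affine, with coefficients in `ℚ(√5)`, and
expanding, apart from the four values with image zero. -/
theorem baseRenorm_affine {q : Bool × ℝ} (hq : q ∈ baseParam) :
    (baseRenorm q).2 = 0 ∧ q.2 ∈ QSqrt5 ∨ ∃ A ∈ QSqrt5, ∃ B ∈ QSqrt5, 1 < |A| ∧
      (baseRenorm q).2 = A * q.2 + B := by
  have hω2 := pow_mem ω_mem 2
  have hω3 := pow_mem ω_mem 3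
  have h1 : 1 < ω := by have := ω_sq; have := ω_pos; nlinarith
  have h2 : 1 < |ω ^ 2| := by rw [abs_pow, abs_of_pos ω_pos]; exact one_lt_pow₀ h1 (by norm_num)
  have h3 : 1 < |ω ^ 3| := by rw [abs_pow, abs_of_pos ω_pos]; exact one_lt_pow₀ h1 (by norm_num)
  unfold baseRenorm
  split_ifs with h4 h5 h6
  · exact Or.inr ⟨_, hω2, 0, by simpa using rat_mem 0, h2, by simp⟩
  · exact Or.inr ⟨_, neg_mem hω3, _, mul_mem hω3 β_mem, by rwa [abs_neg], by simp only; ring⟩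
  · exact Or.inr ⟨_, neg_mem hω2, _, hω2, by rwa [abs_neg], by simp only; ring⟩
  · refine Or.inl ⟨rfl, ?_⟩
    rcases hq with hq | rfl
    · have h7 : q.2 = β ^ 2 ∨ q.2 = β := by
        by_contra! h7
        rcases lt_or_gt_of_ne h7.1 with h8 | h8
        · exact h4 ⟨hq.1, h8⟩
        · rcases lt_or_gt_of_ne h7.2 with h9 | h9
          · exact h5 ⟨h8, h9⟩
          · exact h6 ⟨h9, hq.2⟩
      rcases h7 with h7 | h7 <;> rw [h7]
      · exact pow_mem β_mem 2
      · exact β_mem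
    · simpa using rat_mem 0

theorem iterate_baseRenorm_mem {q : Bool × ℝ} (hq : q ∈ baseParam) (k : ℕ) :
    baseRenorm^[k] q ∈ baseParam := by
  induction k with
  | zero => exact hq
  | succ k ih => exact Function.iterate_succ_apply' baseRenorm k q ▸ (renormalizableVia_base _ ih).1

theorem mem_of_iterate_baseRenorm_mem (k : ℕ) {q : Bool × ℝ} (hq : q ∈ baseParam)
    (h : (baseRenorm^[k] q).2 ∈ QSqrt5) : q.2 ∈ QSqrt5 := by
  induction k generalizing q with
  | zero => exact h
  | succ k ih =>
    have hr := ih (renormalizableVia_base q hq).1 h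
    rcases baseRenorm_affine hq with ⟨-, h0⟩ | ⟨A, hA, B, hB, hlt, he⟩
    · exact h0
    · have hA0 : A ≠ 0 := by rintro rfl; norm_num at hlt
      have : q.2 = ((baseRenorm q).2 - B) * A⁻¹ := by rw [he]; field_simp; ring
      rw [this]
      exact mul_mem (sub_mem hr hB) (inv_mem hA)

/-- The iterates of the renormalization function are affine and expanding along an orbit, unless
the parameter is in `ℚ(√5)`. -/
theorem iterate_baseRenorm_affine {q : Bool × ℝ} (hq : q ∈ baseParam) (k : ℕ) :
    q.2 ∈ QSqrt5 ∨ ∃ A ∈ QSqrt5, ∃ B ∈ QSqrt5, 1 < |A| ∧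
      (baseRenorm^[k + 1] q).2 = A * q.2 + B := by
  induction k with
  | zero => exact (baseRenorm_affine hq).imp_left And.right
  | succ k ih =>
    rcases ih with h | ⟨A, hA, B, hB, hlt, he⟩
    · exact Or.inl h
    rcases baseRenorm_affine (iterate_baseRenorm_mem hq (k + 1)) with
      ⟨-, h⟩ | ⟨A', hA', B', hB', hlt', he'⟩
    · exact Or.inl (mem_of_iterate_baseRenorm_mem _ hq h)
    · refine Or.inr ⟨A' * A, mul_mem hA' hA, A' * B + B', add_mem (mul_mem hA' hB) hB', ?_, ?_⟩
      · rw [abs_mul]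
        exact one_lt_mul_of_lt_of_le hlt' hlt.le
      · rw [Function.iterate_succ_apply', he', he]
        ring

/-- A periodic parameter is the fixed point of an affine function over `ℚ(√5)`. -/
theorem mem_of_mem_periodicPts {q : Bool × ℝ} (hq : q ∈ baseParam) {k : ℕ}
    (h : baseRenorm^[k] q ∈ Function.periodicPts baseRenorm) : q.2 ∈ QSqrt5 := by
  refine mem_of_iterate_baseRenorm_mem k hq ?_
  obtain ⟨n, hn, hper⟩ := h
  rcases iterate_baseRenorm_affine (iterate_baseRenorm_mem hq k) (n - 1) with
    h | ⟨A, hA, B, hB, hlt, he⟩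
  · exact h
  rw [Nat.sub_add_cancel hn, hper.eq] at he
  have hA1 : 1 - A ≠ 0 := by
    intro h
    rw [show A = 1 by linarith, abs_one] at hlt
    exact lt_irrefl _ hlt
  have : (baseRenorm^[k] q).2 = B * (1 - A)⁻¹ := by
    rw [eq_mul_inv_iff_mul_eq₀ hA1]
    linarith
  rw [this]
  exact mul_mem hB (inv_mem (sub_mem (by simpa using rat_mem 1) hA))

/-- The value of the algebraic conjugate. -/
noncomputable def Zw.conjVal (z : Zw) : ℝ := z.a - z.b * β

theorem Zw.conjVal_mulω (z : Zw) : z.mulω.conjVal = -β * z.conjVal := by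
  have := β_sq
  have := β_eq
  simp only [conjVal, mulω]
  push_cast
  grind

theorem Zw.conjVal_sub (z w : Zw) : (z.sub w).conjVal = z.conjVal - w.conjVal := by
  simp only [conjVal, sub]
  push_cast
  ring

/-- The parameters with denominator `N`, whose conjugates are at most `C / N`. -/
def boundedParam (N : ℕ) (C : ℝ) : Set (Bool × ℝ) :=
  {q ∈ baseParam | ∃ z : Zw, q.2 = z.val / N ∧ |z.conjVal| ≤ C}

/-- An element of `ℤ[ω]` is determined up to finitely many possibilities by bounds on its value and
on its conjugate. -/
theorem finite_boundedParam {N : ℕ} (hN : 0 < N) (C : ℝ) : (boundedParam N C).Finite := by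
  have hβ := β_pos
  have hβ1 := β_lt_one
  have hω := β_eq
  have hN' : (0 : ℝ) < N := by exact_mod_cast hN
  set D : ℤ := ⌈N + C⌉ with hD
  have hfin : ((univ : Set Bool) ×ˢ (Icc (-(2 * D)) (2 * D) ×ˢ Icc (-D) D)).Finite :=
    finite_univ.prod ((finite_Icc _ _).prod (finite_Icc _ _))
  refine (hfin.image fun c : Bool × ℤ × ℤ => (c.1, (c.2.1 + c.2.2 * ω) / N)).subset ?_
  rintro ⟨k, τ⟩ ⟨hq, z, hz, hC⟩
  simp only at hz
  have hτ : 0 ≤ τ ∧ τ < 1 := by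
    rcases hq with hq | hq
    · exact ⟨hq.1.le, hq.2⟩
    · obtain ⟨-, rfl⟩ : k = true ∧ τ = 0 := by simpa using hq
      exact ⟨le_rfl, one_pos⟩
  rw [hz, div_lt_one hN'] at hτ
  have h0 := nonneg_of_mul_nonneg_left (by simpa [div_eq_mul_inv] using hτ.1) (inv_pos.2 hN')
  rw [abs_le] at hC
  simp only [Zw.val, Zw.conjVal] at h0 hτ hC
  have hDC := Int.le_ceil (N + C : ℝ)
  rw [← hD] at hDC
  have hb : |(z.b : ℝ)| ≤ D := by
    -- The difference of the value and of the conjugate is `√5 b`.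
    have h1 : z.b * (1 + 2 * β) ≤ N + C := by nlinarith
    have h2 : -(N + C) ≤ z.b * (1 + 2 * β) := by nlinarith
    rw [abs_le]
    constructor <;> nlinarith
  rw [abs_le] at hb
  have ha : |(z.a : ℝ)| ≤ 2 * D := by
    rw [abs_le]
    constructor <;> nlinarith
  rw [abs_le] at ha
  refine ⟨(k, z.a, z.b), ⟨mem_univ _, ⟨?_, ?_⟩, ⟨?_, ?_⟩⟩, by simp [hz, Zw.val]⟩ <;>
  · simp only
    first | exact_mod_cast ha.1 | exact_mod_cast ha.2 | exact_mod_cast hb.1 | exact_mod_cast hb.2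

/-- The conjugates of the slopes of the renormalization function are contracting. -/
theorem baseRenorm_mem_boundedParam {N : ℕ} (hN : 0 < N) {C : ℝ} (hC : N ≤ C) {q : Bool × ℝ}
    (hq : q ∈ boundedParam N C) : baseRenorm q ∈ boundedParam N C := by
  have hβ := β_pos
  have hβ1 := β_lt_one
  have hβ2 : β ^ 2 = 1 - β := by rw [β_sq, β_eq]; ring
  have hhalf : 1 / 2 < β := by nlinarith
  have hω := β_eq
  have hN' : (0 : ℝ) < N := by exact_mod_cast hN
  obtain ⟨hq, z, hz, hzC⟩ := hq
  refine ⟨(renormalizableVia_base q hq).1, ?_⟩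
  unfold baseRenorm
  split_ifs
  · refine ⟨z.mulω.mulω, ?_, ?_⟩
    · simp only [Zw.val_mulω, hz]; ring
    · simp only [Zw.conjVal_mulω, abs_mul, abs_neg, abs_of_pos hβ]
      have h1 : β * |z.conjVal| ≤ C := by nlinarith [abs_nonneg z.conjVal]
      nlinarith [abs_nonneg z.conjVal]
  · refine ⟨((⟨-N, N⟩ : Zw).sub z).mulω.mulω.mulω, ?_, ?_⟩
    · simp only [Zw.val_mulω, Zw.val_sub, hz]
      simp only [Zw.val]
      push_cast
      field_simp
      rw [hω]
      ring
    · have he : ((⟨-N, N⟩ : Zw).sub z).mulω.mulω.mulω.conjVal = β ^ 2 * N + β ^ 3 * z.conjVal := by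
        simp only [Zw.conjVal_mulω, Zw.conjVal_sub]
        simp only [Zw.conjVal]
        push_cast
        linear_combination (β ^ 2 * N : ℝ) * hβ2
      have h3 : β ^ 3 * |z.conjVal| ≤ β ^ 3 * C := by gcongr
      have h2 : β ^ 2 * N ≤ β ^ 2 * C := by gcongr
      have h1 : β ^ 2 * C + β ^ 3 * C ≤ C := by
        have : β ^ 2 * C + β ^ 3 * C = β * C := by linear_combination (β * C) * hβ2
        nlinarith
      rw [he]
      refine (abs_add_le _ _).trans ?_
      rw [abs_mul, abs_mul, abs_of_pos (pow_pos hβ 2), abs_of_pos (pow_pos hβ 3), abs_of_pos hN']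
      linarith
  · refine ⟨((⟨N, 0⟩ : Zw).sub z).mulω.mulω, ?_, ?_⟩
    · simp only [Zw.val_mulω, Zw.val_sub, hz]
      simp only [Zw.val]
      push_cast
      field_simp
      ring
    · have he : ((⟨N, 0⟩ : Zw).sub z).mulω.mulω.conjVal = β ^ 2 * (N - z.conjVal) := by
        simp only [Zw.conjVal_mulω, Zw.conjVal_sub]
        simp only [Zw.conjVal]
        push_cast
        ring
      have h1 : |(N : ℝ) - z.conjVal| ≤ N + C :=
        (abs_sub _ _).trans (by rw [abs_of_pos hN']; linarith)
      have h2 : β ^ 2 * |(N : ℝ) - z.conjVal| ≤ β ^ 2 * (C + C) := by gcongr; linarith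
      rw [he, abs_mul, abs_of_pos (pow_pos hβ 2)]
      nlinarith
  · refine ⟨⟨0, 0⟩, by simp [Zw.val], ?_⟩
    simp only [Zw.conjVal]
    simpa using hN'.le.trans hC

theorem exists_mem_boundedParam {q : Bool × ℝ} (hq : q ∈ baseParam) (h : q.2 ∈ QSqrt5) :
    ∃ N : ℕ, 0 < N ∧ ∃ C : ℝ, N ≤ C ∧ q ∈ boundedParam N C := by
  obtain ⟨x, y, h⟩ := h
  refine ⟨x.den * y.den, Nat.mul_pos x.den_pos y.den_pos, ?_⟩
  set z : Zw := ⟨x.num * y.den - y.num * x.den, 2 * y.num * x.den⟩ with hz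
  refine ⟨max _ |z.conjVal|, le_max_left _ _, hq, z, ?_, le_max_right _ _⟩
  have hx : (x.den : ℝ) ≠ 0 := by exact_mod_cast x.den_nz
  have hy : (y.den : ℝ) ≠ 0 := by exact_mod_cast y.den_nz
  rw [h, Rat.cast_def x, Rat.cast_def y, α_eq, hz, Zw.val]
  push_cast
  field_simp
  ring

/-- A parameter is eventually periodic under the renormalization function if and only if it belongs
to `ℚ(√5)`. -/
theorem eventually_periodic_iff {q : Bool × ℝ} (hq : q ∈ baseParam) :
    (∃ k, baseRenorm^[k] q ∈ Function.periodicPts baseRenorm) ↔ q.2 ∈ QSqrt5 := by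
  refine ⟨fun ⟨k, hk⟩ => mem_of_mem_periodicPts hq hk, fun h => ?_⟩
  obtain ⟨N, hN, C, hC, hqC⟩ := exists_mem_boundedParam hq h
  have hmem : ∀ k, baseRenorm^[k] q ∈ boundedParam N C := by
    intro k
    induction k with
    | zero => exact hqC
    | succ k ih =>
      exact Function.iterate_succ_apply' baseRenorm k q ▸ baseRenorm_mem_boundedParam hN hC ih
  obtain ⟨i, j, hij, he⟩ := (finite_boundedParam hN C).exists_lt_map_eq_of_forall_mem hmem
  refine ⟨i, Function.mk_mem_periodicPts (n := j - i) (by lia) ?_⟩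
  rw [Function.IsPeriodicPt, Function.IsFixedPt, ← Function.iterate_add_apply,
    Nat.sub_add_cancel hij.le]
  exact he.symm

end

section

/-! ### Self-similarity of the rhombus map -/

variable {s t : ℝ}

open QSqrt5 in
theorem shapeC_mem_QSqrt5_iff (hst : (s, t) ∈ paramTriangle) :
    shapeC s t ∈ QSqrt5 ↔ s ∈ QSqrt5 := by
  have hα : α ∈ QSqrt5 := ⟨0, 1, by simp⟩
  have hω := pow_mem ω_mem 7
  have hβ := pow_mem β_mem 3
  have h0 := ω_pos.ne'
  have h1 := α_pos.ne'
  rw [shapeC_eq hst]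
  refine ⟨fun h => ?_, fun h => mul_mem hω (add_mem (mul_mem hα h) hβ)⟩
  have : s = (ω ^ 7 * (α * s + β ^ 3) * (ω ^ 7)⁻¹ - β ^ 3) * α⁻¹ := by field_simp; ring
  rw [this]
  exact mul_mem (sub_mem (mul_mem h (inv_mem hω)) hβ) (inv_mem hα)

theorem recursivelyTiles_domC (hst : (s, t) ∈ paramTriangle) :
    (domC s t).RecursivelyTiles (rhombus s t) := by
  obtain ⟨p, hp, h⟩ := exists_positive_of_mem hst
  exact ⟨_, _, _, (periodicFamily_rhombus hp h).periodic,
    tiledBy_rhombus hp h (isSubdomain_domC hp h) rfl ((models_vC hp h).ontoDom hp ontoBC)⟩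

theorem merging (hst : (s, t) ∈ paramTriangle) : (domC s t).IsSubdomain (rhombus s t) ∧
    shapeC s t = ω ^ 7 * (α * s + β ^ 3) ∧ 0 < shapeC s t ∧ shapeC s t < 1 ∧
    DressedDomain.Similar (base (true, shapeC s t)) (domC s t) := by
  obtain ⟨p, hp, h⟩ := exists_positive_of_mem hst
  exact ⟨isSubdomain_domC hp h, shapeC_eq hst, (shapeC_mem hst).1, (shapeC_mem hst).2,
    shapeC_eq hst ▸ similar_domC hst⟩

theorem selfSimilarVia_iff (hst : (s, t) ∈ paramTriangle) :
    DressedDomain.SelfSimilarVia (rhombus s t) (domC s t) base baseParam baseRenorm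
      (true, shapeC s t) ↔ s ∈ QSqrt5 := by
  have hq : (true, shapeC s t) ∈ baseParam := Or.inl (shapeC_mem hst)
  rw [← shapeC_mem_QSqrt5_iff hst, ← eventually_periodic_iff hq]
  obtain ⟨h1, -, -, -, h5⟩ := merging hst
  exact ⟨fun h => h.2.2.2.2.2, fun h =>
    ⟨h1, recursivelyTiles_domC hst, h5, renormalizableVia_base, hq, h⟩⟩

end

end RhombusPWI

open RhombusPWI RhombusPWI.DressedDomain in
theorem mainTheorem2 :
    -- The bifurcation-free set of `𝒜` is the triangle, and `ℛ` has no bifurcation over it.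
    (bifurcationFree atomA = paramTriangle ∧ paramTriangle ⊆ bifurcationFree rhombusAtom) ∧
    -- Triple induction: `ℛ ▷ ℛ₃ ▷ ℛ₃₁ ▷ 𝒜`, where `R₃` is an atom of `ℛ` and `R₃₁` a triangle.
    (∃ T : ParamTile, T.length = 3 ∧ T.OverQSqrt5 ∧ ∀ s t : ℝ, (s, t) ∈ paramTriangle →
      (rhombus s t).IsDressed ∧
      (∃ (n₁ n₂ : ℕ) (X₁ : DressedDomain n₁) (X₂ : DressedDomain n₂),
        X₁.dom = (rhombus s t).atom 2 ∧ X₂.dom = (T.at s t).carrier ∧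
        (domA s t).dom ⊂ X₂.dom ∧ X₂.dom ⊂ X₁.dom ∧
        X₁.IsSubdomain (rhombus s t) ∧ X₂.IsSubdomain X₁ ∧ (domA s t).IsSubdomain X₂) ∧
      (domA s t).IsSubdomain (rhombus s t)) ∧
    -- The return orbits of the eight atoms (along eight distinct paths) and those of 13 periodic
    -- tiles (along 13 distinct cyclic paths) tile the rhombus; likewise for `𝒞` instead of `𝒜`.
    (∃ (w : Fin 8 → List (Fin 5)) (P : Fin 13 → ParamTile) (v : Fin 13 → List (Fin 5)),
      Function.Injective w ∧ (∀ k, k < 4 → (w k).length = 78) ∧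
      (∀ i j, i ≠ j → ¬ (v i).IsRotated (v j)) ∧ (∀ j, (P j).OverQSqrt5) ∧
      ∀ s t : ℝ, (s, t) ∈ paramTriangle →
        (∀ k, (rhombus s t).HasReturnPath (domA s t).dom ((domA s t).atom k) (w k)) ∧
        (∀ j, (rhombus s t).IsPeriodicTile ((P j).at s t).carrier (v j) ∧
          (interior ((P j).at s t).carrier).Nonempty) ∧
        (rhombus s t).TiledBy (domA s t) (fun j => ((P j).at s t).carrier)
          (fun j => (v j).length) ∧
        (rhombus s t).TiledBy (domC s t) (fun j => ((P j).at s t).carrier)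
          (fun j => (v j).length)) ∧
    -- After merging, `𝒞` is a dressed sub-domain of `ℛ` similar to a base triangle.
    (∀ s t : ℝ, (s, t) ∈ paramTriangle →
      (domC s t).IsSubdomain (rhombus s t) ∧
      shapeC s t = ω ^ 7 * (α * s + β ^ 3) ∧ 0 < shapeC s t ∧ shapeC s t < 1 ∧
      Similar (base (true, shapeC s t)) (domC s t)) ∧
    -- The base triangles are renormalizable.
    RenormalizableVia base baseParam baseRenorm ∧
    -- `ℛ` is self-similar (through `𝒞` and the base triangle) if and only if `s ∈ ℚ(√5)`.
    (∀ s t : ℝ, (s, t) ∈ paramTriangle →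
      (SelfSimilarVia (rhombus s t) (domC s t) base baseParam baseRenorm (true, shapeC s t) ↔
        s ∈ QSqrt5)) := by
  exact ⟨⟨bifurcationFree_atomA, paramTriangle_subset_rhombus⟩, triple_induction, tiling,
    fun _ _ h => merging h, renormalizableVia_base, fun _ _ h => selfSimilarVia_iff h⟩
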